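/- Throughout, $\mathbb F$ is $\mathbb R$ or $\mathbb C$. **C\*-categories.** A small (not necessarily unital) C\*-category $\mathcal A$ consists of a set of objects, a Banach space $\operatorname{Hom}(A,B)$ over $\mathbb F$ for all objects $A,B$, an associative bilinear composition with $\|xy\|\le\|x\|\,\|y\|$, and a conjugate-linear involution $\operatorname{Hom}(A,B)\to\operatorname{Hom}(B,A)$, $x\mapsto x^*$, with $(xy)^*=y^*x^*$, $x^{**}=x$ and $\|x^*x\|=\|x\|^2$, such that $x^*x$ is a positive element of $\operatorname{Hom}(A,A)$ for every $x\in\operatorname{Hom}(A,B)$. It is unital if every object has an identity morphism. It is graded if each $\operatorname{Hom}(A,B)$ is a direct sum of subspaces of morphisms of degree $0$ and of degree $1$, degrees (mod 2) being additive under composition and preserved by the involution. Graded C\*-functors are functors that are linear on morphisms and preserve the involution and degrees; between unital categories they also preserve identities. A direct limit of a directed family is its colimit in the category of small (unital, respectively not necessarily unital) graded C\*-categories and graded C\*-functors. **$K$-theory.** Let $\mathcal A$ be a small unital graded C\*-category. Its additive completion $\mathcal A_\oplus$ has as objects the finite formal sums of objects of $\mathcal A$, and as morphisms the matrices of morphisms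 of $\mathcal A$, with the topology of entrywise convergence. For an object $A$ of $\mathcal A_\oplus$ let $SS(A)=\{x\in\operatorname{Hom}(A,A)_1 : x=x^*,\ x^2=1\}$. Let $V_1(\mathcal A)$ be the abelian semigroup generated by the path components $\langle x\rangle$ of all the spaces $SS(A)$, with addition $\langle x\rangle+\langle y\rangle=\langle x\oplus y\rangle$ and with $\langle x\oplus y\rangle=\langle y\oplus x\rangle$; let $G_1(\mathcal A)$ be its Grothendieck group and $$D(\mathcal A)=\{\langle x\rangle-\langle y\rangle\in G_1(\mathcal A) : x,y\in SS(A),\ A\in\operatorname{Ob}(\mathcal A_\oplus)\}.$$ If all the spaces $SS(A)$ are non-empty, $D(\mathcal A)$ is the group $K_1(\mathcal A)$. In general one puts $K_1(\mathcal A)=D(\mathcal A\mathbin{\hat\otimes}\mathbb F_{1,1})$, where $\hat\otimes$ is the graded tensor product and $\mathbb F_{p,q}$ is the Clifford algebra generated by $p+q$ anticommuting unitary elements of degree $1$, of which $p$ have square $1$ and $q$ have square $-1$. If $\mathcal A$ is not necessarily unital, let $\mathcal A^+$ be its unitization, obtained by adding $\mathbb F\cdot 1$ (of degree $0$) to every endomorphism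 algebra $\operatorname{Hom}(A,A)$, and let $\mathbb F_{\mathcal A}$ be the category with the same objects, endomorphism algebras $\mathbb F$ and no other non-zero morphisms. One puts $K_1(\mathcal A)=\ker\bigl(K_1(\mathcal A^+)\to K_1(\mathbb F_{\mathcal A})\bigr)$. In both cases $K_n(\mathcal A)=K_1(\mathcal A\mathbin{\hat\otimes}\mathbb F_{p,q})$ for $n=1-(p-q)$. **Theorem.** Let $(\mathcal A_i,\phi_{ij})$ be a family of small graded C\*-categories indexed by a non-empty directed set, with direct limit $\mathcal A_\infty$ and structure functors $\phi_i\colon\mathcal A_i\to\mathcal A_\infty$. 1. Suppose that the $\mathcal A_i$ and the $\phi_{ij}$ are unital and that the direct limit is taken among small unital graded C\*-categories. Then, through the maps ${\phi_i}_*$, the group $D(\mathcal A_\infty)$ is the direct limit of the groups $D(\mathcal A_i)$, the group $K_1(\mathcal A_\infty)$ is the direct limit of the groups $K_1(\mathcal A_i)$, and $K_1(\mathcal A_\infty\mathbin{\hat\otimes}\mathbb F_{p,q})$ is the direct limit of the groups $K_1(\mathcal A_i\mathbin{\hat\otimes}\mathbb F_{p,q})$ for all $p,q\ge 0$; that is,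 $K_n(\mathcal A_\infty)=\varinjlim K_n(\mathcal A_i)$ for all $n\in\mathbb Z$. 2. Suppose that the $\mathcal A_i$ are not necessarily unital and that the direct limit is taken among small, not necessarily unital, graded C\*-categories. Then, through the maps ${\phi_i}_*$, the group $K_1(\mathcal A_\infty)$ is the direct limit of the groups $K_1(\mathcal A_i)$, and $K_1(\mathcal A_\infty\mathbin{\hat\otimes}\mathbb F_{p,q})$ is the direct limit of the groups $K_1(\mathcal A_i\mathbin{\hat\otimes}\mathbb F_{p,q})$ for all $p,q\ge 0$; that is, $K_n(\mathcal A_\infty)=\varinjlim K_n(\mathcal A_i)$ for all $n\in\mathbb Z$. -/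

import Mathlib

universe u

namespace GradedCStar

open Filter Topology CategoryTheory

section AutomaticContinuity
variable {A B : Type*}
  [NonUnitalNormedRing A] [NormedSpace ℝ A] [IsScalarTower ℝ A A] [SMulCommClass ℝ A A]
  [CompleteSpace A]
  [NonUnitalNormedRing B] [NormedSpace ℝ B] [IsScalarTower ℝ B B] [SMulCommClass ℝ B B]

/-- An isometric representation of `B` in a complex Banach algebra. -/
structure IsRep {R : Type*} [NormedRing R] [NormedAlgebra ℂ R] (ρ : B → R) : Prop where
  add : ∀ a b, ρ (a + b) = ρ a + ρ b
  mul : ∀ a b, ρ (a * b) = ρ a * ρ b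
  zero : ρ 0 = 0
  smul : ∀ (t : ℝ) b, ρ (t • b) = (t : ℂ) • ρ b
  norm : ∀ b, ‖ρ b‖ = ‖b‖

lemma one_add_mul_one_add {R : Type*} [Ring R] {p q : R} (h : p * q + q + p = 0) :
    (1 + p) * (1 + q) = 1 := by
  have e : (1 + p) * (1 + q) = 1 + (p * q + q + p) := by noncomm_ring
  rw [e, h, add_zero]

/-- Right multiplication by `b`, acting on the complex-valued functionals on `B`. -/
noncomputable def regRep (b : B) : (B →L[ℝ] ℂ) →L[ℂ] (B →L[ℝ] ℂ) :=
  LinearMap.mkContinuous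
    { toFun := fun φ => φ.comp ((ContinuousLinearMap.mul ℝ B).flip b)
      map_add' := fun _ _ => rfl
      map_smul' := fun _ _ => rfl } ‖b‖ (by
    intro φ
    refine ContinuousLinearMap.opNorm_le_bound _ (by positivity) fun x => ?_
    calc ‖φ (x * b)‖ ≤ ‖φ‖ * ‖x * b‖ := φ.le_opNorm _
      _ ≤ ‖φ‖ * (‖x‖ * ‖b‖) := by gcongr; exact norm_mul_le _ _
      _ = ‖b‖ * ‖φ‖ * ‖x‖ := by ring)

lemma regRep_apply (b : B) (φ : B →L[ℝ] ℂ) (x : B) : regRep b φ x = φ (x * b) := rfl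

lemma regRep_mul (a b : B) : regRep (a * b) = regRep a * regRep b := by
  ext φ x; simp [regRep_apply, mul_assoc]

lemma regRep_add (a b : B) : regRep (a + b) = regRep a + regRep b := by
  ext φ x; simp [regRep_apply, mul_add]

lemma regRep_zero : regRep (0 : B) = 0 := by
  ext φ x; simp [regRep_apply]

lemma regRep_smul (t : ℝ) (b : B) : regRep (t • b) = (t : ℂ) • regRep b := by
  ext φ x; simp [regRep_apply, mul_smul_comm]

variable [StarRing B] [CStarRing B]

lemma norm_regRep (b : B) : ‖regRep b‖ = ‖b‖ := by
  apply le_antisymm (LinearMap.mkContinuous_norm_le _ (norm_nonneg _) _)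
  rcases eq_or_ne b 0 with rfl | hb
  · simp
  obtain ⟨g, hg1, hg2⟩ := exists_dual_vector'' ℝ (star b * b)
  let φ : B →L[ℝ] ℂ := Complex.ofRealCLM.comp g
  have hφ : ‖φ‖ ≤ 1 := by
    refine ContinuousLinearMap.opNorm_le_bound _ (by norm_num) fun x => ?_
    have := g.le_of_opNorm_le hg1 x
    simpa [φ] using this
  have h1 : ‖regRep b φ (star b)‖ = ‖b‖ * ‖b‖ := by
    rw [regRep_apply]
    simp [φ, hg2, CStarRing.norm_star_mul_self]
  have h2 : ‖regRep b φ (star b)‖ ≤ ‖regRep b‖ * ‖b‖ := by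
    calc _ ≤ ‖regRep b φ‖ * ‖star b‖ := ContinuousLinearMap.le_opNorm _ _
      _ ≤ (‖regRep b‖ * ‖φ‖) * ‖star b‖ := by gcongr; exact ContinuousLinearMap.le_opNorm _ _
      _ ≤ (‖regRep b‖ * 1) * ‖star b‖ := by gcongr
      _ = _ := by rw [norm_star, mul_one]
  rw [h1] at h2
  exact le_of_mul_le_mul_right h2 (norm_pos_iff.mpr hb)

lemma norm_rep_pow {R : Type*} [NormedRing R] [NormedAlgebra ℂ R] {ρ : B → R}
    (hρ : IsRep ρ) (k : ℕ) : ∀ b : B, star b = b → ‖ρ b ^ 2 ^ k‖ = ‖b‖ ^ 2 ^ k := by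
  induction k with
  | zero => intro b _; simp [hρ.norm]
  | succ k ih =>
    intro b hb
    have h : star (b * b) = b * b := by rw [star_mul, hb]
    have hn : ‖b * b‖ = ‖b‖ ^ 2 := by
      have := CStarRing.norm_star_mul_self (x := b)
      rwa [hb, ← sq] at this
    rw [pow_succ', pow_mul, sq, ← hρ.mul, ih _ h, hn, ← pow_mul]

lemma spectralRadius_rep {R : Type*} [NormedRing R] [NormedAlgebra ℂ R] [CompleteSpace R]
    {ρ : B → R} (hρ : IsRep ρ) (b : B) (hb : star b = b) :
    spectralRadius ℂ (ρ b) = ‖b‖₊ := by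
  have h := spectrum.pow_nnnorm_pow_one_div_tendsto_nhds_spectralRadius (ρ b)
  have h2 : Tendsto (fun k : ℕ => 2 ^ k) atTop atTop :=
    tendsto_pow_atTop_atTop_of_one_lt (by norm_num)
  have h3 := h.comp h2
  refine tendsto_nhds_unique h3 ?_
  refine (tendsto_const_nhds (x := (‖b‖₊ : ENNReal))).congr fun k => ?_
  have : ‖ρ b ^ 2 ^ k‖₊ = ‖b‖₊ ^ 2 ^ k := by
    ext; simpa using norm_rep_pow hρ k b hb
  simp only [Function.comp_apply, this]
  rw [ENNReal.coe_pow, ← ENNReal.rpow_natCast, ← ENNReal.rpow_mul]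
  simp

/-- If `x^* x` is positive for all `x ∈ B`, some real number of modulus `‖b‖` lies in the spectrum
of a self-adjoint element `b`. -/
lemma exists_real_mem_spectrum_rep [StarModule ℝ B]
    {R : Type*} [NormedRing R] [NormedAlgebra ℂ R] [CompleteSpace R]
    {ρ : B → R} (hρ : IsRep ρ)
    (hB : ∀ x : B, ∃ q : B, star x * x * q + q + star x * x = 0 ∧
      q * (star x * x) + q + star x * x = 0)
    (b : B) (hb : star b = b) (hb0 : b ≠ 0) :
    ∃ t : ℝ, |t| = ‖b‖ ∧ (t : ℂ) ∈ spectrum ℂ (ρ b) := by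
  have : Nontrivial R := by
    refine ⟨ρ b, 0, fun h => hb0 ?_⟩
    have := hρ.norm b
    rw [h, norm_zero] at this
    exact norm_eq_zero.mp this.symm
  obtain ⟨z, hz, hzr⟩ := spectrum.exists_nnnorm_eq_spectralRadius (ρ b)
  rw [spectralRadius_rep hρ b hb] at hzr
  have hzn : ‖z‖ = ‖b‖ := by
    have := ENNReal.coe_injective hzr
    simpa using congrArg NNReal.toReal this
  have him : z.im = 0 := by
    by_contra him
    obtain ⟨u, v, huv⟩ : ∃ u v : ℝ, (u : ℂ) * z ^ 2 + v * z = Complex.I := by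
      have hns : z.re ^ 2 + z.im ^ 2 ≠ 0 := by positivity
      obtain ⟨u, v, h1, h2⟩ : ∃ u v : ℝ, u * (z.re ^ 2 - z.im ^ 2) + v * z.re = 0 ∧
          u * (2 * z.re * z.im) + v * z.im = 1 := by
        refine ⟨z.re / (z.im * (z.re ^ 2 + z.im ^ 2)),
          -((z.re ^ 2 - z.im ^ 2) / (z.im * (z.re ^ 2 + z.im ^ 2))), ?_, ?_⟩
        · field_simp; ring
        · field_simp; ring
      refine ⟨u, v, ?_⟩
      apply Complex.ext
      · simp [sq]; linarith
      · simp [sq]; linarith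
    set x : B := u • (b * b) + v • b with hx
    have hxs : star x = x := by
      simp [hx, star_smul, hb]
    obtain ⟨q, hq1, hq2⟩ := hB x
    rw [hxs] at hq1 hq2
    have e1 : (1 + ρ x * ρ x) * (1 + ρ q) = 1 := by
      apply one_add_mul_one_add
      rw [← hρ.mul, ← hρ.mul, ← hρ.add, ← hρ.add, hq1, hρ.zero]
    have e2 : (1 + ρ q) * (1 + ρ x * ρ x) = 1 := by
      apply one_add_mul_one_add
      rw [← hρ.mul, ← hρ.mul, ← hρ.add, ← hρ.add, ← hρ.zero, ← hq2]
      congr 1; abel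
    have hu : IsUnit (1 + ρ x * ρ x) := ⟨⟨_, _, e1, e2⟩, rfl⟩
    let p : Polynomial ℂ := (Polynomial.C (u : ℂ) * Polynomial.X ^ 2 +
      Polynomial.C (v : ℂ) * Polynomial.X) ^ 2 + 1
    have hp : Polynomial.aeval (ρ b) p = 1 + ρ x * ρ x := by
      simp only [p, hx, hρ.add, hρ.smul, hρ.mul, map_add, map_mul, map_one,
        Polynomial.aeval_C, Polynomial.aeval_X, Algebra.algebraMap_eq_smul_one, smul_mul_assoc,
        one_mul, sq]
      abel
    have h0 : (0 : ℂ) ∈ spectrum ℂ (Polynomial.aeval (ρ b) p) := by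
      refine spectrum.subset_polynomial_aeval _ _ ⟨z, hz, ?_⟩
      simp [p, huv]
    rw [hp] at h0
    exact spectrum.zero_notMem ℂ hu h0
  have hzr : z = (z.re : ℂ) := by apply Complex.ext <;> simp [him]
  refine ⟨z.re, ?_, hzr ▸ hz⟩
  rw [← hzn, hzr]; simp

lemma exists_left_quasiInverse (a : A) (ha : ‖a‖ < 1) : ∃ q : A, q - a * q = a := by
  have h : ‖ContinuousLinearMap.mul ℝ A a‖ < 1 :=
    lt_of_le_of_lt (ContinuousLinearMap.opNorm_mul_apply_le ℝ A a) ha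
  let w := Units.oneSub _ h
  refine ⟨(↑w⁻¹ : A →L[ℝ] A) a, ?_⟩
  have := congrArg (fun T : A →L[ℝ] A => T a) w.mul_inv
  simpa [w, Units.val_oneSub] using this

lemma exists_right_quasiInverse (a : A) (ha : ‖a‖ < 1) : ∃ q : A, q - q * a = a := by
  have h : ‖(ContinuousLinearMap.mul ℝ A).flip a‖ < 1 := by
    refine lt_of_le_of_lt (ContinuousLinearMap.opNorm_le_bound _ (norm_nonneg _) fun x => ?_) ha
    rw [ContinuousLinearMap.flip_apply, ContinuousLinearMap.mul_apply', mul_comm ‖a‖]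
    exact norm_mul_le _ _
  let w := Units.oneSub _ h
  refine ⟨(↑w⁻¹ : A →L[ℝ] A) a, ?_⟩
  have := congrArg (fun T : A →L[ℝ] A => T a) w.mul_inv
  simpa [w, Units.val_oneSub] using this

lemma norm_map_le_of_rep [StarRing A] [StarModule ℝ B]
    {R : Type*} [NormedRing R] [NormedAlgebra ℂ R] [CompleteSpace R]
    {ρ : B → R} (hρ : IsRep ρ)
    (hB : ∀ x : B, ∃ q : B, star x * x * q + q + star x * x = 0 ∧
      q * (star x * x) + q + star x * x = 0)
    (f : A →⋆ₙₐ[ℝ] B) (a : A) (ha : star a = a) : ‖f a‖ ≤ ‖a‖ := by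
  by_contra hlt
  push Not at hlt
  have hb0 : f a ≠ 0 := by
    intro h; rw [h, norm_zero] at hlt; exact absurd hlt (not_lt.mpr (norm_nonneg _))
  obtain ⟨t, ht, hts⟩ := exists_real_mem_spectrum_rep hρ hB (f a) (by rw [← map_star, ha]) hb0
  have htpos : 0 < |t| := by rw [ht]; exact norm_pos_iff.mpr hb0
  have ht0 : t ≠ 0 := abs_pos.mp htpos
  have hlt' : ‖t⁻¹ • a‖ < 1 := by
    rw [norm_smul, norm_inv, Real.norm_eq_abs, ← div_eq_inv_mul, div_lt_one htpos, ht]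
    exact hlt
  obtain ⟨q, hq⟩ := exists_left_quasiInverse _ hlt'
  obtain ⟨r, hr⟩ := exists_right_quasiInverse _ hlt'
  have hfa : f (t⁻¹ • a) = t⁻¹ • f a := map_smul f _ _
  have e1 : (1 + -ρ (f (t⁻¹ • a))) * (1 + ρ (f q)) = 1 := by
    apply one_add_mul_one_add
    have h : f q - f (t⁻¹ • a) * f q = f (t⁻¹ • a) := by rw [← map_mul, ← map_sub, hq]
    have h' := congrArg ρ (sub_eq_iff_eq_add.mp h)
    rw [hρ.add, hρ.mul] at h'
    generalize ρ (f (t⁻¹ • a)) = P at h' ⊢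
    calc -P * ρ (f q) + ρ (f q) + -P = ρ (f q) - (P + P * ρ (f q)) := by noncomm_ring
      _ = 0 := sub_eq_zero.mpr h'
  have e2 : (1 + ρ (f r)) * (1 + -ρ (f (t⁻¹ • a))) = 1 := by
    apply one_add_mul_one_add
    have h : f r - f r * f (t⁻¹ • a) = f (t⁻¹ • a) := by rw [← map_mul, ← map_sub, hr]
    have h' := congrArg ρ (sub_eq_iff_eq_add.mp h)
    rw [hρ.add, hρ.mul] at h'
    generalize ρ (f (t⁻¹ • a)) = P at h' ⊢
    calc ρ (f r) * -P + -P + ρ (f r) = ρ (f r) - (P + ρ (f r) * P) := by noncomm_ring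
      _ = 0 := sub_eq_zero.mpr h'
  have hu : IsUnit (1 + -ρ (f (t⁻¹ • a))) := by
    have := left_inv_eq_right_inv e2 e1
    exact ⟨⟨_, _, e1, this ▸ e2⟩, rfl⟩
  apply hts
  have htc : (t : ℂ) ≠ 0 := by exact_mod_cast ht0
  have : algebraMap ℂ R (t : ℂ) - ρ (f a) =
      (t : ℂ) • (1 + -ρ (f (t⁻¹ • a))) := by
    rw [hfa, hρ.smul, smul_add, smul_neg, smul_smul, Algebra.algebraMap_eq_smul_one]
    push_cast
    rw [mul_inv_cancel₀ htc, one_smul, sub_eq_add_neg]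
  rw [spectrum.mem_resolventSet_iff, this]
  exact hu.smul (Units.mk0 (t : ℂ) htc)

/-- Star homomorphisms into (real or complex) C*-algebras do not increase the norm of self-adjoint
elements. -/
lemma norm_map_le_of_positive [StarRing A] [StarModule ℝ B]
    (hB : ∀ x : B, ∃ q : B, star x * x * q + q + star x * x = 0 ∧
      q * (star x * x) + q + star x * x = 0)
    (f : A →⋆ₙₐ[ℝ] B) (a : A) (ha : star a = a) : ‖f a‖ ≤ ‖a‖ :=
  norm_map_le_of_rep (R := (B →L[ℝ] ℂ) →L[ℂ] (B →L[ℝ] ℂ)) (ρ := regRep)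
    ⟨regRep_add, regRep_mul, regRep_zero, regRep_smul, norm_regRep⟩ hB f a ha

end AutomaticContinuity

/-! ### Graded C*-categories -/

/-- A (not necessarily unital) small graded C*-category over `𝕜 = ℝ` or `ℂ`.

`star_comp_self_pos` says that `p = x^* x` is a positive element of the C*-algebra `Hom X X`: for
every `t > 0` the element `p + t` is invertible in the unitization, with inverse `t⁻¹ + r`. -/
structure GCStarCat (𝕜 : Type) [RCLike 𝕜] : Type (u + 1) where
  Ob : Type u
  Hom : Ob → Ob → Type u
  [normedAddCommGroup : ∀ X Y, NormedAddCommGroup (Hom X Y)]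
  [normedSpace : ∀ X Y, NormedSpace 𝕜 (Hom X Y)]
  [completeSpace : ∀ X Y, CompleteSpace (Hom X Y)]
  comp : ∀ {X Y Z}, Hom Y Z → Hom X Y → Hom X Z
  comp_add : ∀ {X Y Z} (x : Hom Y Z) (y y' : Hom X Y), comp x (y + y') = comp x y + comp x y'
  add_comp : ∀ {X Y Z} (x x' : Hom Y Z) (y : Hom X Y), comp (x + x') y = comp x y + comp x' y
  comp_smul : ∀ {X Y Z} (c : 𝕜) (x : Hom Y Z) (y : Hom X Y), comp x (c • y) = c • comp x y
  smul_comp : ∀ {X Y Z} (c : 𝕜) (x : Hom Y Z) (y : Hom X Y), comp (c • x) y = c • comp x y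
  assoc : ∀ {W X Y Z} (x : Hom Y Z) (y : Hom X Y) (z : Hom W X),
    comp (comp x y) z = comp x (comp y z)
  star : ∀ {X Y}, Hom X Y → Hom Y X
  star_add : ∀ {X Y} (x y : Hom X Y), star (x + y) = star x + star y
  star_smul : ∀ {X Y} (c : 𝕜) (x : Hom X Y), star (c • x) = starRingEnd 𝕜 c • star x
  star_comp : ∀ {X Y Z} (x : Hom Y Z) (y : Hom X Y), star (comp x y) = comp (star y) (star x)
  star_star : ∀ {X Y} (x : Hom X Y), star (star x) = x
  norm_comp_le : ∀ {X Y Z} (x : Hom Y Z) (y : Hom X Y), ‖comp x y‖ ≤ ‖x‖ * ‖y‖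
  norm_star_comp_self : ∀ {X Y} (x : Hom X Y), ‖comp (star x) x‖ = ‖x‖ ^ 2
  star_comp_self_pos : ∀ {X Y} (x : Hom X Y) (t : ℝ), 0 < t → ∃ r : Hom X X,
    comp (comp (star x) x) r + (t : 𝕜) • r + (t⁻¹ : 𝕜) • comp (star x) x = 0 ∧
    comp r (comp (star x) x) + (t : 𝕜) • r + (t⁻¹ : 𝕜) • comp (star x) x = 0
  /-- the morphisms of a given degree -/
  deg : ∀ X Y, ZMod 2 → Submodule 𝕜 (Hom X Y)
  isCompl_deg : ∀ X Y, IsCompl (deg X Y 0) (deg X Y 1)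
  comp_mem_deg : ∀ {X Y Z} {a b : ZMod 2} {x : Hom Y Z} {y : Hom X Y},
    x ∈ deg Y Z a → y ∈ deg X Y b → comp x y ∈ deg X Z (a + b)
  star_mem_deg : ∀ {X Y} {a : ZMod 2} {x : Hom X Y}, x ∈ deg X Y a → star x ∈ deg Y X a

attribute [instance] GCStarCat.normedAddCommGroup GCStarCat.normedSpace GCStarCat.completeSpace

/-- A small unital graded C*-category. -/
structure UGCStarCat (𝕜 : Type) [RCLike 𝕜] : Type (u + 1) extends GCStarCat.{u} 𝕜 where
  one : ∀ X, Hom X X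
  one_comp : ∀ {X Y} (x : Hom X Y), comp (one Y) x = x
  comp_one : ∀ {X Y} (x : Hom X Y), comp x (one X) = x

variable {𝕜 : Type} [RCLike 𝕜]

/-- A graded C*-functor. -/
structure GCStarFun (A B : GCStarCat.{u} 𝕜) : Type u where
  obj : A.Ob → B.Ob
  map : ∀ {X Y}, A.Hom X Y →ₗ[𝕜] B.Hom (obj X) (obj Y)
  map_comp : ∀ {X Y Z} (x : A.Hom Y Z) (y : A.Hom X Y), map (A.comp x y) = B.comp (map x) (map y)
  map_star : ∀ {X Y} (x : A.Hom X Y), map (A.star x) = B.star (map x)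
  map_mem_deg : ∀ {X Y} {a : ZMod 2} {x : A.Hom X Y}, x ∈ A.deg X Y a → map x ∈ B.deg _ _ a

/-- A unital graded C*-functor. -/
structure UGCStarFun (A B : UGCStarCat.{u} 𝕜) : Type u
    extends GCStarFun A.toGCStarCat B.toGCStarCat where
  map_one : ∀ X, map (A.one X) = B.one (obj X)

/-- The category of small graded C*-categories. -/
instance : Category (GCStarCat.{u} 𝕜) where
  Hom := GCStarFun
  id A := ⟨id, LinearMap.id, fun _ _ => rfl, fun _ => rfl, fun h => h⟩
  comp f g := ⟨g.obj ∘ f.obj, g.map.comp f.map,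
    fun x y => by simp [f.map_comp, g.map_comp], fun x => by simp [f.map_star, g.map_star],
    fun h => g.map_mem_deg (f.map_mem_deg h)⟩

/-- The category of small unital graded C*-categories. -/
instance : Category (UGCStarCat.{u} 𝕜) where
  Hom := UGCStarFun
  id A := ⟨𝟙 A.toGCStarCat, fun _ => rfl⟩
  comp f g := ⟨CategoryStruct.comp (obj := GCStarCat.{u} 𝕜) f.toGCStarFun g.toGCStarFun,
    fun X => (congrArg g.map (f.map_one X)).trans (g.map_one _)⟩

/-! ### Graded ⋆-categories with topological morphism sets

Only the topology of the morphism sets enters the definition of `K₁`. The additive completion and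
the tensor products with Clifford algebras are therefore formed with their entrywise topology, which
is the topology of their C*-norm. -/

/-- A (not necessarily unital) small graded ⋆-category with topologized morphism sets. The grading is
recorded by the parity operator, which is `1` on morphisms of degree `0` and `-1` on morphisms of
degree `1`. -/
structure TStarCat (𝕜 : Type) [RCLike 𝕜] : Type (u + 1) where
  Ob : Type u
  Hom : Ob → Ob → Type u
  [addCommGroup : ∀ X Y, AddCommGroup (Hom X Y)]
  [module : ∀ X Y, Module 𝕜 (Hom X Y)]
  [topologicalSpace : ∀ X Y, TopologicalSpace (Hom X Y)]
  comp : ∀ {X Y Z}, Hom Y Z → Hom X Y → Hom X Z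
  comp_add : ∀ {X Y Z} (x : Hom Y Z) (y y' : Hom X Y), comp x (y + y') = comp x y + comp x y'
  add_comp : ∀ {X Y Z} (x x' : Hom Y Z) (y : Hom X Y), comp (x + x') y = comp x y + comp x' y
  comp_smul : ∀ {X Y Z} (c : 𝕜) (x : Hom Y Z) (y : Hom X Y), comp x (c • y) = c • comp x y
  smul_comp : ∀ {X Y Z} (c : 𝕜) (x : Hom Y Z) (y : Hom X Y), comp (c • x) y = c • comp x y
  assoc : ∀ {W X Y Z} (x : Hom Y Z) (y : Hom X Y) (z : Hom W X),
    comp (comp x y) z = comp x (comp y z)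
  star : ∀ {X Y}, Hom X Y → Hom Y X
  star_add : ∀ {X Y} (x y : Hom X Y), star (x + y) = star x + star y
  star_smul : ∀ {X Y} (c : 𝕜) (x : Hom X Y), star (c • x) = starRingEnd 𝕜 c • star x
  star_comp : ∀ {X Y Z} (x : Hom Y Z) (y : Hom X Y), star (comp x y) = comp (star y) (star x)
  star_star : ∀ {X Y} (x : Hom X Y), star (star x) = x
  par : ∀ {X Y}, Hom X Y →ₗ[𝕜] Hom X Y
  par_par : ∀ {X Y} (x : Hom X Y), par (par x) = x
  par_comp : ∀ {X Y Z} (x : Hom Y Z) (y : Hom X Y), par (comp x y) = comp (par x) (par y)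
  par_star : ∀ {X Y} (x : Hom X Y), par (star x) = star (par x)

attribute [instance] TStarCat.addCommGroup TStarCat.module TStarCat.topologicalSpace

/-- The unital version of `TStarCat`. -/
structure UTStarCat (𝕜 : Type) [RCLike 𝕜] : Type (u + 1) extends TStarCat.{u} 𝕜 where
  one : ∀ X, Hom X X
  one_comp : ∀ {X Y} (x : Hom X Y), comp (one Y) x = x
  comp_one : ∀ {X Y} (x : Hom X Y), comp x (one X) = x

/-- A continuous linear graded ⋆-functor. -/
structure TStarFun (A B : TStarCat.{u} 𝕜) : Type u where
  obj : A.Ob → B.Ob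
  map : ∀ {X Y}, A.Hom X Y →ₗ[𝕜] B.Hom (obj X) (obj Y)
  map_comp : ∀ {X Y Z} (x : A.Hom Y Z) (y : A.Hom X Y), map (A.comp x y) = B.comp (map x) (map y)
  map_star : ∀ {X Y} (x : A.Hom X Y), map (A.star x) = B.star (map x)
  map_par : ∀ {X Y} (x : A.Hom X Y), map (A.par x) = B.par (map x)
  continuous_map : ∀ {X Y}, Continuous (map : A.Hom X Y → B.Hom (obj X) (obj Y))

/-- A unital continuous linear graded ⋆-functor. -/
structure UTStarFun (A B : UTStarCat.{u} 𝕜) : Type u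
    extends TStarFun A.toTStarCat B.toTStarCat where
  map_one : ∀ X, map (A.one X) = B.one (obj X)

instance : Category (TStarCat.{u} 𝕜) where
  Hom := TStarFun
  id A := ⟨id, LinearMap.id, fun _ _ => rfl, fun _ => rfl, fun _ => rfl, continuous_id⟩
  comp f g := ⟨g.obj ∘ f.obj, g.map.comp f.map,
    fun x y => by simp [f.map_comp, g.map_comp], fun x => by simp [f.map_star, g.map_star],
    fun x => by simp [f.map_par, g.map_par], g.continuous_map.comp f.continuous_map⟩

instance : Category (UTStarCat.{u} 𝕜) where
  Hom := UTStarFun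
  id A := ⟨𝟙 A.toTStarCat, fun _ => rfl⟩
  comp f g := ⟨CategoryStruct.comp (obj := TStarCat.{u} 𝕜) f.toTStarFun g.toTStarFun,
    fun X => (congrArg g.map (f.map_one X)).trans (g.map_one _)⟩

/-! ### The topological ⋆-category underlying a C*-category -/

namespace GCStarCat

/-- The C*-algebra of endomorphisms of an object. -/
abbrev endRing (A : GCStarCat.{u} 𝕜) (X : A.Ob) : NonUnitalNormedRing (A.Hom X X) :=
  { A.normedAddCommGroup X X with
    mul := fun x y => A.comp x y
    left_distrib := fun x y z => A.comp_add x y z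
    right_distrib := fun x y z => A.add_comp x y z
    zero_mul := fun x => by
      have := A.smul_comp 0 (0 : A.Hom X X) x
      rwa [zero_smul, zero_smul] at this
    mul_zero := fun x => by
      have := A.comp_smul 0 x (0 : A.Hom X X)
      rwa [zero_smul, zero_smul] at this
    mul_assoc := fun x y z => A.assoc x y z
    norm_mul_le := fun x y => A.norm_comp_le x y }

lemma norm_map_end_le {A B : GCStarCat.{u} 𝕜} (f : GCStarFun A B) {X : A.Ob} (a : A.Hom X X)
    (ha : A.star a = a) : ‖f.map a‖ ≤ ‖a‖ := by
  let := A.endRing X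
  let := B.endRing (f.obj X)
  let : NormedSpace ℝ (A.Hom X X) := NormedSpace.restrictScalars ℝ 𝕜 _
  let : NormedSpace ℝ (B.Hom (f.obj X) (f.obj X)) := NormedSpace.restrictScalars ℝ 𝕜 _
  have hA : ∀ (t : ℝ) (x : A.Hom X X), t • x = (t : 𝕜) • x := fun t x => by
    rw [← RCLike.real_smul_eq_coe_smul (K := 𝕜)]
  have hB : ∀ (t : ℝ) (x : B.Hom (f.obj X) (f.obj X)), t • x = (t : 𝕜) • x := fun t x => by
    rw [← RCLike.real_smul_eq_coe_smul (K := 𝕜)]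
  have : IsScalarTower ℝ (A.Hom X X) (A.Hom X X) := ⟨fun t x y => by
    rw [hA, hA]; exact A.smul_comp _ x y⟩
  have : SMulCommClass ℝ (A.Hom X X) (A.Hom X X) := ⟨fun t x y => by
    rw [hA, hA]; exact (A.comp_smul _ x y).symm⟩
  have : IsScalarTower ℝ (B.Hom (f.obj X) (f.obj X)) (B.Hom (f.obj X) (f.obj X)) :=
    ⟨fun t x y => by rw [hB, hB]; exact B.smul_comp _ x y⟩
  have : SMulCommClass ℝ (B.Hom (f.obj X) (f.obj X)) (B.Hom (f.obj X) (f.obj X)) :=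
    ⟨fun t x y => by rw [hB, hB]; exact (B.comp_smul _ x y).symm⟩
  let : StarRing (A.Hom X X) :=
    { star := fun x => A.star x, star_involutive := A.star_star, star_mul := A.star_comp,
      star_add := A.star_add }
  let : StarRing (B.Hom (f.obj X) (f.obj X)) :=
    { star := fun x => B.star x, star_involutive := B.star_star, star_mul := B.star_comp,
      star_add := B.star_add }
  have : CStarRing (B.Hom (f.obj X) (f.obj X)) :=
    ⟨fun x => by rw [← sq]; exact (B.norm_star_comp_self x).ge⟩
  have : StarModule ℝ (B.Hom (f.obj X) (f.obj X)) := ⟨fun t x => by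
    rw [hB, hB]; have := B.star_smul (t : 𝕜) x
    rw [RCLike.conj_ofReal] at this
    exact this⟩
  let F : A.Hom X X →⋆ₙₐ[ℝ] B.Hom (f.obj X) (f.obj X) :=
    { toFun := fun x => f.map x
      map_smul' := fun t x => by rw [hA]; exact (map_smul f.map _ _).trans (hB _ _).symm
      map_zero' := map_zero f.map
      map_add' := map_add f.map
      map_mul' := fun x y => f.map_comp x y
      map_star' := fun x => f.map_star x }
  refine norm_map_le_of_positive ?_ F a ha
  intro x
  obtain ⟨r, h1, h2⟩ := B.star_comp_self_pos x 1 one_pos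
  simp only [RCLike.ofReal_one, inv_one, one_smul] at h1 h2
  exact ⟨r, h1, h2⟩

/-- Every C*-functor is norm-decreasing. -/
lemma norm_map_le {A B : GCStarCat.{u} 𝕜} (f : GCStarFun A B) {X Y : A.Ob} (x : A.Hom X Y) :
    ‖f.map x‖ ≤ ‖x‖ := by
  have h := norm_map_end_le f (A.comp (A.star x) x) (by rw [A.star_comp, A.star_star])
  rw [f.map_comp, f.map_star, B.norm_star_comp_self, A.norm_star_comp_self] at h
  exact le_of_sq_le_sq h (norm_nonneg _)

variable (A : GCStarCat.{u} 𝕜)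

lemma exists_add_deg {X Y : A.Ob} (x : A.Hom X Y) :
    ∃ y ∈ A.deg X Y 0, ∃ z ∈ A.deg X Y 1, y + z = x :=
  Submodule.mem_sup.mp ((A.isCompl_deg X Y).sup_eq_top ▸ Submodule.mem_top)

/-- The parity operator of a grading. -/
noncomputable def par {X Y : A.Ob} : A.Hom X Y →ₗ[𝕜] A.Hom X Y :=
  Submodule.projection _ _ (A.isCompl_deg X Y) -
    Submodule.projection _ _ (A.isCompl_deg X Y).symm

lemma par_of_mem_zero {X Y : A.Ob} {x : A.Hom X Y} (hx : x ∈ A.deg X Y 0) : A.par x = x := by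
  rw [par, LinearMap.sub_apply, Submodule.projection_apply_of_mem_left _ hx,
    Submodule.projection_apply_of_mem_right _ hx, sub_zero]

lemma par_of_mem_one {X Y : A.Ob} {x : A.Hom X Y} (hx : x ∈ A.deg X Y 1) : A.par x = -x := by
  rw [par, LinearMap.sub_apply, Submodule.projection_apply_of_mem_left _ hx,
    Submodule.projection_apply_of_mem_right _ hx, zero_sub]

lemma star_neg {X Y : A.Ob} (x : A.Hom X Y) : A.star (-x) = -A.star x := by
  have := A.star_smul (-1) x
  simpa using this

/-- The topological graded ⋆-category underlying a C*-category. -/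
@[reducible] noncomputable def toTStarCat : TStarCat.{u} 𝕜 where
  Ob := A.Ob
  Hom := A.Hom
  comp := A.comp
  comp_add := A.comp_add
  add_comp := A.add_comp
  comp_smul := A.comp_smul
  smul_comp := A.smul_comp
  assoc := A.assoc
  star := A.star
  star_add := A.star_add
  star_smul := A.star_smul
  star_comp := A.star_comp
  star_star := A.star_star
  par := A.par
  par_par x := by
    obtain ⟨y, hy, z, hz, rfl⟩ := A.exists_add_deg x
    simp [A.par_of_mem_zero hy, A.par_of_mem_one hz]
  par_comp x x' := by
    obtain ⟨y, hy, z, hz, rfl⟩ := A.exists_add_deg x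
    obtain ⟨y', hy', z', hz', rfl⟩ := A.exists_add_deg x'
    have h1 := A.par_of_mem_zero (A.comp_mem_deg hy hy')
    have h2 := A.par_of_mem_one (A.comp_mem_deg hy hz')
    have h3 := A.par_of_mem_one (A.comp_mem_deg hz hy')
    have h4 := A.par_of_mem_zero (A.comp_mem_deg hz hz')
    have e1 := A.comp_smul (-1) y z'
    have e2 := A.smul_comp (-1) z y'
    have e3 := A.smul_comp (-1) z ((-1 : 𝕜) • z')
    have e4 := A.comp_smul (-1) z z'
    simp only [neg_smul, one_smul] at e1 e2 e3 e4
    simp only [map_add, A.comp_add, A.add_comp, h1, h2, h3, h4, A.par_of_mem_zero hy,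
      A.par_of_mem_zero hy', A.par_of_mem_one hz, A.par_of_mem_one hz', e1, e2, e3, e4, neg_neg]
  par_star x := by
    obtain ⟨y, hy, z, hz, rfl⟩ := A.exists_add_deg x
    simp only [map_add, A.star_add, A.par_of_mem_zero hy, A.par_of_mem_one hz,
      A.par_of_mem_zero (A.star_mem_deg hy), A.par_of_mem_one (A.star_mem_deg hz), A.star_neg]

end GCStarCat

lemma GCStarFun.map_par {A B : GCStarCat.{u} 𝕜} (f : GCStarFun A B) {X Y : A.Ob}
    (x : A.Hom X Y) : f.map (A.par x) = B.par (f.map x) := by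
  obtain ⟨y, hy, z, hz, rfl⟩ := A.exists_add_deg x
  simp only [map_add, A.par_of_mem_zero hy, A.par_of_mem_one hz, map_neg,
    B.par_of_mem_zero (f.map_mem_deg hy), B.par_of_mem_one (f.map_mem_deg hz)]

lemma GCStarFun.continuous_map {A B : GCStarCat.{u} 𝕜} (f : GCStarFun A B) {X Y : A.Ob} :
    Continuous (f.map : A.Hom X Y → B.Hom (f.obj X) (f.obj Y)) :=
  AddMonoidHomClass.continuous_of_bound f.map 1
    fun x => by simpa using GCStarCat.norm_map_le f x

/-- A graded C*-functor is a continuous graded ⋆-functor. -/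
noncomputable def GCStarFun.toTStarFun {A B : GCStarCat.{u} 𝕜} (f : GCStarFun A B) :
    TStarFun A.toTStarCat B.toTStarCat where
  obj := f.obj
  map := f.map
  map_comp := f.map_comp
  map_star := f.map_star
  map_par := f.map_par
  continuous_map := f.continuous_map

/-- The forgetful functor from small graded C*-categories. -/
noncomputable def forgetGC : GCStarCat.{u} 𝕜 ⥤ TStarCat.{u} 𝕜 where
  obj A := A.toTStarCat
  map f := GCStarFun.toTStarFun f

/-- The forgetful functor from small unital graded C*-categories. -/
noncomputable def forgetUGC : UGCStarCat.{u} 𝕜 ⥤ UTStarCat.{u} 𝕜 where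
  obj A := ⟨A.toTStarCat, A.one, A.one_comp, A.comp_one⟩
  map f := ⟨f.toTStarFun, f.map_one⟩

/-! ### Auxiliary facts -/

namespace TStarCat

variable (A : TStarCat.{u} 𝕜)

/-- Composition as a bilinear map. -/
def compₗ {X Y Z : A.Ob} : A.Hom Y Z →ₗ[𝕜] A.Hom X Y →ₗ[𝕜] A.Hom X Z :=
  LinearMap.mk₂ 𝕜 A.comp A.add_comp A.smul_comp A.comp_add A.comp_smul

@[simp] lemma zero_comp {X Y Z : A.Ob} (y : A.Hom X Y) : A.comp (0 : A.Hom Y Z) y = 0 :=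
  A.compₗ.map_zero₂ y

@[simp] lemma comp_zero {X Y Z : A.Ob} (x : A.Hom Y Z) : A.comp x (0 : A.Hom X Y) = 0 :=
  (A.compₗ x).map_zero

lemma sum_comp {X Y Z : A.Ob} {ι : Type*} (s : Finset ι) (x : ι → A.Hom Y Z) (y : A.Hom X Y) :
    A.comp (∑ i ∈ s, x i) y = ∑ i ∈ s, A.comp (x i) y :=
  A.compₗ.map_sum₂ s x y

lemma comp_sum {X Y Z : A.Ob} {ι : Type*} (s : Finset ι) (x : A.Hom Y Z) (y : ι → A.Hom X Y) :
    A.comp x (∑ i ∈ s, y i) = ∑ i ∈ s, A.comp x (y i) :=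
  map_sum (A.compₗ x) y s

/-- The involution as an additive map. -/
def starₐ {X Y : A.Ob} : A.Hom X Y →+ A.Hom Y X := AddMonoidHom.mk' A.star A.star_add

@[simp] lemma star_zero {X Y : A.Ob} : A.star (0 : A.Hom X Y) = 0 := A.starₐ.map_zero

lemma star_sum {X Y : A.Ob} {ι : Type*} (s : Finset ι) (x : ι → A.Hom X Y) :
    A.star (∑ i ∈ s, x i) = ∑ i ∈ s, A.star (x i) :=
  map_sum A.starₐ x s

end TStarCat

/-! ### The graded tensor product with a Clifford algebra -/

/-- The exponent `S ∈ (ℤ/2)^{p+q}` indexes the basis element `e_S`, the product in increasing order of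
the generators with `S i = 1`, of the Clifford algebra with `p` generators of square `1` followed by
`q` generators of square `-1`. -/
abbrev CliffIdx (p q : ℕ) : Type := Fin (p + q) → ZMod 2

/-- `e_S e_T = (-1)^(cliffForm S T) e_{S+T}`. -/
def cliffForm {p q : ℕ} (S T : CliffIdx p q) : ZMod 2 :=
  ∑ i : Fin (p + q), ∑ j : Fin (p + q), if j < i ∨ (i = j ∧ p ≤ (i : ℕ)) then S i * T j else 0

/-- The degree of `e_S`. -/
def cliffDeg {p q : ℕ} (S : CliffIdx p q) : ZMod 2 := ∑ i, S i

lemma cliffForm_add_left {p q : ℕ} (S S' T : CliffIdx p q) :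
    cliffForm (S + S') T = cliffForm S T + cliffForm S' T := by
  simp only [cliffForm, ← Finset.sum_add_distrib]
  refine Finset.sum_congr rfl fun i _ => Finset.sum_congr rfl fun j _ => ?_
  split_ifs <;> simp [add_mul]

lemma cliffForm_add_right {p q : ℕ} (S T T' : CliffIdx p q) :
    cliffForm S (T + T') = cliffForm S T + cliffForm S T' := by
  simp only [cliffForm, ← Finset.sum_add_distrib]
  refine Finset.sum_congr rfl fun i _ => Finset.sum_congr rfl fun j _ => ?_
  split_ifs <;> simp [mul_add]

lemma cliffDeg_add {p q : ℕ} (S T : CliffIdx p q) :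
    cliffDeg (S + T) = cliffDeg S + cliffDeg T := by
  simp [cliffDeg, Finset.sum_add_distrib]

lemma cliffForm_zero_left {p q : ℕ} (T : CliffIdx p q) : cliffForm 0 T = 0 := by
  simp [cliffForm]

lemma cliffForm_zero_right {p q : ℕ} (T : CliffIdx p q) : cliffForm T 0 = 0 := by
  simp [cliffForm]

/-- The Clifford relations: `e_i e_j = -e_j e_i` for `i ≠ j`, and `e_i² = 1` or `-1` according to
whether `i < p` or not. -/
lemma cliffForm_single {p q : ℕ} (i j : Fin (p + q)) :
    cliffForm (Pi.single i 1 : CliffIdx p q) (Pi.single j 1) =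
      if j < i ∨ (i = j ∧ p ≤ (i : ℕ)) then 1 else 0 := by
  unfold cliffForm
  rw [Finset.sum_eq_single i (by intro k _ hk; simp [hk]) (by simp),
    Finset.sum_eq_single j (by intro k _ hk; simp [hk]) (by simp)]
  simp

lemma cliffDeg_zero {p q : ℕ} : cliffDeg (0 : CliffIdx p q) = 0 := by
  simp [cliffDeg]

variable (𝕜) in
/-- The sign `(-1)^a`. -/
def sgn (a : ZMod 2) : 𝕜 := if a = 0 then 1 else -1

lemma sgn_zero : sgn 𝕜 0 = 1 := if_pos rfl

lemma zmod_two_cases (a : ZMod 2) : a = 0 ∨ a = 1 := by revert a; decide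

lemma sgn_add (a b : ZMod 2) : sgn 𝕜 (a + b) = sgn 𝕜 a * sgn 𝕜 b := by
  rcases zmod_two_cases a with rfl | rfl <;> rcases zmod_two_cases b with rfl | rfl <;>
    simp [sgn, show (1 : ZMod 2) + 1 = 0 from rfl]

lemma conj_sgn (a : ZMod 2) : starRingEnd 𝕜 (sgn 𝕜 a) = sgn 𝕜 a := by
  unfold sgn; split_ifs <;> simp

lemma sgn_mul_self (a : ZMod 2) : sgn 𝕜 a * sgn 𝕜 a = 1 := by
  unfold sgn; split_ifs <;> simp

namespace TStarCat

variable (A : TStarCat.{u} 𝕜)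

/-- The `a`-th power of the parity operator. -/
def parPow (a : ZMod 2) {X Y : A.Ob} : A.Hom X Y →ₗ[𝕜] A.Hom X Y :=
  if a = 0 then LinearMap.id else A.par

lemma parPow_zero {X Y : A.Ob} (x : A.Hom X Y) : A.parPow 0 x = x := rfl

lemma parPow_add (a b : ZMod 2) {X Y : A.Ob} (x : A.Hom X Y) :
    A.parPow (a + b) x = A.parPow a (A.parPow b x) := by
  rcases zmod_two_cases a with rfl | rfl <;> rcases zmod_two_cases b with rfl | rfl <;>
    simp [parPow, show (1 : ZMod 2) + 1 = 0 from rfl, A.par_par]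

lemma parPow_comp (a : ZMod 2) {X Y Z : A.Ob} (x : A.Hom Y Z) (y : A.Hom X Y) :
    A.parPow a (A.comp x y) = A.comp (A.parPow a x) (A.parPow a y) := by
  unfold parPow; split_ifs <;> simp [A.par_comp]

lemma parPow_star (a : ZMod 2) {X Y : A.Ob} (x : A.Hom X Y) :
    A.parPow a (A.star x) = A.star (A.parPow a x) := by
  unfold parPow; split_ifs <;> simp [A.par_star]

lemma par_parPow (a : ZMod 2) {X Y : A.Ob} (x : A.Hom X Y) :
    A.par (A.parPow a x) = A.parPow a (A.par x) := by
  unfold parPow; split_ifs <;> simp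

/-- The graded tensor product of `A` with the Clifford algebra `𝔽_{p,q}`. The family
`(x_S)_S` stands for the sum of the elementary tensors `x_S ⊗ e_S`; the operations are
`(x ⊗ e)(y ⊗ f) = (-1)^(deg e * deg y) xy ⊗ ef` and
`(x ⊗ e)^* = (-1)^(deg e * deg x) x^* ⊗ e^*`, where the generators of `𝔽_{p,q}` are unitary, so that
`e_S^* = (-1)^(cliffForm S S) e_S`. -/
@[reducible] def cliff (p q : ℕ) : TStarCat.{u} 𝕜 where
  Ob := A.Ob
  Hom X Y := CliffIdx p q → A.Hom X Y
  comp x y := fun U => ∑ S, sgn 𝕜 (cliffForm S (U - S)) •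
    A.comp (x S) (A.parPow (cliffDeg S) (y (U - S)))
  comp_add x y y' := by
    funext U
    simp only [Pi.add_apply, map_add, A.comp_add, smul_add, Finset.sum_add_distrib]
  add_comp x y y' := by
    funext U
    simp only [Pi.add_apply, A.add_comp, smul_add, Finset.sum_add_distrib]
  comp_smul c x y := by
    funext U
    simp only [Pi.smul_apply, map_smul, A.comp_smul, Finset.smul_sum, smul_comm c]
  smul_comp c x y := by
    funext U
    simp only [Pi.smul_apply, A.smul_comp, Finset.smul_sum, smul_comm c]
  assoc x y z := by
    funext W
    simp only [A.sum_comp, A.comp_sum, map_sum, map_smul, A.smul_comp, A.comp_smul,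
      Finset.smul_sum, smul_smul, A.parPow_comp, A.assoc]
    rw [Finset.sum_comm]
    refine Finset.sum_congr rfl fun S _ => ?_
    refine (Fintype.sum_equiv (Equiv.addLeft S) _ _ fun T => ?_).symm
    simp only [Equiv.coe_addLeft, add_sub_cancel_left, ← A.parPow_add, cliffDeg_add, ← sgn_add,
      sub_add_eq_sub_sub]
    congr 2
    have h : W - S = T + (W - S - T) := by abel
    conv_lhs => rw [h, cliffForm_add_right]
    rw [add_sub_cancel_left, cliffForm_add_left]
    ring
  star x := fun S => sgn 𝕜 (cliffForm S S) • A.parPow (cliffDeg S) (A.star (x S))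
  star_add x y := by
    funext S
    simp only [Pi.add_apply, A.star_add, map_add, smul_add]
  star_smul c x := by
    funext S
    simp only [Pi.smul_apply, A.star_smul, map_smul, smul_comm (starRingEnd 𝕜 c)]
  star_comp x y := by
    funext U
    simp only [A.star_sum, map_sum, A.star_smul, map_smul, Finset.smul_sum, smul_smul, conj_sgn,
      A.star_comp, A.parPow_comp, A.smul_comp, A.comp_smul]
    refine Fintype.sum_equiv (Equiv.subLeft U) _ _ fun S => ?_
    simp only [Equiv.subLeft_apply, sub_sub_cancel, ← A.parPow_star, ← A.parPow_add, ← sgn_add]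
    obtain ⟨T, rfl⟩ : ∃ T, U = S + T := ⟨U - S, by abel⟩
    simp only [add_sub_cancel_left, cliffForm_add_left, cliffForm_add_right, cliffDeg_add]
    have h2 : ∀ a : ZMod 2, a + a = 0 := by decide
    congr 1
    · congr 1
      linear_combination h2 (cliffForm S T)
    congr 1
    · congr 2
      linear_combination h2 (cliffDeg S)
    · congr 2
      ring
  star_star x := by
    funext S
    simp only [A.star_smul, map_smul, smul_smul, conj_sgn, sgn_mul_self, one_smul,
      ← A.parPow_star, ← A.parPow_add, A.star_star]
    rw [show cliffDeg S + cliffDeg S = 0 from by generalize cliffDeg S = a; revert a; decide]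
    rfl
  par := LinearMap.pi fun S => sgn 𝕜 (cliffDeg S) • A.par ∘ₗ LinearMap.proj S
  par_par x := by
    funext S
    simp [A.par_par, smul_smul, sgn_mul_self]
  par_comp x y := by
    funext U
    simp only [LinearMap.pi_apply, LinearMap.smul_apply, LinearMap.comp_apply, LinearMap.proj_apply,
      map_sum, map_smul, Finset.smul_sum, smul_smul, A.smul_comp, A.comp_smul, A.par_comp,
      A.par_parPow]
    refine Finset.sum_congr rfl fun S _ => ?_
    congr 1
    rw [show U = S + (U - S) by abel, cliffDeg_add, sgn_add]
    simp only [add_sub_cancel_left]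
    ring
  par_star x := by
    funext S
    simp [A.star_smul, conj_sgn, A.par_parPow, smul_smul, mul_comm, A.par_star]

/-- The unitization `A⁺`: scalar multiples of identities are adjoined to the endomorphism sets. -/
def plusHom (X Y : A.Ob) : Submodule 𝕜 (A.Hom X Y × 𝕜) where
  carrier := {x | X ≠ Y → x.2 = 0}
  add_mem' hx hy h := by simp [hx h, hy h]
  zero_mem' _ := rfl
  smul_mem' c x hx h := by simp [hx h]

open Classical in
/-- `c` times the morphism `1 y`, for the identity `1 : Y → Z` (zero if `Y ≠ Z`). -/
noncomputable def lscal {X Y : A.Ob} (Z : A.Ob) (c : 𝕜) (y : A.Hom X Y) : A.Hom X Z :=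
  if h : Y = Z then c • (h ▸ y) else 0

open Classical in
/-- `c` times the morphism `x 1`, for the identity `1 : X → Y` (zero if `X ≠ Y`). -/
noncomputable def rscal {Y Z : A.Ob} (X : A.Ob) (c : 𝕜) (x : A.Hom Y Z) : A.Hom X Z :=
  if h : Y = X then c • (h ▸ x) else 0

@[simp] lemma lscal_self {X Y : A.Ob} (c : 𝕜) (y : A.Hom X Y) : A.lscal Y c y = c • y := by
  simp [lscal]

@[simp] lemma rscal_self {Y Z : A.Ob} (c : 𝕜) (x : A.Hom Y Z) : A.rscal Y c x = c • x := by
  simp [rscal]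

@[simp] lemma lscal_zero {X Y : A.Ob} (Z : A.Ob) (y : A.Hom X Y) : A.lscal Z 0 y = 0 := by
  simp [lscal]

@[simp] lemma rscal_zero {Y Z : A.Ob} (X : A.Ob) (x : A.Hom Y Z) : A.rscal X 0 x = 0 := by
  simp [rscal]

/-- For a pair in `plusHom X Y`, either `X = Y` or the scalar vanishes. -/
lemma plusHom_cases {X Y : A.Ob} (x : A.plusHom X Y) : X = Y ∨ x.1.2 = 0 := by
  by_cases h : X = Y
  · exact Or.inl h
  · exact Or.inr (x.2 h)

end TStarCat

namespace TStarCat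

variable (A : TStarCat.{u} 𝕜)

lemma plusHom_induct {X Y : A.Ob} {motive : A.plusHom X Y → Prop} (x : A.plusHom X Y)
    (h0 : ∀ y : A.Hom X Y, motive ⟨(y, 0), fun _ => rfl⟩)
    (h1 : X = Y → ∀ (y : A.Hom X Y) (c : 𝕜) (hc : X ≠ Y → c = 0), motive ⟨(y, c), hc⟩) :
    motive x := by
  obtain ⟨⟨y, c⟩, hx⟩ := x
  by_cases h : X = Y
  · exact h1 h y c hx
  · have hc : c = 0 := hx h
    subst hc
    exact h0 y

lemma lscal_add {X Y : A.Ob} (Z : A.Ob) (c : 𝕜) (y y' : A.Hom X Y) :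
    A.lscal Z c (y + y') = A.lscal Z c y + A.lscal Z c y' := by
  by_cases h : Y = Z
  · subst h; simp
  · simp [lscal, h]

lemma add_lscal {X Y : A.Ob} (Z : A.Ob) (c c' : 𝕜) (y : A.Hom X Y) :
    A.lscal Z (c + c') y = A.lscal Z c y + A.lscal Z c' y := by
  by_cases h : Y = Z
  · subst h; simp [add_smul]
  · simp [lscal, h]

lemma rscal_add {Y Z : A.Ob} (X : A.Ob) (c : 𝕜) (x x' : A.Hom Y Z) :
    A.rscal X c (x + x') = A.rscal X c x + A.rscal X c x' := by
  by_cases h : Y = X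
  · subst h; simp
  · simp [rscal, h]

lemma add_rscal {Y Z : A.Ob} (X : A.Ob) (c c' : 𝕜) (x : A.Hom Y Z) :
    A.rscal X (c + c') x = A.rscal X c x + A.rscal X c' x := by
  by_cases h : Y = X
  · subst h; simp [add_smul]
  · simp [rscal, h]

lemma lscal_smul {X Y : A.Ob} (Z : A.Ob) (c d : 𝕜) (y : A.Hom X Y) :
    A.lscal Z c (d • y) = d • A.lscal Z c y := by
  by_cases h : Y = Z
  · subst h; simp [smul_comm c]
  · simp [lscal, h]

lemma smul_lscal {X Y : A.Ob} (Z : A.Ob) (c d : 𝕜) (y : A.Hom X Y) :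
    A.lscal Z (d * c) y = d • A.lscal Z c y := by
  by_cases h : Y = Z
  · subst h; simp [smul_smul]
  · simp [lscal, h]

lemma rscal_smul {Y Z : A.Ob} (X : A.Ob) (c d : 𝕜) (x : A.Hom Y Z) :
    A.rscal X c (d • x) = d • A.rscal X c x := by
  by_cases h : Y = X
  · subst h; simp [smul_comm c]
  · simp [rscal, h]

lemma smul_rscal {Y Z : A.Ob} (X : A.Ob) (c d : 𝕜) (x : A.Hom Y Z) :
    A.rscal X (d * c) x = d • A.rscal X c x := by
  by_cases h : Y = X
  · subst h; simp [smul_smul]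
  · simp [rscal, h]

@[simp] lemma lscal_apply_zero {X Y : A.Ob} (Z : A.Ob) (c : 𝕜) :
    A.lscal Z c (0 : A.Hom X Y) = 0 := by
  simpa using A.lscal_smul Z c 0 (0 : A.Hom X Y)

@[simp] lemma rscal_apply_zero {Y Z : A.Ob} (X : A.Ob) (c : 𝕜) :
    A.rscal X c (0 : A.Hom Y Z) = 0 := by
  simpa using A.rscal_smul X c 0 (0 : A.Hom Y Z)

/-- Composition in the unitization, `(x + a1)(y + b1) = (xy + ay + bx) + ab1`. -/
noncomputable def plusComp {X Y Z : A.Ob} (x : A.plusHom Y Z) (y : A.plusHom X Y) :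
    A.plusHom X Z :=
  ⟨(A.comp x.1.1 y.1.1 + A.lscal Z x.1.2 y.1.1 + A.rscal X y.1.2 x.1.1, x.1.2 * y.1.2),
    fun h => by
      rcases A.plusHom_cases x with rfl | hx
      · rcases A.plusHom_cases y with rfl | hy
        · exact absurd rfl h
        · simp [hy]
      · simp [hx]⟩

lemma plusComp_assoc {W X Y Z : A.Ob} (x : A.plusHom Y Z) (y : A.plusHom X Y)
    (z : A.plusHom W X) : A.plusComp (A.plusComp x y) z = A.plusComp x (A.plusComp y z) := by
  induction x using A.plusHom_induct with
  | h0 x =>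
    induction y using A.plusHom_induct with
    | h0 y =>
      induction z using A.plusHom_induct with
      | h0 z => apply Subtype.ext; simp [plusComp, A.assoc]
      | h1 h z c _ =>
        subst h; apply Subtype.ext
        simp [plusComp, A.assoc, A.comp_add, A.comp_smul]
    | h1 h y b _ =>
      subst h
      induction z using A.plusHom_induct with
      | h0 z =>
        apply Subtype.ext
        simp [plusComp, A.assoc, A.comp_add, A.add_comp, A.smul_comp, A.comp_smul]
      | h1 h z c _ =>
        subst h; apply Subtype.ext
        simp [plusComp, A.assoc, A.comp_add, A.add_comp, A.smul_comp, A.comp_smul, smul_smul]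
        module
  | h1 h x a _ =>
    subst h
    induction y using A.plusHom_induct with
    | h0 y =>
      induction z using A.plusHom_induct with
      | h0 z => apply Subtype.ext; simp [plusComp, A.assoc, A.add_comp, A.smul_comp]
      | h1 h z c _ =>
        subst h; apply Subtype.ext
        simp [plusComp, A.assoc, A.comp_add, A.add_comp, A.smul_comp, A.comp_smul, smul_smul]
        module
    | h1 h y b _ =>
      subst h
      induction z using A.plusHom_induct with
      | h0 z =>
        apply Subtype.ext
        simp [plusComp, A.assoc, A.comp_add, A.add_comp, A.smul_comp, A.comp_smul, smul_smul]
        module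
      | h1 h z c _ =>
        subst h; apply Subtype.ext
        simp [plusComp, A.assoc, A.comp_add, A.add_comp, A.smul_comp, A.comp_smul, smul_smul]
        exact ⟨by module, mul_assoc a b c⟩

/-- The involution of the unitization. -/
def plusStar {X Y : A.Ob} (x : A.plusHom X Y) : A.plusHom Y X :=
  ⟨(A.star x.1.1, starRingEnd 𝕜 x.1.2), fun h => by simp [x.2 h.symm]⟩

/-- The parity operator of the unitization. -/
def plusPar {X Y : A.Ob} : A.plusHom X Y →ₗ[𝕜] A.plusHom X Y where
  toFun x := ⟨(A.par x.1.1, x.1.2), x.2⟩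
  map_add' x y := by apply Subtype.ext; simp
  map_smul' c x := by apply Subtype.ext; simp

lemma plusStar_comp {X Y Z : A.Ob} (x : A.plusHom Y Z) (y : A.plusHom X Y) :
    A.plusStar (A.plusComp x y) = A.plusComp (A.plusStar y) (A.plusStar x) := by
  induction x using A.plusHom_induct with
  | h0 x =>
    induction y using A.plusHom_induct with
    | h0 y => apply Subtype.ext; simp [plusStar, plusComp, A.star_comp]
    | h1 h y b _ =>
      subst h; apply Subtype.ext
      simp [plusStar, plusComp, A.star_comp, A.star_add, A.star_smul]
  | h1 h x a _ =>
    subst h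
    induction y using A.plusHom_induct with
    | h0 y =>
      apply Subtype.ext; simp [plusStar, plusComp, A.star_comp, A.star_add, A.star_smul]
    | h1 h y b _ =>
      subst h; apply Subtype.ext
      simp [plusStar, plusComp, A.star_comp, A.star_add, A.star_smul, mul_comm]
      abel

lemma plusPar_comp {X Y Z : A.Ob} (x : A.plusHom Y Z) (y : A.plusHom X Y) :
    A.plusPar (A.plusComp x y) = A.plusComp (A.plusPar x) (A.plusPar y) := by
  induction x using A.plusHom_induct with
  | h0 x =>
    induction y using A.plusHom_induct with
    | h0 y => apply Subtype.ext; simp [plusPar, plusComp, A.par_comp]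
    | h1 h y b _ =>
      subst h; apply Subtype.ext
      simp [plusPar, plusComp, A.par_comp]
  | h1 h x a _ =>
    subst h
    induction y using A.plusHom_induct with
    | h0 y =>
      apply Subtype.ext; simp [plusPar, plusComp, A.par_comp]
    | h1 h y b _ =>
      subst h; apply Subtype.ext
      simp [plusPar, plusComp, A.par_comp]

/-- The unitization `A⁺`. -/
@[reducible] noncomputable def plus : UTStarCat.{u} 𝕜 where
  Ob := A.Ob
  Hom X Y := A.plusHom X Y
  comp := A.plusComp
  comp_add x y y' := by
    apply Subtype.ext
    simp only [plusComp, Submodule.coe_add, Prod.fst_add, Prod.snd_add, A.comp_add, lscal_add,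
      add_rscal, mul_add, Prod.mk_add_mk]
    congr 1; abel
  add_comp x x' y := by
    apply Subtype.ext
    simp only [plusComp, Submodule.coe_add, Prod.fst_add, Prod.snd_add, A.add_comp, add_lscal,
      rscal_add, add_mul, Prod.mk_add_mk]
    congr 1; abel
  comp_smul c x y := by
    apply Subtype.ext
    simp [plusComp, A.comp_smul, lscal_smul, smul_rscal, mul_left_comm]
  smul_comp c x y := by
    apply Subtype.ext
    simp [plusComp, A.smul_comp, smul_lscal, rscal_smul, mul_assoc]
  assoc := A.plusComp_assoc
  star := A.plusStar
  star_add x y := by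
    apply Subtype.ext; simp [plusStar, A.star_add]
  star_smul c x := by
    apply Subtype.ext; simp [plusStar, A.star_smul]
  star_comp := A.plusStar_comp
  star_star x := by
    apply Subtype.ext; simp [plusStar, A.star_star]
  par := A.plusPar
  par_par x := by
    apply Subtype.ext; simp [plusPar, A.par_par]
  par_comp := A.plusPar_comp
  par_star x := by
    apply Subtype.ext; simp [plusStar, plusPar, A.par_star]
  one X := ⟨((0 : A.Hom X X), (1 : 𝕜)), fun h => absurd rfl h⟩
  one_comp x := by
    apply Subtype.ext; simp [plusComp]
  comp_one x := by
    apply Subtype.ext; simp [plusComp]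

/-- The category with the same objects as `A` and only zero morphisms. -/
@[reducible] def zeroCat : TStarCat.{u} 𝕜 where
  Ob := A.Ob
  Hom _ _ := PUnit
  comp _ _ := 0
  comp_add _ _ _ := rfl
  add_comp _ _ _ := rfl
  comp_smul _ _ _ := rfl
  smul_comp _ _ _ := rfl
  assoc _ _ _ := rfl
  star _ := 0
  star_add _ _ := rfl
  star_smul _ _ := rfl
  star_comp _ _ := rfl
  star_star _ := rfl
  par := LinearMap.id
  par_par _ := rfl
  par_comp _ _ := rfl
  par_star _ := rfl

end TStarCat

namespace UTStarCat

variable (A : UTStarCat.{u} 𝕜)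

lemma parPow_one (a : ZMod 2) (X : A.Ob) : A.parPow a (A.one X) = A.one X := by
  have h1 : A.parPow a (A.parPow a (A.one X)) = A.one X := by
    rw [← A.parPow_add, show a + a = 0 by revert a; decide]; rfl
  have h := A.parPow_comp a (A.parPow a (A.one X)) (A.one X)
  rwa [A.comp_one, h1, A.one_comp, eq_comm] at h

/-- The graded tensor product of a unital category with the Clifford algebra `𝔽_{p,q}`. -/
@[reducible] def cliff (p q : ℕ) : UTStarCat.{u} 𝕜 where
  toTStarCat := A.toTStarCat.cliff p q
  one X := Pi.single (M := fun _ => A.Hom X X) 0 (A.one X)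
  one_comp {X Y} x := by
    funext U
    change ∑ S, sgn 𝕜 (cliffForm S (U - S)) • A.comp (Pi.single (M := fun _ => A.Hom Y Y) 0
      (A.one Y) S) (A.parPow (cliffDeg S) (x (U - S))) = x U
    rw [Finset.sum_eq_single 0 (by intro S _ hS; simp [hS]) (by simp)]
    simp [cliffForm_zero_left, cliffDeg_zero, sgn_zero, TStarCat.parPow_zero, A.one_comp]
  comp_one {X Y} x := by
    funext U
    change ∑ S, sgn 𝕜 (cliffForm S (U - S)) • A.comp (x S) (A.parPow (cliffDeg S)
      (Pi.single (M := fun _ => A.Hom X X) 0 (A.one X) (U - S))) = x U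
    rw [Finset.sum_eq_single U
      (by intro S _ hS; simp [Pi.single_eq_of_ne (sub_ne_zero.mpr hS.symm)]) (by simp)]
    simp [cliffForm_zero_right, sgn_zero, A.parPow_one, A.comp_one]

end UTStarCat

namespace TStarFun

variable {A B : TStarCat.{u} 𝕜} (f : TStarFun A B)

lemma map_parPow (a : ZMod 2) {X Y : A.Ob} (x : A.Hom X Y) :
    f.map (A.parPow a x) = B.parPow a (f.map x) := by
  unfold TStarCat.parPow; split_ifs <;> simp [f.map_par]

lemma map_lscal {X Y Z : A.Ob} (x : A.plusHom Y Z) (y : A.Hom X Y) :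
    f.map (A.lscal Z x.1.2 y) = B.lscal (f.obj Z) x.1.2 (f.map y) := by
  rcases A.plusHom_cases x with rfl | h
  · simp
  · simp [h]

lemma map_rscal {X Y Z : A.Ob} (y : A.plusHom X Y) (x : A.Hom Y Z) :
    f.map (A.rscal X y.1.2 x) = B.rscal (f.obj X) y.1.2 (f.map x) := by
  rcases A.plusHom_cases y with rfl | h
  · simp
  · simp [h]

/-- `f ⊗ 1 : A ⊗ 𝔽_{p,q} → B ⊗ 𝔽_{p,q}`. -/
@[reducible] def cliff (p q : ℕ) : TStarFun (A.cliff p q) (B.cliff p q) where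
  obj := f.obj
  map {X Y} :=
    { toFun := fun (x : CliffIdx p q → A.Hom X Y) S => f.map (x S)
      map_add' := fun x y => by funext S; simp
      map_smul' := fun c x => by funext S; simp }
  map_comp x y := by
    funext U
    simp [map_sum, f.map_comp, f.map_parPow]
  map_star x := by
    funext S
    simp [f.map_star, f.map_parPow]
  map_par x := by
    funext S
    simp [f.map_par]
  continuous_map :=
    continuous_pi fun S => f.continuous_map.comp (continuous_apply S)

/-- The induced functor of unitizations. -/
@[reducible] noncomputable def plus : UTStarFun A.plus B.plus where
  obj := f.obj
  map {X Y} :=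
    { toFun := fun x => ⟨(f.map x.1.1, x.1.2), fun h => x.2 fun e => h (congrArg f.obj e)⟩
      map_add' := fun x y => by apply Subtype.ext; simp
      map_smul' := fun c x => by apply Subtype.ext; simp }
  map_comp x y := by
    apply Subtype.ext
    simp [TStarCat.plusComp, f.map_comp, f.map_lscal, f.map_rscal]
  map_star x := by
    apply Subtype.ext; simp [TStarCat.plusStar, f.map_star]
  map_par x := by
    apply Subtype.ext; simp [TStarCat.plusPar, f.map_par]
  continuous_map := by
    refine Continuous.subtype_mk (Continuous.prodMk ?_ ?_) _
    · exact f.continuous_map.comp (continuous_fst.comp continuous_subtype_val)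
    · exact continuous_snd.comp continuous_subtype_val
  map_one X := by
    apply Subtype.ext; simp

end TStarFun

/-- `f ⊗ 1 : A ⊗ 𝔽_{p,q} → B ⊗ 𝔽_{p,q}`. -/
@[reducible] def UTStarFun.cliff (p q : ℕ) {A B : UTStarCat.{u} 𝕜} (f : UTStarFun A B) :
    UTStarFun (A.cliff p q) (B.cliff p q) where
  toTStarFun := f.toTStarFun.cliff p q
  map_one X := by
    funext S
    by_cases h : S = 0
    · subst h; simp [f.map_one]
    · simp [h]

/-- The functor `A ↦ A ⊗ 𝔽_{p,q}`. -/
def cliffT (p q : ℕ) : TStarCat.{u} 𝕜 ⥤ TStarCat.{u} 𝕜 where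
  obj A := A.cliff p q
  map f := TStarFun.cliff f p q

/-- The functor `A ↦ A ⊗ 𝔽_{p,q}` on unital categories. -/
def cliffU (p q : ℕ) : UTStarCat.{u} 𝕜 ⥤ UTStarCat.{u} 𝕜 where
  obj A := A.cliff p q
  map f := UTStarFun.cliff p q f

/-- The unitization functor `A ↦ A⁺`. -/
noncomputable def unitization : TStarCat.{u} 𝕜 ⥤ UTStarCat.{u} 𝕜 where
  obj A := A.plus
  map f := TStarFun.plus f

/-- The functor taking `A` to the category with the same objects and only zero morphisms. The
unitization of the latter is the category `𝔽_A` with `Hom X X = 𝔽` and `Hom X Y = 0` for `X ≠ Y`. -/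
def zeroFunctor : TStarCat.{u} 𝕜 ⥤ TStarCat.{u} 𝕜 where
  obj A := A.zeroCat
  map f := ⟨f.obj, 0, fun _ _ => rfl, fun _ => rfl, fun _ => rfl, continuous_const⟩

/-- The functor `A → 0` inducing the quotient functor `A⁺ → 𝔽_A`. -/
def toZero : 𝟭 (TStarCat.{u} 𝕜) ⟶ zeroFunctor where
  app A := (⟨id, 0, fun _ _ => rfl, fun _ => rfl, fun _ => rfl, continuous_const⟩ :
    TStarFun A A.zeroCat)

/-! ### The additive completion -/

namespace UTStarCat

variable (A : UTStarCat.{u} 𝕜)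

/-- The identity matrix on a finite family of objects. -/
def idMat {ι : Type} [DecidableEq ι] (a : ι → A.Ob) (i j : ι) : A.Hom (a j) (a i) :=
  if h : j = i then h ▸ A.one (a j) else 0

@[simp] lemma idMat_self {ι : Type} [DecidableEq ι] (a : ι → A.Ob) (i : ι) :
    A.idMat a i i = A.one (a i) := by simp [idMat]

lemma idMat_ne {ι : Type} [DecidableEq ι] (a : ι → A.Ob) {i j : ι} (h : i ≠ j) :
    A.idMat a i j = 0 := by simp [idMat, h.symm]

/-- The additive completion `A_⊕`: the objects are the formal sums of objects of `A`, the morphisms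
are matrices. -/
@[reducible] def addCompl : UTStarCat.{u} 𝕜 where
  Ob := Σ n : ℕ, Fin n → A.Ob
  Hom X Y := ∀ (i : Fin Y.1) (j : Fin X.1), A.Hom (X.2 j) (Y.2 i)
  comp x y := fun i k => ∑ j, A.comp (x i j) (y j k)
  comp_add x y y' := by
    funext i k; simp [A.comp_add, Finset.sum_add_distrib]
  add_comp x x' y := by
    funext i k; simp [A.add_comp, Finset.sum_add_distrib]
  comp_smul c x y := by
    funext i k; simp [A.comp_smul, Finset.smul_sum]
  smul_comp c x y := by
    funext i k; simp [A.smul_comp, Finset.smul_sum]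
  assoc x y z := by
    funext i l
    simp only [A.sum_comp, A.comp_sum, A.assoc]
    exact Finset.sum_comm
  star x := fun i j => A.star (x j i)
  star_add x y := by
    funext i j; simp [A.star_add]
  star_smul c x := by
    funext i j; simp [A.star_smul]
  star_comp x y := by
    funext i j; simp [A.star_sum, A.star_comp]
  star_star x := by
    funext i j; simp [A.star_star]
  par :=
    { toFun := fun x i j => A.par (x i j)
      map_add' := fun x y => by funext i j; simp
      map_smul' := fun c x => by funext i j; simp }
  par_par x := by
    funext i j; simp [A.par_par]
  par_comp x y := by
    funext i j; simp [A.par_comp]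
  par_star x := by
    funext i j; simp [A.par_star]
  one X := A.idMat X.2
  one_comp {X Y} x := by
    funext i j
    change ∑ k, A.comp (A.idMat Y.2 i k) (x k j) = x i j
    rw [Finset.sum_eq_single i (by intro k _ hk; simp [A.idMat_ne _ hk.symm]) (by simp)]
    simp [A.one_comp]
  comp_one {X Y} x := by
    funext i j
    change ∑ k, A.comp (x i k) (A.idMat X.2 k j) = x i j
    rw [Finset.sum_eq_single j (by intro k _ hk; simp [A.idMat_ne _ hk]) (by simp)]
    simp [A.comp_one]

/-- The space of supersymmetries of an object `X`: the odd self-adjoint `x` with `x² = 1`. -/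
def SS (X : A.Ob) : Type u :=
  {x : A.Hom X X // A.par x = -x ∧ A.star x = x ∧ A.comp x x = A.one X}

instance (X : A.Ob) : TopologicalSpace (A.SS X) :=
  inferInstanceAs (TopologicalSpace (Subtype _))

end UTStarCat

namespace UTStarFun

variable {A B : UTStarCat.{u} 𝕜} (f : UTStarFun A B)

lemma map_idMat {ι : Type} [DecidableEq ι] (a : ι → A.Ob) (i j : ι) :
    f.map (A.idMat a i j) = B.idMat (f.obj ∘ a) i j := by
  by_cases h : i = j
  · subst h; simp [f.map_one]
  · rw [A.idMat_ne a h, B.idMat_ne _ h, map_zero]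

/-- The induced functor of additive completions. -/
@[reducible] def addCompl : UTStarFun A.addCompl B.addCompl where
  obj X := ⟨X.1, f.obj ∘ X.2⟩
  map {X Y} :=
    { toFun := fun x i j => f.map (x i j)
      map_add' := fun x y => by funext i j; simp
      map_smul' := fun c x => by funext i j; simp }
  map_comp x y := by
    funext i j; simp [f.map_comp]
  map_star x := by
    funext i j; simp [f.map_star]
  map_par x := by
    funext i j; simp [f.map_par]
  continuous_map := continuous_pi fun i => continuous_pi fun j =>
    f.continuous_map.comp ((continuous_apply j).comp (continuous_apply i))
  map_one X := by
    funext i j; exact f.map_idMat X.2 i j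

/-- The induced map of spaces of supersymmetries. -/
def mapSS {X : A.Ob} (x : A.SS X) : B.SS (f.obj X) :=
  ⟨f.map x.1, by rw [← f.map_par, x.2.1, map_neg], by rw [← f.map_star, x.2.2.1],
    by rw [← f.map_comp, x.2.2.2, f.map_one]⟩

lemma continuous_mapSS {X : A.Ob} : Continuous (f.mapSS : A.SS X → B.SS (f.obj X)) :=
  Continuous.subtype_mk (f.continuous_map.comp continuous_subtype_val) _

end UTStarFun

/-! ### Van Daele's `K`-group -/

namespace UTStarCat

variable (A : UTStarCat.{u} 𝕜)

/-- The pairs consisting of an object of `A_⊕` and a supersymmetry of it. -/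
structure Super : Type u where
  ob : A.addCompl.Ob
  ss : A.addCompl.SS ob

variable {A}

/-- The block matrix with diagonal blocks `x`, `y`. -/
def blockDiag {ι κ : Type} {a : ι → A.Ob} {b : κ → A.Ob} (x : ∀ i j, A.Hom (a j) (a i))
    (y : ∀ i j, A.Hom (b j) (b i)) :
    ∀ s t : ι ⊕ κ, A.Hom (Sum.elim a b t) (Sum.elim a b s)
  | .inl i, .inl j => x i j
  | .inl _, .inr _ => 0
  | .inr _, .inl _ => 0
  | .inr i, .inr j => y i j

lemma blockDiag_idMat {ι κ : Type} [DecidableEq ι] [DecidableEq κ] (a : ι → A.Ob)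
    (b : κ → A.Ob) (s t : ι ⊕ κ) :
    blockDiag (A.idMat a) (A.idMat b) s t = A.idMat (Sum.elim a b) s t := by
  rcases s with i | i <;> rcases t with j | j
  · by_cases h : i = j
    · subst h; simp [blockDiag]
    · rw [A.idMat_ne _ (by simpa using h)]; exact A.idMat_ne _ h
  · rw [A.idMat_ne _ (by simp)]; rfl
  · rw [A.idMat_ne _ (by simp)]; rfl
  · by_cases h : i = j
    · subst h; simp [blockDiag]
    · rw [A.idMat_ne _ (by simpa using h)]; exact A.idMat_ne _ h

/-- The sum `A₁ ⊕ ⋯ ⊕ A_m ⊕ B₁ ⊕ ⋯ ⊕ B_n` of two formal sums. -/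
@[reducible] def osum (X Y : A.addCompl.Ob) : A.addCompl.Ob :=
  ⟨X.1 + Y.1, Sum.elim X.2 Y.2 ∘ finSumFinEquiv.symm⟩

lemma blockDiag_par {ι κ : Type} {a : ι → A.Ob} {b : κ → A.Ob} {x : ∀ i j, A.Hom (a j) (a i)}
    {y : ∀ i j, A.Hom (b j) (b i)} (hx : ∀ i j, A.par (x i j) = -x i j)
    (hy : ∀ i j, A.par (y i j) = -y i j) (s t : ι ⊕ κ) :
    A.par (blockDiag x y s t) = -blockDiag x y s t := by
  rcases s with i | i <;> rcases t with j | j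
  · exact hx i j
  · exact (map_zero A.par).trans neg_zero.symm
  · exact (map_zero A.par).trans neg_zero.symm
  · exact hy i j

lemma blockDiag_star {ι κ : Type} {a : ι → A.Ob} {b : κ → A.Ob} {x : ∀ i j, A.Hom (a j) (a i)}
    {y : ∀ i j, A.Hom (b j) (b i)} (hx : ∀ i j, A.star (x j i) = x i j)
    (hy : ∀ i j, A.star (y j i) = y i j) (s t : ι ⊕ κ) :
    A.star (blockDiag x y t s) = blockDiag x y s t := by
  rcases s with i | i <;> rcases t with j | j
  · exact hx i j
  · exact A.star_zero
  · exact A.star_zero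
  · exact hy i j

lemma blockDiag_comp {ι κ : Type} [Fintype ι] [Fintype κ] [DecidableEq ι] [DecidableEq κ]
    {a : ι → A.Ob} {b : κ → A.Ob} {x : ∀ i j, A.Hom (a j) (a i)} {y : ∀ i j, A.Hom (b j) (b i)}
    (hx : ∀ i j, ∑ k, A.comp (x i k) (x k j) = A.idMat a i j)
    (hy : ∀ i j, ∑ k, A.comp (y i k) (y k j) = A.idMat b i j) (s t : ι ⊕ κ) :
    ∑ k, A.comp (blockDiag x y s k) (blockDiag x y k t) = A.idMat (Sum.elim a b) s t := by
  rw [← blockDiag_idMat, Fintype.sum_sum_type]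
  rcases s with i | i <;> rcases t with j | j
  · exact (congrArg₂ (· + · : A.Hom (a j) (a i) → _ → _) (hx i j) (Finset.sum_eq_zero fun k _ => A.zero_comp _)).trans
      (add_zero _)
  · exact (congrArg₂ (· + ·) (Finset.sum_eq_zero fun k _ => A.comp_zero _)
      (Finset.sum_eq_zero fun k _ => A.zero_comp _)).trans (add_zero _)
  · exact (congrArg₂ (· + ·) (Finset.sum_eq_zero fun k _ => A.zero_comp _)
      (Finset.sum_eq_zero fun k _ => A.comp_zero _)).trans (add_zero _)
  · exact (congrArg₂ (· + · : A.Hom (b j) (b i) → _ → _)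
      (Finset.sum_eq_zero fun k _ => A.zero_comp _) (hy i j)).trans
      (zero_add _)

/-- The supersymmetry `x ⊕ y`. -/
def SS.oplus {X Y : A.addCompl.Ob} (x : A.addCompl.SS X) (y : A.addCompl.SS Y) :
    A.addCompl.SS (osum X Y) :=
  ⟨fun i j => blockDiag x.1 y.1 (finSumFinEquiv.symm i) (finSumFinEquiv.symm j), by
    funext i j
    exact blockDiag_par (fun i j => congrFun₂ x.2.1 i j) (fun i j => congrFun₂ y.2.1 i j) _ _, by
    funext i j
    exact blockDiag_star (fun i j => congrFun₂ x.2.2.1 i j)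
      (fun i j => congrFun₂ y.2.2.1 i j) _ _, by
    funext i j
    have key := blockDiag_comp (fun i j => congrFun₂ x.2.2.2 i j)
      (fun i j => congrFun₂ y.2.2.2 i j) (finSumFinEquiv.symm i) (finSumFinEquiv.symm j)
    rw [← Equiv.sum_comp finSumFinEquiv.symm] at key
    refine key.trans ?_
    change _ = A.idMat (Sum.elim X.2 Y.2 ∘ finSumFinEquiv.symm) i j
    by_cases h : i = j
    · subst h; simp
    · rw [A.idMat_ne _ h, A.idMat_ne _ (by simpa using h)]⟩

namespace Super

instance : Add A.Super := ⟨fun s t => ⟨osum s.ob t.ob, s.ss.oplus t.ss⟩⟩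

instance : Zero A.Super :=
  ⟨⟨⟨0, Fin.elim0⟩, ⟨0, by funext i; exact i.elim0, by funext i; exact i.elim0,
    by funext i; exact i.elim0⟩⟩⟩

/-- The entry of a supersymmetry, together with its source and target. -/
def entry (s : A.Super) (i j : Fin s.ob.1) : Σ p : A.Ob × A.Ob, A.Hom p.1 p.2 :=
  ⟨(s.ob.2 j, s.ob.2 i), s.ss.1 i j⟩

/-- The zero morphism as an entry. -/
def zeroEntry (X Y : A.Ob) : Σ p : A.Ob × A.Ob, A.Hom p.1 p.2 := ⟨(X, Y), 0⟩

lemma ext' {s t : A.Super} (h : s.ob.1 = t.ob.1)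
    (hob : ∀ i, s.ob.2 i = t.ob.2 (Fin.cast h i))
    (he : ∀ i j, s.entry i j = t.entry (Fin.cast h i) (Fin.cast h j)) : s = t := by
  obtain ⟨⟨n, a⟩, x⟩ := s
  obtain ⟨⟨m, b⟩, y⟩ := t
  obtain rfl : n = m := h
  obtain rfl : a = b := funext hob
  have : x = y := by
    apply Subtype.ext
    funext i j
    have := he i j
    simp only [entry, Fin.cast_eq_self] at this
    simpa using this
  rw [this]

@[simp] lemma add_ob_castAdd (s t : A.Super) (i : Fin s.ob.1) :
    (s + t).ob.2 (Fin.castAdd t.ob.1 i) = s.ob.2 i := by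
  change Sum.elim _ _ (finSumFinEquiv.symm _) = _
  simp

@[simp] lemma add_ob_natAdd (s t : A.Super) (i : Fin t.ob.1) :
    (s + t).ob.2 (Fin.natAdd s.ob.1 i) = t.ob.2 i := by
  change Sum.elim _ _ (finSumFinEquiv.symm _) = _
  simp

lemma entry_add (s t : A.Super) (i j : Fin (s.ob.1 + t.ob.1))
    (u v : Fin s.ob.1 ⊕ Fin t.ob.1) (hu : finSumFinEquiv.symm i = u)
    (hv : finSumFinEquiv.symm j = v) :
    (s + t).entry i j = ⟨(Sum.elim s.ob.2 t.ob.2 v, Sum.elim s.ob.2 t.ob.2 u),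
      blockDiag s.ss.1 t.ss.1 u v⟩ := by
  subst hu hv; rfl

@[simp] lemma entry_add_ll (s t : A.Super) (i j : Fin s.ob.1) :
    (s + t).entry (Fin.castAdd t.ob.1 i) (Fin.castAdd t.ob.1 j) = s.entry i j :=
  entry_add s t _ _ (.inl i) (.inl j) (by simp) (by simp)

@[simp] lemma entry_add_lr (s t : A.Super) (i : Fin s.ob.1) (j : Fin t.ob.1) :
    (s + t).entry (Fin.castAdd t.ob.1 i) (Fin.natAdd s.ob.1 j) =
      zeroEntry (t.ob.2 j) (s.ob.2 i) :=
  entry_add s t _ _ (.inl i) (.inr j) (by simp) (by simp)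

@[simp] lemma entry_add_rl (s t : A.Super) (i : Fin t.ob.1) (j : Fin s.ob.1) :
    (s + t).entry (Fin.natAdd s.ob.1 i) (Fin.castAdd t.ob.1 j) =
      zeroEntry (s.ob.2 j) (t.ob.2 i) :=
  entry_add s t _ _ (.inr i) (.inl j) (by simp) (by simp)

@[simp] lemma entry_add_rr (s t : A.Super) (i j : Fin t.ob.1) :
    (s + t).entry (Fin.natAdd s.ob.1 i) (Fin.natAdd s.ob.1 j) = t.entry i j :=
  entry_add s t _ _ (.inr i) (.inr j) (by simp) (by simp)

lemma zero_add' (s : A.Super) : 0 + s = s := by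
  have h : (0 + s).ob.1 = s.ob.1 := Nat.zero_add _
  have hc : ∀ i : Fin s.ob.1, Fin.cast h (Fin.natAdd (0 : A.Super).ob.1 i) = i := fun i => by
    ext; exact Nat.zero_add _
  refine ext' h (fun i => ?_) (fun i j => ?_)
  · refine Fin.addCases (fun i => i.elim0) (fun i => ?_) i
    rw [hc, add_ob_natAdd]
  · refine Fin.addCases (fun i => i.elim0) (fun i => ?_) i
    refine Fin.addCases (fun j => j.elim0) (fun j => ?_) j
    rw [hc, hc, entry_add_rr]

lemma add_zero' (s : A.Super) : s + 0 = s := by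
  refine ext' rfl (fun i => ?_) (fun i j => ?_)
  · refine Fin.addCases (fun i => ?_) (fun i => i.elim0) i
    rw [add_ob_castAdd]; rfl
  · refine Fin.addCases (fun i => ?_) (fun i => i.elim0) i
    refine Fin.addCases (fun j => ?_) (fun j => j.elim0) j
    rw [entry_add_ll]; rfl

lemma add_assoc' (s t r : A.Super) : s + t + r = s + (t + r) := by
  have h : (s + t + r).ob.1 = (s + (t + r)).ob.1 := Nat.add_assoc _ _ _
  have h1 : ∀ i : Fin s.ob.1, Fin.cast h (Fin.castAdd r.ob.1 (Fin.castAdd t.ob.1 i)) =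
      Fin.castAdd (t + r).ob.1 i := fun i => rfl
  have h2 : ∀ i : Fin t.ob.1, Fin.cast h (Fin.castAdd r.ob.1 (Fin.natAdd s.ob.1 i)) =
      Fin.natAdd s.ob.1 (Fin.castAdd r.ob.1 i) := fun i => rfl
  have h3 : ∀ i : Fin r.ob.1, Fin.cast h (Fin.natAdd (s + t).ob.1 i) =
      Fin.natAdd s.ob.1 (Fin.natAdd t.ob.1 i) := fun i => by
    ext; exact Nat.add_assoc _ _ _
  have cases3 : ∀ {P : Fin (s + t + r).ob.1 → Prop},
      (∀ i : Fin s.ob.1, P (Fin.castAdd r.ob.1 (Fin.castAdd t.ob.1 i))) →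
      (∀ i : Fin t.ob.1, P (Fin.castAdd r.ob.1 (Fin.natAdd s.ob.1 i))) →
      (∀ i : Fin r.ob.1, P (Fin.natAdd (s + t).ob.1 i)) → ∀ i, P i :=
    fun a b c i => Fin.addCases (fun i => Fin.addCases a b i) c i
  have o1 := add_ob_castAdd s t
  have o2 := add_ob_natAdd s t
  have e1 := entry_add_ll s t
  have e2 := entry_add_lr s t
  have e3 := entry_add_rl s t
  have e4 := entry_add_rr s t
  refine ext' h ?_ ?_
  · refine cases3 (fun i => ?_) (fun i => ?_) (fun i => ?_)
    · rw [h1]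
      exact ((add_ob_castAdd (s + t) r _).trans (o1 i)).trans (add_ob_castAdd s (t + r) i).symm
    · rw [h2]
      exact ((add_ob_castAdd (s + t) r _).trans (o2 i)).trans
        ((add_ob_natAdd s (t + r) _).trans (add_ob_castAdd t r i)).symm
    · rw [h3, add_ob_natAdd, add_ob_natAdd, add_ob_natAdd]
  · refine cases3 (fun i => ?_) (fun i => ?_) (fun i => ?_) <;>
    refine cases3 (fun j => ?_) (fun j => ?_) (fun j => ?_)
    all_goals simp only [h1, h2, h3, entry_add_ll, entry_add_lr, entry_add_rl, entry_add_rr, o1, o2,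
      e1, e2, e3, e4, add_ob_castAdd, add_ob_natAdd]

instance : AddMonoid A.Super where
  zero_add := zero_add'
  add_zero := add_zero'
  add_assoc := add_assoc'
  nsmul := nsmulRec

end Super
end UTStarCat

namespace UTStarCat

open Algebra (GrothendieckAddGroup)

variable (A : UTStarCat.{u} 𝕜)

/-- The relations `⟨x⟩ = ⟨y⟩` for supersymmetries of the same object in the same path component,
and `⟨x ⊕ y⟩ = ⟨y ⊕ x⟩`. -/
inductive V1Rel : A.Super → A.Super → Prop
  | path {X : A.addCompl.Ob} (x y : A.addCompl.SS X) (h : Joined x y) : V1Rel ⟨X, x⟩ ⟨X, y⟩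
  | comm (s t : A.Super) : V1Rel (s + t) (t + s)

/-- The abelian semigroup `V₁(A)` of classes of supersymmetries in `A_⊕`. -/
def V1 : Type u := (addConGen A.V1Rel).Quotient

instance : AddMonoid A.V1 := inferInstanceAs (AddMonoid (addConGen A.V1Rel).Quotient)

/-- The class `⟨x⟩` in `V₁(A)`. -/
def V1.mk : A.Super →+ A.V1 := (addConGen A.V1Rel).mk'

instance : AddCommMonoid A.V1 where
  add_comm a b := by
    induction a using AddCon.induction_on with
    | H s =>
      induction b using AddCon.induction_on with
      | H t => exact (AddCon.eq _).mpr (AddConGen.Rel.of _ _ (V1Rel.comm s t))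

/-- The group `G₁(A)`, the Grothendieck completion of `V₁(A)`. -/
abbrev G1 : Type u := GrothendieckAddGroup A.V1

/-- The class `⟨x⟩` in `G₁(A)`. -/
noncomputable def G1.mk : A.Super →+ A.G1 := (GrothendieckAddGroup.of).comp (V1.mk A)

/-- Van Daele's group of formal differences `⟨x⟩ - ⟨y⟩` of supersymmetries `x`, `y` of the same
object of `A_⊕`. -/
noncomputable def vanDaele : AddSubgroup A.G1 where
  carrier := {g | ∃ (X : A.addCompl.Ob) (x y : A.addCompl.SS X),
    g = G1.mk A ⟨X, x⟩ - G1.mk A ⟨X, y⟩}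
  zero_mem' := ⟨(0 : A.Super).ob, (0 : A.Super).ss, (0 : A.Super).ss, by rw [sub_self]⟩
  add_mem' := by
    rintro _ _ ⟨X, x, y, rfl⟩ ⟨X', x', y', rfl⟩
    refine ⟨osum X X', x.oplus x', y.oplus y', ?_⟩
    have h : ∀ (z : A.addCompl.SS X) (z' : A.addCompl.SS X'),
        G1.mk A ⟨osum X X', z.oplus z'⟩ = G1.mk A ⟨X, z⟩ + G1.mk A ⟨X', z'⟩ :=
      fun z z' => map_add (G1.mk A) ⟨X, z⟩ ⟨X', z'⟩
    rw [h, h]; abel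
  neg_mem' := by
    rintro _ ⟨X, x, y, rfl⟩
    exact ⟨X, y, x, by rw [neg_sub]⟩

end UTStarCat

namespace UTStarFun

open UTStarCat Algebra

variable {A B C : UTStarCat.{u} 𝕜} (f : UTStarFun A B)

lemma obj_sumElim {ι κ : Type} (a : ι → A.Ob) (b : κ → A.Ob) (u : ι ⊕ κ) :
    f.obj (Sum.elim a b u) = Sum.elim (f.obj ∘ a) (f.obj ∘ b) u := by
  rcases u with i | i <;> rfl

lemma map_blockDiag {ι κ : Type} {a : ι → A.Ob} {b : κ → A.Ob} (x : ∀ i j, A.Hom (a j) (a i))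
    (y : ∀ i j, A.Hom (b j) (b i)) (u v : ι ⊕ κ) :
    (⟨(f.obj (Sum.elim a b v), f.obj (Sum.elim a b u)), f.map (blockDiag x y u v)⟩ :
      Σ p : B.Ob × B.Ob, B.Hom p.1 p.2) =
    ⟨(Sum.elim (f.obj ∘ a) (f.obj ∘ b) v, Sum.elim (f.obj ∘ a) (f.obj ∘ b) u),
      blockDiag (a := f.obj ∘ a) (b := f.obj ∘ b) (fun i j => f.map (x i j))
        (fun i j => f.map (y i j)) u v⟩ := by
  rcases u with i | i <;> rcases v with j | j
  · rfl
  · exact congrArg (Sigma.mk (f.obj (b j), f.obj (a i))) (map_zero f.map)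
  · exact congrArg (Sigma.mk (f.obj (a j), f.obj (b i))) (map_zero f.map)
  · rfl

/-- The action of a functor on supersymmetries. -/
def mapSuper : A.Super →+ B.Super where
  toFun s := ⟨f.addCompl.obj s.ob, f.addCompl.mapSS s.ss⟩
  map_zero' := Super.ext' rfl (fun i => i.elim0) (fun i => i.elim0)
  map_add' s t := Super.ext' rfl (fun i => f.obj_sumElim s.ob.2 t.ob.2 (finSumFinEquiv.symm i))
    (fun i j => f.map_blockDiag s.ss.1 t.ss.1 (finSumFinEquiv.symm i) (finSumFinEquiv.symm j))

/-- The induced map `V₁(A) → V₁(B)`. -/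
def mapV1 : A.V1 →+ B.V1 :=
  AddCon.lift (addConGen A.V1Rel) ((V1.mk B).comp f.mapSuper) (by
    refine AddCon.addConGen_le.mpr ?_
    rintro _ _ (⟨x, y, h⟩ | ⟨s, t⟩)
    · exact (AddCon.eq _).mpr (AddConGen.Rel.of _ _
        (V1Rel.path _ _ (h.map f.addCompl.continuous_mapSS)))
    · change V1.mk B (f.mapSuper (s + t)) = V1.mk B (f.mapSuper (t + s))
      rw [map_add, map_add, map_add, map_add, add_comm])

/-- The induced map `G₁(A) → G₁(B)`. -/
noncomputable def mapG1 : A.G1 →+ B.G1 :=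
  GrothendieckAddGroup.lift (GrothendieckAddGroup.of.comp f.mapV1)

lemma mapG1_mk (s : A.Super) : f.mapG1 (G1.mk A s) = G1.mk B (f.mapSuper s) := by
  have h := DFunLike.congr_fun (GrothendieckAddGroup.lift.symm_apply_apply
    ((GrothendieckAddGroup.of (M := B.V1)).comp f.mapV1)) (V1.mk A s)
  exact h

/-- The induced map of van Daele's groups. -/
noncomputable def mapVanDaele : A.vanDaele →+ B.vanDaele :=
  (f.mapG1.comp A.vanDaele.subtype).codRestrict B.vanDaele (by
    rintro ⟨_, X, x, y, rfl⟩
    refine ⟨f.addCompl.obj X, f.addCompl.mapSS x, f.addCompl.mapSS y, ?_⟩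
    simp only [AddMonoidHom.comp_apply, AddSubgroup.subtype_apply, map_sub, mapG1_mk]
    rfl)

end UTStarFun

/-! ### `K`-theory -/

/-- Van Daele's group as a functor. If all spaces of supersymmetries of objects of `A_⊕` are
non-empty, this is the group `K₁(A)`. -/
noncomputable def vanDaele : UTStarCat.{u} 𝕜 ⥤ AddCommGrpCat.{u} where
  obj A := AddCommGrpCat.of A.vanDaele
  map f := AddCommGrpCat.ofHom (UTStarFun.mapVanDaele f)
  map_id A := by
    ext ⟨_, X, x, y, rfl⟩
    change UTStarFun.mapG1 (A := A) (B := A) (𝟙 A) (UTStarCat.G1.mk A ⟨X, x⟩ -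
      UTStarCat.G1.mk A ⟨X, y⟩) = UTStarCat.G1.mk A ⟨X, x⟩ - UTStarCat.G1.mk A ⟨X, y⟩
    rw [map_sub, UTStarFun.mapG1_mk, UTStarFun.mapG1_mk]
    rfl
  map_comp {A B C} f g := by
    ext ⟨_, X, x, y, rfl⟩
    change UTStarFun.mapG1 (A := A) (B := C) (f ≫ g) (UTStarCat.G1.mk A ⟨X, x⟩ -
      UTStarCat.G1.mk A ⟨X, y⟩) = UTStarFun.mapG1 (A := B) (B := C) g (UTStarFun.mapG1 (A := A)
      (B := B) f (UTStarCat.G1.mk A ⟨X, x⟩ - UTStarCat.G1.mk A ⟨X, y⟩))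
    simp only [map_sub, UTStarFun.mapG1_mk]
    rfl

/-- `K₁` on unital categories. The tensor product with `𝔽_{1,1}` does not change the `K`-theory and
ensures that the spaces of supersymmetries are non-empty. -/
noncomputable def K1Unital : UTStarCat.{u} 𝕜 ⥤ AddCommGrpCat.{u} :=
  cliffU 1 1 ⋙ vanDaele

/-- `K₁` on not necessarily unital categories: the kernel of `K₁(A⁺) → K₁(𝔽_A)`. -/
noncomputable def K1NonUnital : TStarCat.{u} 𝕜 ⥤ AddCommGrpCat.{u} :=
  Limits.kernel (Functor.whiskerRight toZero (unitization ⋙ K1Unital))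

namespace UGCStarCat

/-- The group of formal differences `⟨x⟩ - ⟨y⟩` of supersymmetries of the same object of `A_⊕`; this
is `K₁(A)` when all spaces of supersymmetries are non-empty. -/
noncomputable def K1Direct : UGCStarCat.{u} 𝕜 ⥤ AddCommGrpCat.{u} :=
  forgetUGC ⋙ vanDaele

/-- The functor `K₁` on small unital graded C*-categories. -/
noncomputable def K1 : UGCStarCat.{u} 𝕜 ⥤ AddCommGrpCat.{u} :=
  forgetUGC ⋙ K1Unital

/-- The functor `K_n`, `n = 1 - (p - q)`, on small unital graded C*-categories, in the form
`K₁(A ⊗ 𝔽_{p,q})`. -/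
noncomputable def K (p q : ℕ) : UGCStarCat.{u} 𝕜 ⥤ AddCommGrpCat.{u} :=
  forgetUGC ⋙ cliffU p q ⋙ K1Unital

end UGCStarCat

namespace GCStarCat

/-- The functor `K₁` on small, not necessarily unital, graded C*-categories. -/
noncomputable def K1 : GCStarCat.{u} 𝕜 ⥤ AddCommGrpCat.{u} :=
  forgetGC ⋙ K1NonUnital

/-- The functor `K_n`, `n = 1 - (p - q)`, on small, not necessarily unital, graded C*-categories, in
the form `K₁(A ⊗ 𝔽_{p,q})`. -/
noncomputable def K (p q : ℕ) : GCStarCat.{u} 𝕜 ⥤ AddCommGrpCat.{u} :=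
  forgetGC ⋙ cliffT p q ⋙ K1NonUnital

end GCStarCat

end GradedCStar

open CategoryTheory GradedCStar

/-! A direct limit is given only by its universal property, whereas van Daele's groups depend on the
morphisms and their topology. The limit is therefore first made concrete, in the form
`IsDirectLimit`: its objects are those of the stages up to eventual equality, the images of the
stages are dense, and the norm of the image of `x` in the limit is the limit of the norms of its
images at the stages.

Two test cocones extract this from the universal property. The first is the category of germs
`germCat`, made of bounded families of morphisms modulo null families. Its norm is the upper limit
of the norms at the stages, and C*-functors are norm-decreasing, so the functor from the limit to it
bounds these norms by the norm in the limit; the same functor shows that objects identified in the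
limit are identified at some stage. The second is the closed subcategory `IsCompat.sub` generated by
the images. The identity of the limit factors through its inclusion, which gives surjectivity on
objects and density. That both cocones satisfy the positivity axiom rests on two resolvent
estimates, `IsResolvent.norm_le` and `IsResolvent.norm_sub_le`.

Only the topology of the morphism sets enters K-theory. Sum norms can thus replace C*-norms, and
`IsDirectLimit` passes easily to Clifford tensor products, unitizations and additive completions.

The analytic core is the stability of supersymmetries in Banach algebras with involution. A Newton
iteration moves an odd self-adjoint `z` with `z²` near `1` to a supersymmetry
(`exists_mul_self_eq_one_near`), and a Cayley transform joins close supersymmetries by a path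
(`exists_path_mul_self_eq_one`). Hence supersymmetries of the limit have approximate lifts, and
lifts of close ones have eventually the same class (`exists_near`, `exists_V1_mk_eq`).

For injectivity on `V₁`, call two supersymmetries of the limit related if they have arbitrarily
close lifts with a common class (`LiftRel`). This is a congruence that contains both kinds of
generating relations, so it contains equality in `V₁` (`exists_V1_mk_eq_of_map_eq`). Passing to
differences gives `isColimit_vanDaele`; the non-unital case follows because kernels commute with
filtered colimits (`isColimit_kernel`). -/

namespace GradedCStar

open Filter Topology CategoryTheory

variable {𝕜 : Type} [RCLike 𝕜]

/-! ### Supersymmetries in Banach algebras -/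

section BanachAlgebra

variable {R : Type*} [NormedRing R] [NormedAlgebra 𝕜 R]

variable (𝕜) in
/-- One step of the Newton iteration for a square root of `1`. -/
noncomputable def newtonStep (z : R) : R := z + (2⁻¹ : 𝕜) • (z * (1 - z * z))

/-- With `e = 1 - z²` the step multiplies `z` by `1 + e/2`, and `(1 - e)(1 + e/2)² = 1 - (3/4)e² -
(1/4)e³`. The error is thus replaced by a quantity of second order. -/
lemma one_sub_newtonStep_sq (z : R) :
    1 - newtonStep 𝕜 z * newtonStep 𝕜 z =
      (3 / 4 : 𝕜) • ((1 - z * z) * (1 - z * z)) +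
        (1 / 4 : 𝕜) • ((1 - z * z) * ((1 - z * z) * (1 - z * z))) := by
  simp only [newtonStep, mul_add, add_mul, mul_sub, sub_mul, mul_one, one_mul, smul_mul_assoc,
    mul_smul_comm, smul_sub, mul_assoc]
  module

lemma norm_newtonStep_sub_le (z : R) :
    ‖newtonStep 𝕜 z - z‖ ≤ ‖z‖ * ‖1 - z * z‖ / 2 := by
  rw [newtonStep, add_sub_cancel_left, norm_smul]
  have := norm_mul_le z (1 - z * z)
  rw [norm_inv, RCLike.norm_ofNat]
  linarith

lemma norm_one_sub_newtonStep_sq_le (z : R) (hz : ‖1 - z * z‖ ≤ 1) :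
    ‖1 - newtonStep 𝕜 z * newtonStep 𝕜 z‖ ≤ ‖1 - z * z‖ * ‖1 - z * z‖ := by
  rw [one_sub_newtonStep_sq]
  generalize 1 - z * z = e at *
  have h1 := norm_mul_le e e
  have h2 := norm_mul_le e (e * e)
  have h3 : ‖e‖ * ‖e * e‖ ≤ 1 * (‖e‖ * ‖e‖) := by gcongr
  refine (norm_add_le _ _).trans ?_
  rw [norm_smul, norm_smul]
  have e1 : ‖(3 / 4 : 𝕜)‖ = 3 / 4 := by simp [norm_div]
  have e2 : ‖(1 / 4 : 𝕜)‖ = 1 / 4 := by simp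
  rw [e1, e2]
  linarith

/-- An approximate square root of `1` in a closed set stable under the Newton iteration is close to
a
square root of `1` in this set. -/
lemma exists_mul_self_eq_one_near [CompleteSpace R] {S : Set R} (hS : IsClosed S)
    (hstep : ∀ z ∈ S, newtonStep 𝕜 z ∈ S) {z : R} (hz : z ∈ S) (h : ‖1 - z * z‖ ≤ 1 / 2) :
    ∃ x ∈ S, x * x = 1 ∧ ‖x - z‖ ≤ 2 * ‖z‖ * ‖1 - z * z‖ := by
  set u : ℕ → R := fun n => (newtonStep 𝕜)^[n] z with hu
  set d := ‖1 - z * z‖ with hd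
  have hsucc : ∀ n, u (n + 1) = newtonStep 𝕜 (u n) := fun n => Function.iterate_succ_apply' _ _ _
  have hmem : ∀ n, u n ∈ S := fun n => by
    induction n with
    | zero => exact hz
    | succ n ih => rw [hsucc]; exact hstep _ ih
  -- The convergence is quadratic, but halving is enough: the error is at most `1/2` throughout, so
  -- squaring it at least halves it.
  have he : ∀ n, ‖1 - u n * u n‖ ≤ d * (1 / 2) ^ n := fun n => by
    induction n with
    | zero => simp [hu, hd]
    | succ n ih =>
      have hp : ((1 : ℝ) / 2) ^ n ≤ 1 := pow_le_one₀ (by norm_num) (by norm_num)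
      have hle : ‖1 - u n * u n‖ ≤ 1 / 2 := ih.trans (by
        have := mul_le_mul h hp (by positivity) (by norm_num : (0 : ℝ) ≤ 1 / 2); linarith)
      rw [hsucc]
      calc _ ≤ ‖1 - u n * u n‖ * ‖1 - u n * u n‖ :=
            norm_one_sub_newtonStep_sq_le _ (hle.trans (by norm_num))
        _ ≤ (d * (1 / 2) ^ n) * (1 / 2) := by gcongr
        _ = _ := by rw [pow_succ]; ring
  -- A step has length at most half of `‖u n‖` times the error. With `‖u n‖ ≤ 2‖z‖` and error at
  -- most `(1/2)^(n+1)` this is `‖z‖ (1/2)^(n+1)`, which is the increment of the bound.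
  have hb : ∀ n, ‖u n‖ ≤ ‖z‖ * (2 - (1 / 2) ^ n) := fun n => by
    induction n with
    | zero => simp only [hu, Function.iterate_zero, id, pow_zero]; linarith
    | succ n ih =>
      have h1 := norm_newtonStep_sub_le (𝕜 := 𝕜) (u n)
      have h2 : ‖u n‖ * ‖1 - u n * u n‖ ≤ (‖z‖ * 2) * ((1 / 2) * (1 / 2) ^ n) := by
        have : (0 : ℝ) ≤ (1 / 2) ^ n := by positivity
        refine mul_le_mul (ih.trans ?_) ((he n).trans ?_) (norm_nonneg _) (by positivity)
        · gcongr; linarith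
        · gcongr
      rw [hsucc]
      have h3 := norm_add_le (newtonStep 𝕜 (u n) - u n) (u n)
      rw [sub_add_cancel] at h3
      rw [pow_succ]
      linarith
  have hdist : ∀ n, dist (u n) (u (n + 1)) ≤ ‖z‖ * d * (1 / 2) ^ n := fun n => by
    rw [dist_comm, dist_eq_norm, hsucc]
    have h1 := norm_newtonStep_sub_le (𝕜 := 𝕜) (u n)
    have h2 : ‖u n‖ * ‖1 - u n * u n‖ ≤ (‖z‖ * 2) * (d * (1 / 2) ^ n) := by
      have : (0 : ℝ) ≤ (1 / 2) ^ n := by positivity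
      refine mul_le_mul ((hb n).trans ?_) (he n) (norm_nonneg _) (by positivity)
      gcongr; linarith
    linarith
  obtain ⟨x, hx⟩ := cauchySeq_tendsto_of_complete
    (cauchySeq_of_le_geometric (1 / 2) _ (by norm_num) hdist)
  refine ⟨x, hS.mem_of_tendsto hx (Eventually.of_forall hmem), ?_, ?_⟩
  · have h1 : Tendsto (fun n => 1 - u n * u n) atTop (𝓝 (1 - x * x)) :=
      tendsto_const_nhds.sub (hx.mul hx)
    have h2 : Tendsto (fun n => 1 - u n * u n) atTop (𝓝 0) := by
      refine squeeze_zero_norm he ?_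
      simpa using (tendsto_pow_atTop_nhds_zero_of_lt_one (by norm_num : (0 : ℝ) ≤ 1 / 2)
        (by norm_num)).const_mul d
    exact (sub_eq_zero.mp (tendsto_nhds_unique h1 h2)).symm
  · have := dist_le_of_le_geometric_of_tendsto₀ (1 / 2) _ (by norm_num) hdist hx
    rw [dist_comm, dist_eq_norm] at this
    refine this.trans (le_of_eq ?_)
    ring

/-- The Cayley transform of a product of two close self-adjoint odd square roots of `1`. -/
lemma exists_cayley {R : Type*} [NormedRing R] (𝕜 : Type) [RCLike 𝕜] [NormedAlgebra 𝕜 R]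
    [CompleteSpace R] [StarRing R] (θ : R →+* R) {x y : R}
    (hx : θ x = -x ∧ star x = x ∧ x * x = 1) (hy : θ y = -y ∧ star y = y ∧ y * y = 1)
    (h : ‖y - x‖ * ‖x‖ < 1 / 2) :
    ∃ k : R, ‖k‖ < 1 ∧ star k = -k ∧ x * k * x = -k ∧ θ k = k ∧ y * (1 + k) = x * (1 - k) := by
  -- The element `w` is close to `1` and has inverse `star w = x * y`. Its Cayley transform is `k =
  -- (w - 1)(1 + w)⁻¹`; the symmetries of `k` all follow from uniqueness of the solution of `k (1 +
  -- w) = w - 1` or of `(1 + w) k = w - 1`.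
  obtain ⟨w, hw⟩ : ∃ w, w = y * x := ⟨_, rfl⟩
  have hws : star w = x * y := by rw [hw, star_mul, hx.2.1, hy.2.1]
  have hθw : θ w = w := by rw [hw, map_mul, hx.1, hy.1, neg_mul_neg]
  have hyw : y * w = x := by rw [hw, ← mul_assoc, hy.2.2, one_mul]
  have hw1 : w * (x * y) = 1 := by rw [hw, mul_assoc, ← mul_assoc x x, hx.2.2, one_mul, hy.2.2]
  have hxwx : x * w * x = x * y := by rw [hw, mul_assoc, mul_assoc, hx.2.2, mul_one]
  have hnw : ‖w - 1‖ < 1 / 2 := by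
    have : w - 1 = (y - x) * x := by rw [sub_mul, hx.2.2, hw]
    rw [this]; exact (norm_mul_le _ _).trans_lt h
  have hlt : ‖(2⁻¹ : 𝕜) • (1 - w)‖ < 1 := by
    rw [norm_smul, norm_inv, RCLike.norm_ofNat, norm_sub_rev]; linarith
  have hu : (2 : 𝕜) • ((Units.oneSub _ hlt : Rˣ) : R) = 1 + w := by
    rw [Units.val_oneSub]; module
  set v := Units.oneSub _ hlt
  set I : R := (2⁻¹ : 𝕜) • (↑v⁻¹ : R) with hI
  have hI1 : (1 + w) * I = 1 := by rw [← hu, hI, smul_mul_smul_comm]; simp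
  have hI2 : I * (1 + w) = 1 := by rw [← hu, hI, smul_mul_smul_comm]; simp
  set k := (w - 1) * I with hk
  have hkw : k * (1 + w) = w - 1 := by rw [hk, mul_assoc, hI2, mul_one]
  have hkw' : (1 + w) * k = w - 1 := by
    have : (1 + w) * (w - 1) = (w - 1) * (1 + w) := by noncomm_ring
    rw [hk, ← mul_assoc, this, mul_assoc, hI1, mul_one]
  have huniq : ∀ m, m * (1 + w) = w - 1 → m = k := fun m hm => by
    rw [hk, ← hm, mul_assoc, hI1, mul_one]
  have huniq' : ∀ m, (1 + w) * m = w - 1 → m = k := fun m hm => by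
    rw [← one_mul m, ← one_mul k, ← hI2, mul_assoc, mul_assoc, hm, hkw']
  refine ⟨k, ?_, ?_, ?_, ?_, ?_⟩
  -- This identity gives `2‖k‖ ≤ ‖w - 1‖ + ‖k‖‖w - 1‖ ≤ 1/2 + ‖k‖/2`, so even `‖k‖ ≤ 1/3`.
  · have e : (2 : 𝕜) • k = (w - 1) - k * (w - 1) := by
      have : (2 : 𝕜) • k = k * (1 + w) - k * (w - 1) := by
        rw [mul_add, mul_sub, mul_one, two_smul]; abel
      rw [this, hkw]
    have h1 : ‖(2 : 𝕜) • k‖ = 2 * ‖k‖ := by rw [norm_smul, RCLike.norm_ofNat]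
    have h2 := norm_sub_le (w - 1) (k * (w - 1))
    have h3 := norm_mul_le k (w - 1)
    have h4 : ‖k‖ * ‖w - 1‖ ≤ ‖k‖ * (1 / 2) := by gcongr
    rw [← e, h1] at h2
    linarith
  · rw [← neg_eq_iff_eq_neg]
    refine huniq' _ ?_
    have h1 : (1 + x * y) * star I = 1 := by
      have := congrArg star hI2
      rwa [star_mul, star_add, star_one, hws] at this
    have h2 : 1 + w = w * (1 + x * y) := by rw [mul_add, mul_one, hw1, add_comm]
    rw [hk, star_mul, star_sub, star_one, hws, h2, mul_neg, mul_assoc, ← mul_assoc _ (star I), h1,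
      one_mul, mul_sub, hw1, mul_one, neg_sub]
  · rw [← neg_eq_iff_eq_neg]
    refine huniq _ ?_
    have h2 : x * (1 + w) = (1 + w) * (x * y) * x := by
      have : w * (x * y) * x = x := by rw [hw1, one_mul]
      rw [add_mul, add_mul, this, mul_add, mul_one, one_mul, hw, add_comm, mul_assoc]
    rw [neg_mul, mul_assoc, h2, mul_assoc x, ← mul_assoc k, ← mul_assoc k, hkw, sub_mul, hw1,
      one_mul,
      sub_mul, mul_sub, one_mul, hx.2.2, mul_assoc x y x, ← mul_assoc x x, hx.2.2, one_mul, ← hw,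
      neg_sub]
  · refine huniq _ ?_
    have := congrArg θ hkw
    rwa [map_mul, map_sub, map_add, map_one, hθw] at this
  · have h1 : 1 + k = w * (1 - k) := by
      have h2 : k + w * k = w - 1 := by rw [← hkw', add_mul, one_mul]
      rw [mul_sub, mul_one, eq_sub_iff_add_eq, add_assoc, h2, add_sub_cancel]
    rw [h1, ← mul_assoc, hyw]

lemma isUnit_one_add_of_norm_lt_one [CompleteSpace R] {k : R} (hk : ‖k‖ < 1) :
    IsUnit (1 + k) := by
  have := (Units.oneSub (-k) (by rwa [norm_neg])).isUnit
  rwa [Units.val_oneSub, sub_neg_eq_add] at this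

/-- Close self-adjoint odd square roots of `1` are connected by a path of such elements. -/
lemma exists_path_mul_self_eq_one [CompleteSpace R] [StarRing R] [StarModule 𝕜 R] (θ : R →+* R)
    (hθ : ∀ (c : 𝕜) (a : R), θ (c • a) = c • θ a) {x y : R}
    (hx : θ x = -x ∧ star x = x ∧ x * x = 1) (hy : θ y = -y ∧ star y = y ∧ y * y = 1)
    (h : ‖y - x‖ * ‖x‖ < 1 / 2) :
    ∃ γ : unitInterval → R, Continuous γ ∧ γ 0 = x ∧ γ 1 = y ∧
      ∀ t, θ (γ t) = -γ t ∧ star (γ t) = γ t ∧ γ t * γ t = 1 := by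
  obtain ⟨k, hk, hks, hxk, hθk, hyk⟩ := exists_cayley 𝕜 θ hx hy h
  -- The path conjugates `x` by `g t = 1 + t k`. As `k` is skew-adjoint and anticommutes with `x`,
  -- one has `g x = x g^*`; at `t = 1` this is `x (1 - k) = y (1 + k)`, so the path ends at `y`. The
  -- elements `g t` need not be unitary: that `g` is normal suffices for the conjugates to be
  -- self-adjoint.
  set g : unitInterval → R := fun t => 1 + ((t : ℝ) : 𝕜) • k with hg
  have hgu : ∀ t, IsUnit (g t) := fun t => isUnit_one_add_of_norm_lt_one (by
    rw [norm_smul, RCLike.norm_ofReal, abs_of_nonneg t.2.1]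
    exact lt_of_le_of_lt (mul_le_of_le_one_left (norm_nonneg _) t.2.2) hk)
  have hgx : ∀ t, g t * x = x * star (g t) := fun t => by
    have : k * x = -(x * k) := by
      rw [← neg_eq_iff_eq_neg, ← neg_mul, ← hxk, mul_assoc, hx.2.2, mul_one]
    simp only [hg, star_add, star_one, star_smul, hks, add_mul, mul_add, one_mul, mul_one,
      smul_mul_assoc, mul_smul_comm, this, mul_neg, RCLike.star_def, RCLike.conj_ofReal]
  have hgs : ∀ t, star (g t) * g t = g t * star (g t) := fun t => by
    simp only [hg, star_add, star_one, star_smul, hks, RCLike.star_def, RCLike.conj_ofReal,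
      smul_neg,
      add_mul, mul_add, one_mul, mul_one, neg_mul, mul_neg]
    abel
  have hi1 : ∀ t, g t * Ring.inverse (g t) = 1 := fun t => Ring.mul_inverse_cancel _ (hgu t)
  have hi2 : ∀ t, Ring.inverse (g t) * g t = 1 := fun t => Ring.inverse_mul_cancel _ (hgu t)
  have hinv : ∀ t m, m * g t = 1 → m = Ring.inverse (g t) := fun t m hm => by
    rw [← mul_one m, ← hi1 t, ← mul_assoc, hm, one_mul]
  have hθg : ∀ t, θ (g t) = g t := fun t => by simp [hg, hθ, hθk]
  refine ⟨fun t => g t * x * Ring.inverse (g t), ?_, ?_, ?_, fun t => ⟨?_, ?_, ?_⟩⟩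
  · have hgc : Continuous g :=
      continuous_const.add ((RCLike.continuous_ofReal.comp continuous_subtype_val).smul
        continuous_const)
    refine (hgc.mul continuous_const).mul (continuous_iff_continuousAt.mpr fun t => ?_)
    obtain ⟨v, hv⟩ := hgu t
    refine ContinuousAt.comp (g := Ring.inverse) ?_ hgc.continuousAt
    rw [← hv]
    exact NormedRing.inverse_continuousAt v
  · simp [hg]
  · have hg1 : g 1 = 1 + k := by simp [hg]
    have hs : star (1 + k) = 1 - k := by rw [star_add, star_one, hks, sub_eq_add_neg]
    change g 1 * x * Ring.inverse (g 1) = y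
    rw [hgx, hg1, hs, ← hyk, ← hg1, mul_assoc, hi1, mul_one]
  · have : θ (Ring.inverse (g t)) = Ring.inverse (g t) := hinv t _ (by
      have := congrArg θ (hi2 t)
      rwa [map_mul, hθg, map_one] at this)
    rw [map_mul, map_mul, hθg, this, hx.1, mul_neg, neg_mul]
  · have h1 : star (g t) * star (Ring.inverse (g t)) = 1 := by
      rw [← star_mul, hi2, star_one]
    have h2 : star (Ring.inverse (g t)) * star (g t) = 1 := by
      rw [← star_mul, hi1, star_one]
    have h3 : star (g t) * Ring.inverse (g t) = Ring.inverse (g t) * star (g t) := by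
      calc _ = Ring.inverse (g t) * (g t * star (g t)) * Ring.inverse (g t) := by
            rw [← mul_assoc, hi2, one_mul]
        _ = _ := by rw [← hgs, ← mul_assoc, mul_assoc, hi1, mul_one]
    have h4 : star (g t) * x = x * g t := by
      have := congrArg star (hgx t)
      rw [star_mul, star_mul, star_star, hx.2.1] at this
      calc star (g t) * x = x * (x * star (g t)) * x := by
            rw [← mul_assoc, hx.2.2, one_mul]
        _ = _ := by rw [← hgx, mul_assoc, mul_assoc, hx.2.2, mul_one]
    have h5 : star (Ring.inverse (g t)) * x = x * Ring.inverse (g t) := by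
      calc _ = star (Ring.inverse (g t)) * (x * g t) * Ring.inverse (g t) := by
            rw [mul_assoc, mul_assoc, hi1, mul_one]
        _ = _ := by rw [← h4, ← mul_assoc, h2, one_mul]
    rw [star_mul, star_mul, hx.2.1, ← mul_assoc, h5, mul_assoc, ← h3, ← mul_assoc, ← hgx]
  · calc _ = g t * x * (Ring.inverse (g t) * g t) * x * Ring.inverse (g t) := by noncomm_ring
      _ = _ := by rw [hi2, mul_one, mul_assoc (g t), hx.2.2, mul_one, hi1]

end BanachAlgebra

/-! ### Morphisms along equalities of objects -/

namespace TStarCat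

variable (A : TStarCat.{u} 𝕜)

/-- Transport of morphisms along equalities of objects. -/
def hcast {X X' Y Y' : A.Ob} (hX : X = X') (hY : Y = Y') : A.Hom X Y →ₗ[𝕜] A.Hom X' Y' :=
  hX ▸ hY ▸ LinearMap.id

@[simp] lemma hcast_rfl {X Y : A.Ob} (x : A.Hom X Y) : A.hcast rfl rfl x = x := rfl

lemma hcast_star {X X' Y Y' : A.Ob} (hX : X = X') (hY : Y = Y') (x : A.Hom X Y) :
    A.hcast hY hX (A.star x) = A.star (A.hcast hX hY x) := by
  subst hX hY; rfl

lemma hcast_par {X X' Y Y' : A.Ob} (hX : X = X') (hY : Y = Y') (x : A.Hom X Y) :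
    A.hcast hX hY (A.par x) = A.par (A.hcast hX hY x) := by
  subst hX hY; rfl

lemma neg_comp {X Y Z : A.Ob} (x : A.Hom Y Z) (y : A.Hom X Y) : A.comp (-x) y = -A.comp x y :=
  A.compₗ.map_neg₂ x y

lemma comp_neg {X Y Z : A.Ob} (x : A.Hom Y Z) (y : A.Hom X Y) : A.comp x (-y) = -A.comp x y :=
  (A.compₗ x).map_neg y

lemma sub_comp {X Y Z : A.Ob} (x x' : A.Hom Y Z) (y : A.Hom X Y) :
    A.comp (x - x') y = A.comp x y - A.comp x' y :=
  A.compₗ.map_sub₂ x x' y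

lemma comp_sub {X Y Z : A.Ob} (x : A.Hom Y Z) (y y' : A.Hom X Y) :
    A.comp x (y - y') = A.comp x y - A.comp x y' :=
  (A.compₗ x).map_sub y y'

lemma star_sub {X Y : A.Ob} (x y : A.Hom X Y) : A.star (x - y) = A.star x - A.star y :=
  map_sub A.starₐ x y

end TStarCat

/-! ### Banach norms -/

variable (𝕜) in
/-- A complete norm that defines the topology of a vector space. -/
structure IsBanachNorm {E : Type*} [AddCommGroup E] [Module 𝕜 E] [TopologicalSpace E]
    (n : E → ℝ) : Prop where
  add_le : ∀ x y, n (x + y) ≤ n x + n y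
  smul : ∀ (c : 𝕜) x, n (c • x) = ‖c‖ * n x
  eq_zero : ∀ x, n x = 0 → x = 0
  nhds_basis : ∀ x, (𝓝 x).HasBasis (fun ε : ℝ => 0 < ε) fun ε => {y | n (y - x) < ε}
  complete : ∀ u : ℕ → E, (∀ k, n (u (k + 1) - u k) ≤ (1 / 2) ^ k) → ∃ x, Tendsto u atTop (𝓝 x)

namespace IsBanachNorm

lemma of_norm {E : Type*} [NormedAddCommGroup E] [NormedSpace 𝕜 E] [CompleteSpace E] :
    IsBanachNorm 𝕜 (norm : E → ℝ) where
  add_le := norm_add_le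
  smul := norm_smul
  eq_zero _ := norm_eq_zero.mp
  nhds_basis x := by
    convert Metric.nhds_basis_ball (x := x) using 2 with ε
    ext y
    rw [Metric.mem_ball, dist_eq_norm]
    rfl
  complete u hu := cauchySeq_tendsto_of_complete
    (cauchySeq_of_le_geometric (1 / 2) 1 (by norm_num) fun k => by
      rw [dist_comm, dist_eq_norm, one_mul]; exact hu k)

section
variable {E : Type*} [AddCommGroup E] [Module 𝕜 E] [TopologicalSpace E] {n : E → ℝ}
  (hn : IsBanachNorm 𝕜 n)
include hn

lemma zero : n 0 = 0 := by simpa using hn.smul 0 0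

lemma neg (x : E) : n (-x) = n x := by simpa using hn.smul (-1) x

lemma nonneg (x : E) : 0 ≤ n x := by
  have := hn.add_le x (-x)
  rw [add_neg_cancel, hn.zero, hn.neg] at this
  linarith

lemma submodule (p : Submodule 𝕜 E) (hp : IsClosed (p : Set E)) :
    IsBanachNorm 𝕜 fun x : p => n x where
  add_le x y := hn.add_le x y
  smul c x := hn.smul c x
  eq_zero x hx := Subtype.ext (hn.eq_zero x hx)
  nhds_basis x := by
    rw [nhds_subtype]
    exact (hn.nhds_basis x).comap _
  complete u hu := by
    obtain ⟨x, hx⟩ := hn.complete (fun k => u k) hu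
    exact ⟨⟨x, hp.mem_of_tendsto hx (Eventually.of_forall fun k => (u k).2)⟩,
      tendsto_subtype_rng.mpr hx⟩

lemma prod {F : Type*} [AddCommGroup F] [Module 𝕜 F] [TopologicalSpace F] {m : F → ℝ}
    (hm : IsBanachNorm 𝕜 m) : IsBanachNorm 𝕜 fun x : E × F => n x.1 + m x.2 where
  add_le x y := by
    have h1 := hn.add_le x.1 y.1
    have h2 := hm.add_le x.2 y.2
    simp only [Prod.fst_add, Prod.snd_add]
    linarith
  smul c x := by simp only [Prod.smul_fst, Prod.smul_snd, hn.smul, hm.smul, mul_add]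
  eq_zero x hx := by
    have h1 := hn.nonneg x.1
    have h2 := hm.nonneg x.2
    exact Prod.ext (hn.eq_zero _ (by linarith)) (hm.eq_zero _ (by linarith))
  nhds_basis x := by
    refine ((hn.nhds_basis x.1).prod_nhds (hm.nhds_basis x.2)).to_hasBasis ?_ ?_
    · rintro ⟨ε, δ⟩ ⟨hε, hδ⟩
      refine ⟨min ε δ, lt_min hε hδ, fun y hy => ?_⟩
      have h1 := hn.nonneg (y.1 - x.1)
      have h2 := hm.nonneg (y.2 - x.2)
      have hy' : n (y.1 - x.1) + m (y.2 - x.2) < min ε δ := hy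
      obtain ⟨h3, h4⟩ := lt_min_iff.mp hy'
      exact ⟨lt_of_le_of_lt (by linarith) h3, lt_of_le_of_lt (by linarith) h4⟩
    · intro ε hε
      refine ⟨(ε / 2, ε / 2), ⟨half_pos hε, half_pos hε⟩, fun y hy => ?_⟩
      exact (add_lt_add hy.1 hy.2).trans_eq (add_halves ε)
  complete u hu := by
    obtain ⟨x, hx⟩ := hn.complete (fun k => (u k).1) fun k =>
      le_trans (le_add_of_nonneg_right (hm.nonneg _)) (hu k)
    obtain ⟨y, hy⟩ := hm.complete (fun k => (u k).2) fun k =>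
      le_trans (le_add_of_nonneg_left (hn.nonneg _)) (hu k)
    exact ⟨(x, y), hx.prodMk_nhds hy⟩

end

lemma pi {ι : Type*} [Fintype ι] {E : ι → Type*} [∀ i, AddCommGroup (E i)] [∀ i, Module 𝕜 (E i)]
    [∀ i, TopologicalSpace (E i)] {n : ∀ i, E i → ℝ} (hn : ∀ i, IsBanachNorm 𝕜 (n i)) :
    IsBanachNorm 𝕜 fun x : ∀ i, E i => ∑ i, n i (x i) where
  add_le x y := by
    rw [← Finset.sum_add_distrib]
    exact Finset.sum_le_sum fun i _ => (hn i).add_le _ _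
  smul c x := by
    rw [Finset.mul_sum]
    exact Finset.sum_congr rfl fun i _ => (hn i).smul _ _
  eq_zero x hx := funext fun i => (hn i).eq_zero _
    ((Finset.sum_eq_zero_iff_of_nonneg fun i _ => (hn i).nonneg _).mp hx i (Finset.mem_univ i))
  nhds_basis x := by
    refine ⟨fun s => ⟨fun hs => ?_, ?_⟩⟩
    · rw [nhds_pi] at hs
      obtain ⟨⟨I, ε⟩, ⟨hI, hε⟩, hs⟩ := (hasBasis_pi fun i => (hn i).nhds_basis (x i)).mem_iff.mp hs
      have : ∀ᶠ δ : ℝ in 𝓝[>] 0, ∀ i, i ∈ I → δ < ε i := eventually_all.mpr fun i => by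
        by_cases hi : i ∈ I
        · filter_upwards [mem_nhdsWithin_of_mem_nhds (Iio_mem_nhds (hε i hi))] with δ hδ _ using hδ
        · exact Eventually.of_forall fun δ h => absurd h hi
      obtain ⟨δ, hδ, hδ0⟩ := (this.and self_mem_nhdsWithin).exists
      refine ⟨δ, hδ0, fun y hy => hs fun i hi => ?_⟩
      exact lt_of_le_of_lt (Finset.single_le_sum (f := fun i => n i ((y - x) i))
        (fun i _ => (hn i).nonneg _) (Finset.mem_univ i)) (lt_trans hy (hδ i hi))
    · rintro ⟨ε, hε, hs⟩
      refine mem_of_superset ?_ hs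
      -- The added `1` covers an empty index type and makes the final inequality strict.
      have hc : (0 : ℝ) < Fintype.card ι + 1 := by positivity
      have : ∀ᶠ y in 𝓝 x, ∀ i, n i (y i - x i) < ε / (Fintype.card ι + 1) :=
        eventually_all.mpr fun i => (continuous_apply i).continuousAt.eventually
          (((hn i).nhds_basis (x i)).mem_of_mem (div_pos hε hc))
      filter_upwards [this] with y hy
      calc ∑ i, n i (y i - x i) ≤ ∑ i : ι, ε / (Fintype.card ι + 1) :=
            Finset.sum_le_sum fun i _ => (hy i).le
        _ = Fintype.card ι * ε / (Fintype.card ι + 1) := by simp [mul_div_assoc]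
        _ < ε := by rw [div_lt_iff₀ hc]; linarith
  complete u hu := by
    have : ∀ i, ∃ y, Tendsto (fun k => u k i) atTop (𝓝 y) := fun i => (hn i).complete _ fun k =>
      le_trans (Finset.single_le_sum (f := fun i => n i ((u (k + 1) - u k) i))
        (fun i _ => (hn i).nonneg _) (Finset.mem_univ i)) (hu k)
    choose y hy using this
    exact ⟨y, tendsto_pi_nhds.mpr hy⟩

end IsBanachNorm

/-- A complete submultiplicative norm on a topological graded ⋆-category that defines its topology
and is not increased by the involution and the parity operator. -/
structure Bnorm (A : TStarCat.{u} 𝕜) where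
  nrm : ∀ {X Y}, A.Hom X Y → ℝ
  isBanachNorm : ∀ X Y, IsBanachNorm 𝕜 (nrm : A.Hom X Y → ℝ)
  comp_le : ∀ {X Y Z} (x : A.Hom Y Z) (y : A.Hom X Y), nrm (A.comp x y) ≤ nrm x * nrm y
  star_le : ∀ {X Y} (x : A.Hom X Y), nrm (A.star x) ≤ nrm x
  par_le : ∀ {X Y} (x : A.Hom X Y), nrm (A.par x) ≤ nrm x

namespace Bnorm

section
variable {A : TStarCat.{u} 𝕜} (N : Bnorm A)

lemma add_le {X Y : A.Ob} (x y : A.Hom X Y) : N.nrm (x + y) ≤ N.nrm x + N.nrm y :=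
  (N.isBanachNorm X Y).add_le x y

lemma smul {X Y : A.Ob} (c : 𝕜) (x : A.Hom X Y) : N.nrm (c • x) = ‖c‖ * N.nrm x :=
  (N.isBanachNorm X Y).smul c x

lemma eq_zero {X Y : A.Ob} (x : A.Hom X Y) : N.nrm x = 0 → x = 0 :=
  (N.isBanachNorm X Y).eq_zero x

@[simp] lemma nrm_zero {X Y : A.Ob} : N.nrm (0 : A.Hom X Y) = 0 := (N.isBanachNorm X Y).zero

lemma nrm_neg {X Y : A.Ob} (x : A.Hom X Y) : N.nrm (-x) = N.nrm x :=
  (N.isBanachNorm X Y).neg x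

lemma nonneg {X Y : A.Ob} (x : A.Hom X Y) : 0 ≤ N.nrm x :=
  (N.isBanachNorm X Y).nonneg x

lemma sub_le {X Y : A.Ob} (x y : A.Hom X Y) : N.nrm (x - y) ≤ N.nrm x + N.nrm y := by
  have := N.add_le x (-y)
  rwa [N.nrm_neg, ← sub_eq_add_neg] at this

lemma sub_comm {X Y : A.Ob} (x y : A.Hom X Y) : N.nrm (x - y) = N.nrm (y - x) := by
  rw [← N.nrm_neg, neg_sub]

lemma sub_le_sub_add_sub {X Y : A.Ob} (x y z : A.Hom X Y) :
    N.nrm (x - z) ≤ N.nrm (x - y) + N.nrm (y - z) := by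
  have := N.add_le (x - y) (y - z)
  rwa [sub_add_sub_cancel] at this

lemma le_add_sub {X Y : A.Ob} (x y : A.Hom X Y) : N.nrm x ≤ N.nrm y + N.nrm (x - y) := by
  have := N.add_le y (x - y)
  rwa [add_sub_cancel] at this

lemma sum_le {X Y : A.Ob} {ι : Type*} (s : Finset ι) (x : ι → A.Hom X Y) :
    N.nrm (∑ i ∈ s, x i) ≤ ∑ i ∈ s, N.nrm (x i) :=
  Finset.le_sum_of_subadditive _ N.nrm_zero.le N.add_le _ _

lemma nrm_hcast {X X' Y Y' : A.Ob} (hX : X = X') (hY : Y = Y') (x : A.Hom X Y) :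
    N.nrm (A.hcast hX hY x) = N.nrm x := by
  subst hX hY; rfl

/-- The morphism sets as normed groups with the given topology. -/
abbrev normedAddCommGroup (X Y : A.Ob) : NormedAddCommGroup (A.Hom X Y) :=
  letI : Norm (A.Hom X Y) := ⟨N.nrm⟩
  have core : NormedSpace.Core 𝕜 (A.Hom X Y) :=
    { norm_nonneg := N.nonneg
      norm_smul := N.smul
      norm_triangle := N.add_le
      norm_eq_zero_iff := fun x => ⟨N.eq_zero x, fun h => h ▸ N.nrm_zero⟩ }
  NormedAddCommGroup.ofCoreReplaceTopology core (by
    refine TopologicalSpace.ext_nhds fun x => ?_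
    let := NormedAddCommGroup.ofCore core
    refine ((N.isBanachNorm X Y).nhds_basis x).eq_of_same_basis ?_
    convert Metric.nhds_basis_ball (x := x) using 2 with ε
    ext y
    rw [Metric.mem_ball, dist_eq_norm]
    rfl)

/-- A metric space is complete as soon as sequences with geometrically controlled increments
converge, and this is all that `IsBanachNorm` asks for. -/
lemma completeSpace (X Y : A.Ob) :
    letI := N.normedAddCommGroup X Y
    CompleteSpace (A.Hom X Y) := by
  let := N.normedAddCommGroup X Y
  refine Metric.complete_of_convergent_controlled_sequences (fun n => (1 / 2) ^ n)
    (fun n => by positivity) fun u hu => (N.isBanachNorm X Y).complete u fun n => ?_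
  have := (hu n (n + 1) n n.le_succ le_rfl).le
  rw [dist_eq_norm] at this
  exact this

lemma continuous_star {A : TStarCat.{u} 𝕜} (N : Bnorm A) {X Y : A.Ob} : Continuous
    (A.star : A.Hom X Y → A.Hom Y X) := by
  let := N.normedAddCommGroup X Y
  let := N.normedAddCommGroup Y X
  exact AddMonoidHomClass.continuous_of_bound A.starₐ 1 fun x => by
    rw [one_mul]; exact N.star_le x

lemma continuous_par {A : TStarCat.{u} 𝕜} (N : Bnorm A) {X Y : A.Ob} : Continuous
    (A.par : A.Hom X Y → A.Hom X Y) := by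
  let := N.normedAddCommGroup X Y
  exact AddMonoidHomClass.continuous_of_bound A.par 1 fun x => by
    rw [one_mul]; exact N.par_le x

end

section Unital
variable {A : UTStarCat.{u} 𝕜} (N : Bnorm A.toTStarCat)

/-- The Banach algebra of endomorphisms of an object. -/
abbrev endRing (X : A.Ob) : NormedRing (A.Hom X X) :=
  { N.normedAddCommGroup X X with
    mul := fun x y => A.comp x y
    left_distrib := A.comp_add
    right_distrib := A.add_comp
    zero_mul := A.zero_comp
    mul_zero := A.comp_zero
    mul_assoc := A.assoc
    one := A.one X
    one_mul := A.one_comp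
    mul_one := A.comp_one
    norm_mul_le := N.comp_le }

abbrev endAlgebra (X : A.Ob) :
    letI := N.endRing X
    NormedAlgebra 𝕜 (A.Hom X X) :=
  letI := N.endRing X
  { Algebra.ofModule (fun c x y => A.smul_comp c x y) (fun c x y => A.comp_smul c x y) with
    norm_smul_le := fun c x => (N.smul c x).le }

/-- The Newton step is an odd polynomial with real coefficients, so it preserves the closed set of
odd self-adjoint elements, and the iteration converges inside it. -/
lemma exists_SS_near {X : A.Ob} (z : A.Hom X X) (hp : A.par z = -z) (hs : A.star z = z)
    (h : N.nrm (A.one X - A.comp z z) ≤ 1 / 2) :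
    ∃ x : A.SS X, N.nrm (x.1 - z) ≤ 2 * N.nrm z * N.nrm (A.one X - A.comp z z) := by
  let := N.endRing X
  let := N.endAlgebra X
  have := N.completeSpace X X
  have hS : IsClosed {z : A.Hom X X | A.par z = -z ∧ A.star z = z} :=
    (isClosed_eq N.continuous_par continuous_neg).inter (isClosed_eq N.continuous_star
      continuous_id)
  have hstep : ∀ z ∈ {z : A.Hom X X | A.par z = -z ∧ A.star z = z},
      newtonStep 𝕜 z ∈ {z : A.Hom X X | A.par z = -z ∧ A.star z = z} := by
    rintro z ⟨hp, hs⟩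
    have e : newtonStep 𝕜 z = z + (2⁻¹ : 𝕜) • (z - A.comp z (A.comp z z)) := by
      change z + (2⁻¹ : 𝕜) • (z * (1 - z * z)) = _
      rw [mul_sub, mul_one]; rfl
    rw [Set.mem_ofPred_eq, e]
    constructor
    · simp only [map_add, map_smul, map_sub, A.par_comp, hp, A.neg_comp, A.comp_neg, neg_neg]
      module
    · simp only [A.star_add, A.star_smul, A.star_sub, A.star_comp, hs, A.assoc, map_inv₀, map_ofNat]
  obtain ⟨x, hx, hxx, hxz⟩ := exists_mul_self_eq_one_near (𝕜 := 𝕜) hS hstep ⟨hp, hs⟩ h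
  exact ⟨⟨x, hx.1, hx.2, hxx⟩, hxz⟩

/-- The parity operator is a unital ring endomorphism, which makes the Cayley path available with
`θ` equal to it. -/
lemma joined_of_near {X : A.Ob} (x y : A.SS X) (h : N.nrm (y.1 - x.1) * N.nrm x.1 < 1 / 2) :
    Joined x y := by
  let := N.endRing X
  let := N.endAlgebra X
  have := N.completeSpace X X
  let : StarRing (A.Hom X X) :=
    { star := fun x => A.star x
      star_involutive := A.star_star
      star_mul := A.star_comp
      star_add := A.star_add }
  have : StarModule 𝕜 (A.Hom X X) := ⟨A.star_smul⟩
  let θ : A.Hom X X →+* A.Hom X X :=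
    { toFun := A.par
      map_one' := A.parPow_one 1 X
      map_mul' := A.par_comp
      map_zero' := map_zero _
      map_add' := map_add _ }
  obtain ⟨γ, hγ, h0, h1, hγs⟩ := exists_path_mul_self_eq_one (𝕜 := 𝕜) θ
    (fun c a => map_smul A.par c a) x.2 y.2 h
  exact ⟨{ toFun := fun t => ⟨γ t, hγs t⟩
           continuous_toFun := hγ.subtype_mk _
           source' := Subtype.ext h0
           target' := Subtype.ext h1 }⟩

end Unital
end Bnorm

/-! ### Norms on C*-categories, Clifford tensor products, unitizations and additive completions. -/

lemma norm_sgn (a : ZMod 2) : ‖sgn 𝕜 a‖ = 1 := by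
  unfold sgn; split_ifs <;> simp

/-- A graded C*-functor from the parity operator. -/
noncomputable def GCStarCat.parFun (A : GCStarCat.{u} 𝕜) : GCStarFun A A where
  obj := id
  map := A.par
  map_comp := A.toTStarCat.par_comp
  map_star := A.toTStarCat.par_star
  map_mem_deg {X Y a x} hx := by
    rcases zmod_two_cases a with rfl | rfl
    · rwa [A.par_of_mem_zero hx]
    · rw [A.par_of_mem_one hx]; exact Submodule.neg_mem _ hx

/-- The grading comes without any continuity assumption; its parity operator is bounded because it
is a C*-functor and C*-functors are norm-decreasing. -/
lemma GCStarCat.norm_par_le (A : GCStarCat.{u} 𝕜) {X Y : A.Ob} (x : A.Hom X Y) :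
    ‖A.par x‖ ≤ ‖x‖ :=
  GCStarCat.norm_map_le A.parFun x

lemma GCStarCat.norm_star_le (A : GCStarCat.{u} 𝕜) {X Y : A.Ob} (x : A.Hom X Y) :
    ‖A.star x‖ ≤ ‖x‖ := by
  have h1 := A.norm_star_comp_self (A.star x)
  have h2 := A.norm_comp_le (A.star (A.star x)) (A.star x)
  rw [h1, A.star_star] at h2
  rcases (norm_nonneg (A.star x)).eq_or_lt with h | h
  · rw [← h]; exact norm_nonneg _
  · exact le_of_mul_le_mul_right (by linarith [sq ‖A.star x‖]) h

/-- The C*-norm. -/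
noncomputable def GCStarCat.bnorm (A : GCStarCat.{u} 𝕜) : Bnorm A.toTStarCat where
  nrm x := ‖x‖
  isBanachNorm _ _ := IsBanachNorm.of_norm
  comp_le := A.norm_comp_le
  star_le := A.norm_star_le
  par_le := A.norm_par_le

namespace Bnorm

section
variable {A : TStarCat.{u} 𝕜} (N : Bnorm A)

lemma nrm_sgn_smul (a : ZMod 2) {X Y : A.Ob} (x : A.Hom X Y) : N.nrm (sgn 𝕜 a • x) = N.nrm x := by
  rw [N.smul, norm_sgn, one_mul]

lemma nrm_parPow_le (a : ZMod 2) {X Y : A.Ob} (x : A.Hom X Y) :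
    N.nrm (A.parPow a x) ≤ N.nrm x := by
  unfold TStarCat.parPow
  split_ifs
  · exact le_rfl
  · exact N.par_le x

/-- The sum norm on the tensor product with a Clifford algebra. -/
noncomputable def cliff (p q : ℕ) : Bnorm (A.cliff p q) where
  nrm x := ∑ S, N.nrm (x S)
  isBanachNorm X Y := IsBanachNorm.pi fun _ => N.isBanachNorm X Y
  comp_le x y := by
    calc ∑ U, N.nrm (∑ S, sgn 𝕜 (cliffForm S (U - S)) •
          A.comp (x S) (A.parPow (cliffDeg S) (y (U - S))))
        ≤ ∑ U, ∑ S, N.nrm (x S) * N.nrm (y (U - S)) := by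
          refine Finset.sum_le_sum fun U _ => (N.sum_le _ _).trans (Finset.sum_le_sum fun S _ => ?_)
          rw [N.nrm_sgn_smul]
          exact (N.comp_le _ _).trans
            (mul_le_mul_of_nonneg_left (N.nrm_parPow_le _ _) (N.nonneg _))
      _ = (∑ S, N.nrm (x S)) * ∑ S, N.nrm (y S) := by
          rw [Finset.sum_comm, Finset.sum_mul]
          refine Finset.sum_congr rfl fun S _ => ?_
          rw [← Finset.mul_sum]
          exact congrArg _ ((Equiv.subRight S).sum_comp fun U => N.nrm (y U))
  star_le x := Finset.sum_le_sum fun S _ => by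
    rw [N.nrm_sgn_smul]
    exact (N.nrm_parPow_le _ _).trans (N.star_le _)
  par_le x := Finset.sum_le_sum fun S _ => by
    refine (N.nrm_sgn_smul _ _).trans_le (N.par_le _)

lemma nrm_lscal_le {X Y : A.Ob} (Z : A.Ob) (c : 𝕜) (y : A.Hom X Y) :
    N.nrm (A.lscal Z c y) ≤ ‖c‖ * N.nrm y := by
  by_cases h : Y = Z
  · subst h; rw [A.lscal_self, N.smul]
  · simp only [TStarCat.lscal, h, dite_false, N.nrm_zero]
    exact mul_nonneg (norm_nonneg _) (N.nonneg _)

lemma nrm_rscal_le {Y Z : A.Ob} (X : A.Ob) (c : 𝕜) (x : A.Hom Y Z) :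
    N.nrm (A.rscal X c x) ≤ ‖c‖ * N.nrm x := by
  by_cases h : Y = X
  · subst h; rw [A.rscal_self, N.smul]
  · simp only [TStarCat.rscal, h, dite_false, N.nrm_zero]
    exact mul_nonneg (norm_nonneg _) (N.nonneg _)

lemma isClosed_plusHom (A : TStarCat.{u} 𝕜) (X Y : A.Ob) : IsClosed (A.plusHom X Y : Set
    (A.Hom X Y × 𝕜)) := by
  by_cases h : X = Y
  · convert isClosed_univ
    exact Set.eq_univ_of_forall fun x hx => absurd h hx
  · have : (A.plusHom X Y : Set (A.Hom X Y × 𝕜)) = {x | x.2 = 0} :=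
      Set.ext fun x => ⟨fun hx => hx h, fun hx _ => hx⟩
    rw [this]
    exact isClosed_eq continuous_snd continuous_const

/-- The sum norm on the unitization. -/
noncomputable def plus : Bnorm A.plus.toTStarCat where
  nrm x := N.nrm x.1.1 + ‖x.1.2‖
  isBanachNorm X Y := ((N.isBanachNorm X Y).prod IsBanachNorm.of_norm).submodule (A.plusHom X Y)
    (isClosed_plusHom A X Y)
  comp_le {X Y Z} x y := by
    change N.nrm (A.comp x.1.1 y.1.1 + A.lscal Z x.1.2 y.1.1 + A.rscal X y.1.2 x.1.1) +
      ‖x.1.2 * y.1.2‖ ≤ (N.nrm x.1.1 + ‖x.1.2‖) * (N.nrm y.1.1 + ‖y.1.2‖)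
    have h1 := N.add_le (A.comp x.1.1 y.1.1 + A.lscal Z x.1.2 y.1.1) (A.rscal X y.1.2 x.1.1)
    have h2 := N.add_le (A.comp x.1.1 y.1.1) (A.lscal Z x.1.2 y.1.1)
    have h3 := N.comp_le x.1.1 y.1.1
    have h4 := N.nrm_lscal_le Z x.1.2 y.1.1
    have h5 := N.nrm_rscal_le X y.1.2 x.1.1
    rw [norm_mul]
    linarith
  star_le x := by
    change N.nrm (A.star x.1.1) + ‖starRingEnd 𝕜 x.1.2‖ ≤ N.nrm x.1.1 + ‖x.1.2‖
    rw [RCLike.norm_conj]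
    exact add_le_add_left (N.star_le _) _
  par_le x := add_le_add_left (N.par_le x.1.1) _

/-- The zero norm. -/
def zeroCat (A : TStarCat.{u} 𝕜) : Bnorm A.zeroCat where
  nrm _ := 0
  isBanachNorm _ _ :=
    { add_le := fun _ _ => (add_zero 0).ge
      smul := fun _ _ => (mul_zero _).symm
      eq_zero := fun _ _ => rfl
      nhds_basis := fun _ => ⟨fun _ => ⟨fun hs => ⟨1, one_pos, fun _ _ => mem_of_mem_nhds hs⟩,
        fun ⟨_, hε, h⟩ => mem_of_superset univ_mem fun _ _ => h hε⟩⟩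
      complete := fun _ _ => ⟨PUnit.unit, tendsto_const_nhds⟩ }
  comp_le _ _ := (mul_zero _).ge
  star_le _ := le_rfl
  par_le _ := le_rfl

end

/-- The sum norm on the additive completion. -/
noncomputable def addCompl {A : UTStarCat.{u} 𝕜} (N : Bnorm A.toTStarCat) :
    Bnorm A.addCompl.toTStarCat where
  nrm x := ∑ i, ∑ j, N.nrm (x i j)
  isBanachNorm X Y := IsBanachNorm.pi fun i => IsBanachNorm.pi fun j => N.isBanachNorm _ _
  comp_le {X Y Z} x y := by
    calc ∑ i, ∑ k, N.nrm (∑ j, A.comp (x i j) (y j k))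
        ≤ ∑ i, ∑ k, ∑ j, N.nrm (x i j) * N.nrm (y j k) :=
          Finset.sum_le_sum fun i _ => Finset.sum_le_sum fun k _ => (N.sum_le _ _).trans
            (Finset.sum_le_sum fun j _ => N.comp_le _ _)
      _ = ∑ i, ∑ j, N.nrm (x i j) * ∑ k, N.nrm (y j k) := by
          refine Finset.sum_congr rfl fun i _ => ?_
          rw [Finset.sum_comm]
          exact Finset.sum_congr rfl fun j _ => (Finset.mul_sum _ _ _).symm
      _ ≤ ∑ i, ∑ j, N.nrm (x i j) * ∑ j, ∑ k, N.nrm (y j k) :=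
          Finset.sum_le_sum fun i _ => Finset.sum_le_sum fun j _ =>
            mul_le_mul_of_nonneg_left (Finset.single_le_sum (f := fun j => ∑ k, N.nrm (y j k))
              (fun j _ => Finset.sum_nonneg fun k _ => N.nonneg _) (Finset.mem_univ j)) (N.nonneg _)
      _ = _ := by simp only [Finset.sum_mul]
  star_le x := by
    change ∑ i, ∑ j, N.nrm (A.star (x j i)) ≤ _
    rw [Finset.sum_comm]
    exact Finset.sum_le_sum fun i _ => Finset.sum_le_sum fun j _ => N.star_le _
  par_le x := Finset.sum_le_sum fun i _ => Finset.sum_le_sum fun j _ => N.par_le (x i j)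

lemma addCompl_nrm {A : UTStarCat.{u} 𝕜} (N : Bnorm A.toTStarCat) {X Y : A.addCompl.Ob}
    (x : A.addCompl.Hom X Y) : N.addCompl.nrm x = ∑ i, ∑ j, N.nrm (x i j) := rfl

end Bnorm

namespace TStarCat

variable {C : TStarCat.{u} 𝕜}

lemma hcast_cliff {p q : ℕ} {X X' Y Y' : C.Ob} (hX : X = X') (hY : Y = Y')
    (x : (C.cliff p q).Hom X Y) (S : CliffIdx p q) :
    (C.cliff p q).hcast hX hY x S = C.hcast hX hY (x S) := by
  subst hX hY; rfl

lemma hcast_plus {X X' Y Y' : C.Ob} (hX : X = X') (hY : Y = Y') (x : C.plus.Hom X Y) :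
    (C.plus.hcast hX hY x).1 = (C.hcast hX hY x.1.1, x.1.2) := by
  subst hX hY; rfl

lemma hcast_addCompl {C : UTStarCat.{u} 𝕜} {m n : ℕ} {a a' : Fin m → C.Ob} {b b' : Fin n → C.Ob}
    (ha : ∀ j, a j = a' j) (hb : ∀ i, b i = b' i)
    (hX : (⟨m, a⟩ : C.addCompl.Ob) = ⟨m, a'⟩) (hY : (⟨n, b⟩ : C.addCompl.Ob) = ⟨n, b'⟩)
    (x : C.addCompl.Hom ⟨m, a⟩ ⟨n, b⟩) (i : Fin n) (j : Fin m) :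
    C.addCompl.hcast hX hY x i j = C.hcast (ha j) (hb i) (x i j) := by
  obtain rfl := funext ha
  obtain rfl := funext hb
  rfl

end TStarCat

/-! ### Direct limits of Banach categories -/

/-- The functors `φ i : A i → C` exhibit `C` as a direct limit, in the sense of objects and of
morphisms with their norms, of the directed system `f`. -/
structure IsDirectLimit {J : Type*} [Preorder J] {A : J → TStarCat.{u} 𝕜}
    (f : ∀ i j, i ≤ j → TStarFun (A i) (A j)) {C : TStarCat.{u} 𝕜} (φ : ∀ i, TStarFun (A i) C)
    (N : ∀ i, Bnorm (A i)) (NC : Bnorm C) : Prop where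
  obj_surj : ∀ X : C.Ob, ∃ i Y, (φ i).obj Y = X
  obj_inj : ∀ i (X Y : (A i).Ob), (φ i).obj X = (φ i).obj Y →
    ∀ᶠ k in atTop, ∀ h : i ≤ k, (f i k h).obj X = (f i k h).obj Y
  nrm_map_le : ∀ i {X Y : (A i).Ob} (x : (A i).Hom X Y), NC.nrm ((φ i).map x) ≤ (N i).nrm x
  nrm_lt : ∀ i {X Y : (A i).Ob} (x : (A i).Hom X Y) (ε : ℝ), 0 < ε →
    ∀ᶠ k in atTop, ∀ h : i ≤ k, (N k).nrm ((f i k h).map x) < NC.nrm ((φ i).map x) + ε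
  dense : ∀ i {X Y : (A i).Ob} (y : C.Hom ((φ i).obj X) ((φ i).obj Y)) (ε : ℝ), 0 < ε →
    ∀ᶠ k in atTop, ∀ h : i ≤ k, ∃ (hX : (φ k).obj ((f i k h).obj X) = (φ i).obj X)
      (hY : (φ k).obj ((f i k h).obj Y) = (φ i).obj Y)
      (x : (A k).Hom ((f i k h).obj X) ((f i k h).obj Y)),
      NC.nrm (C.hcast hX hY ((φ k).map x) - y) < ε

namespace IsDirectLimit

variable {J : Type*} [Preorder J]

/-- This distributes a tolerance over finitely many coefficients; the `1` in the denominator allows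
an empty index type. -/
lemma sum_lt_of_forall_lt {ι : Type*} [Fintype ι] {a : ι → ℝ} {ε : ℝ} (hε : 0 < ε)
    (h : ∀ i, a i < ε / (Fintype.card ι + 1)) : ∑ i, a i < ε := by
  have hc : (0 : ℝ) < Fintype.card ι + 1 := by positivity
  calc ∑ i, a i ≤ ∑ i : ι, ε / (Fintype.card ι + 1) := Finset.sum_le_sum fun i _ => (h i).le
    _ = Fintype.card ι * ε / (Fintype.card ι + 1) := by simp [mul_div_assoc]
    _ < ε := by rw [div_lt_iff₀ hc]; linarith

section
variable {A : J → TStarCat.{u} 𝕜} {f : ∀ i j, i ≤ j → TStarFun (A i) (A j)} {C : TStarCat.{u} 𝕜}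
  {φ : ∀ i, TStarFun (A i) C} {N : ∀ i, Bnorm (A i)} {NC : Bnorm C} (H : IsDirectLimit f φ N NC)
include H

/-- Everything is checked on coefficients, which are finite in number, so that finitely many
eventual statements hold at once. -/
lemma cliff (p q : ℕ) : IsDirectLimit (fun i j h => (f i j h).cliff p q)
    (fun i => (φ i).cliff p q) (fun i => (N i).cliff p q) (NC.cliff p q) where
  obj_surj := H.obj_surj
  obj_inj := H.obj_inj
  nrm_map_le i _ _ x := Finset.sum_le_sum fun S _ => H.nrm_map_le i (x S)
  nrm_lt i X Y x ε hε := by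
    have h1 : ∀ᶠ k in atTop, ∀ S, ∀ h : i ≤ k, (N k).nrm ((f i k h).map (x S)) <
        NC.nrm ((φ i).map (x S)) + ε / (Fintype.card (CliffIdx p q) + 1) :=
      eventually_all.mpr fun S => H.nrm_lt i (x S) _ (by positivity)
    filter_upwards [h1] with k hk h
    have h2 := sum_lt_of_forall_lt hε fun S : CliffIdx p q => sub_lt_iff_lt_add'.mpr (hk S h)
    rw [Finset.sum_sub_distrib] at h2
    exact sub_lt_iff_lt_add'.mp h2
  dense i X Y y ε hε := by
    have h1 := eventually_all.mpr fun S : CliffIdx p q => H.dense i (y S)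
      (ε / (Fintype.card (CliffIdx p q) + 1)) (by positivity)
    filter_upwards [h1] with k hk h
    have hk' := fun S => hk S h
    choose hX hY x hx using hk'
    -- The equalities of objects do not depend on the coefficient; the index `0` is an arbitrary
    -- choice.
    refine ⟨hX 0, hY 0, x, sum_lt_of_forall_lt hε fun S => ?_⟩
    rw [Pi.sub_apply, TStarCat.hcast_cliff]
    exact hx S

lemma plus : IsDirectLimit (A := fun i => (A i).plus.toTStarCat)
    (fun i j h => ((f i j h).plus).toTStarFun) (C := C.plus.toTStarCat)
    (fun i => ((φ i).plus).toTStarFun) (fun i => (N i).plus) NC.plus where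
  obj_surj := H.obj_surj
  obj_inj := H.obj_inj
  nrm_map_le i _ _ x := add_le_add_left (H.nrm_map_le i x.1.1) _
  nrm_lt i X Y x ε hε := by
    filter_upwards [H.nrm_lt i x.1.1 ε hε] with k hk h
    change (N k).nrm ((f i k h).map x.1.1) + ‖x.1.2‖ < NC.nrm ((φ i).map x.1.1) + ‖x.1.2‖ + ε
    linarith [hk h]
  dense i X Y y ε hε := by
    -- A non-zero scalar part is allowed only on endomorphisms. If the two objects coincide in the
    -- limit, they must already coincide at stage `k` for the scalar of `y` to be lifted unchanged.
    have h1 : ∀ᶠ k in atTop, ∀ h : i ≤ k, (f i k h).obj X ≠ (f i k h).obj Y → y.1.2 = 0 := by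
      by_cases hXY : (φ i).obj X = (φ i).obj Y
      · filter_upwards [H.obj_inj i X Y hXY] with k hk h hne using absurd (hk h) hne
      · exact Eventually.of_forall fun k h _ => y.2 hXY
    filter_upwards [h1, H.dense i y.1.1 ε hε] with k hk1 hk2 h
    obtain ⟨hX, hY, x, hx⟩ := hk2 h
    refine ⟨hX, hY, ⟨(x, y.1.2), hk1 h⟩, ?_⟩
    change NC.nrm (C.plus.hcast hX hY _ - y).1.1 + ‖(C.plus.hcast hX hY _ - y).1.2‖ < ε
    rw [Submodule.coe_sub, Prod.fst_sub, Prod.snd_sub, TStarCat.hcast_plus]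
    change NC.nrm (C.hcast hX hY ((φ k).map x) - y.1.1) + ‖y.1.2 - y.1.2‖ < ε
    rwa [sub_self, norm_zero, add_zero]

/-- Compatibility of the functors is not a field of `IsDirectLimit`. On objects it is recovered from
the equalities that come with density, applied to the zero morphism. -/
lemma eventually_obj_eq (i : J) (X : (A i).Ob) :
    ∀ᶠ k in atTop, ∀ h : i ≤ k, (φ k).obj ((f i k h).obj X) = (φ i).obj X := by
  filter_upwards [H.dense i (0 : C.Hom ((φ i).obj X) ((φ i).obj X)) 1 one_pos] with k hk h
  exact (hk h).1

lemma zeroCat : IsDirectLimit (fun i j h => zeroFunctor.map (X := A i) (Y := A j) (f i j h))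
    (C := zeroFunctor.obj C) (fun i => zeroFunctor.map (X := A i) (Y := C) (φ i))
    (fun i => Bnorm.zeroCat (A i)) (Bnorm.zeroCat C) where
  obj_surj := H.obj_surj
  obj_inj := H.obj_inj
  nrm_map_le _ _ _ _ := le_rfl
  nrm_lt _ _ _ _ ε hε := Eventually.of_forall fun _ _ => hε.trans_eq (zero_add ε).symm
  dense i X Y y ε hε := by
    filter_upwards [H.eventually_obj_eq i X, H.eventually_obj_eq i Y] with k hX hY h
    exact ⟨hX h, hY h, PUnit.unit, hε⟩

end

/-- A formal sum has finitely many summands and a matrix finitely many entries, so directedness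
brings them to a common stage, with the tolerance divided over rows and then over columns. -/
lemma addCompl [IsDirectedOrder J] [Nonempty J] {A : J → UTStarCat.{u} 𝕜}
    {f : ∀ i j, i ≤ j → UTStarFun (A i) (A j)} {C : UTStarCat.{u} 𝕜} {φ : ∀ i, UTStarFun (A i) C}
    {N : ∀ i, Bnorm (A i).toTStarCat} {NC : Bnorm C.toTStarCat}
    (H : IsDirectLimit (fun i j h => (f i j h).toTStarFun) (fun i => (φ i).toTStarFun) N NC) :
    IsDirectLimit (fun i j h => (f i j h).addCompl.toTStarFun)
      (fun i => (φ i).addCompl.toTStarFun) (fun i => (N i).addCompl) NC.addCompl where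
  obj_surj := by
    rintro ⟨n, a⟩
    choose i Y hY using fun j => H.obj_surj (a j)
    obtain ⟨k, hk1, hk2⟩ := ((eventually_all.mpr fun j => H.eventually_obj_eq (i j) (Y j)).and
      (eventually_all.mpr fun j => eventually_ge_atTop (i j))).exists
    exact ⟨k, ⟨n, fun j => (f (i j) k (hk2 j)).obj (Y j)⟩,
      congrArg (Sigma.mk n) (funext fun j => (hk1 j (hk2 j)).trans (hY j))⟩
  obj_inj i := by
    rintro ⟨n, a⟩ ⟨m, b⟩ h
    obtain ⟨rfl, h⟩ := Sigma.mk.inj_iff.mp h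
    filter_upwards [eventually_all.mpr fun j => H.obj_inj i (a j) (b j) (congrFun (eq_of_heq h) j)]
      with k hk h
    exact congrArg (Sigma.mk n) (funext fun j => hk j h)
  nrm_map_le i _ _ x := by
    rw [Bnorm.addCompl_nrm, Bnorm.addCompl_nrm]
    exact Finset.sum_le_sum fun s _ => Finset.sum_le_sum fun t _ => H.nrm_map_le i (x s t)
  nrm_lt i X Y x ε hε := by
    have h1 : ∀ᶠ k in atTop, ∀ (b : Fin Y.1) (a : Fin X.1), ∀ h : i ≤ k,
        (N k).nrm ((f i k h).map (x b a)) < NC.nrm ((φ i).map (x b a)) +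
          (ε / (Fintype.card (Fin Y.1) + 1)) / (Fintype.card (Fin X.1) + 1) :=
      eventually_all.mpr fun b => eventually_all.mpr fun a => H.nrm_lt i (x b a) _ (by positivity)
    filter_upwards [h1] with k hk h
    have h2 := sum_lt_of_forall_lt hε fun b => sum_lt_of_forall_lt (by positivity) fun a =>
      sub_lt_iff_lt_add'.mpr (hk b a h)
    simp only [Finset.sum_sub_distrib] at h2
    exact sub_lt_iff_lt_add'.mp h2
  dense i := by
    rintro ⟨m, a⟩ ⟨n, b⟩ y ε hε
    have h1 := eventually_all.mpr fun s => eventually_all.mpr fun t => H.dense i (y s t)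
      ((ε / (Fintype.card (Fin n) + 1)) / (Fintype.card (Fin m) + 1)) (by positivity)
    -- The equalities of objects are taken separately, since a matrix with no rows or no columns has
    -- no entry to supply them.
    filter_upwards [h1, eventually_all.mpr fun s => H.eventually_obj_eq i (a s),
      eventually_all.mpr fun s => H.eventually_obj_eq i (b s)] with k hk ha hb h
    have hk' := fun s t => hk s t h
    choose hX hY x hx using hk'
    refine ⟨congrArg (Sigma.mk m) (funext fun s => ha s h),
      congrArg (Sigma.mk n) (funext fun s => hb s h), x, ?_⟩
    rw [Bnorm.addCompl_nrm]
    refine sum_lt_of_forall_lt hε fun s => sum_lt_of_forall_lt (by positivity) fun t => ?_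
    rw [Pi.sub_apply, Pi.sub_apply, TStarCat.hcast_addCompl (fun s => ha s h) (fun s => hb s h)]
    exact hx s t

end IsDirectLimit

/-! ### Lifting supersymmetries -/

namespace IsDirectLimit

variable {J : Type*} [Preorder J] {A : J → UTStarCat.{u} 𝕜}
  {f : ∀ i j, i ≤ j → UTStarFun (A i) (A j)} {C : UTStarCat.{u} 𝕜} {φ : ∀ i, UTStarFun (A i) C}
  {N : ∀ i, Bnorm (A i).toTStarCat} {NC : Bnorm C.toTStarCat}
  (H : IsDirectLimit (fun i j h => (f i j h).toTStarFun) (fun i => (φ i).toTStarFun) N NC)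
  (hw : ∀ i j h {X Y : (A i).Ob} (x : (A i).Hom X Y),
    ∃ hX hY, C.hcast hX hY ((φ j).map ((f i j h).map x)) = (φ i).map x)
include H

/-- Self-adjoint odd morphisms in the limit are approximated by self-adjoint odd morphisms. -/
lemma exists_odd_near (i : J) {X : (A i).Ob} (u : C.SS ((φ i).obj X)) {ε : ℝ} (hε : 0 < ε) :
    ∀ᶠ k in atTop, ∀ h : i ≤ k, ∃ (hX : (φ k).obj ((f i k h).obj X) = (φ i).obj X)
      (z : (A k).Hom ((f i k h).obj X) ((f i k h).obj X)),
      (A k).par z = -z ∧ (A k).star z = z ∧ NC.nrm (C.hcast hX hX ((φ k).map z) - u.1) < ε := by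
  filter_upwards [H.dense i u.1 ε hε] with k hk h
  obtain ⟨hX, _, z, hz⟩ := hk h
  -- The witness is the odd self-adjoint part of `z`. This projection commutes with the functors,
  -- fixes `u` and is norm-decreasing, being a mean of four norm-decreasing terms, so the distance
  -- to `u` does not grow.
  refine ⟨hX, (4⁻¹ : 𝕜) • (z - (A k).par z + ((A k).star z - (A k).par ((A k).star z))), ?_, ?_, ?_⟩
  · simp only [map_smul, map_add, map_sub, (A k).par_par]
    module
  · simp only [(A k).star_smul, (A k).star_add, (A k).star_sub, (A k).par_star, (A k).star_star,
      map_inv₀, map_ofNat]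
    module
  · set w := C.hcast hX hX ((φ k).map z) with hw
    have e : C.hcast hX hX ((φ k).map ((4⁻¹ : 𝕜) • (z - (A k).par z +
        ((A k).star z - (A k).par ((A k).star z))))) - u.1 =
        (4⁻¹ : 𝕜) • (((w - u.1) - C.par (w - u.1)) + (C.star (w - u.1) -
          C.par (C.star (w - u.1)))) := by
      simp only [map_smul, map_add, map_sub, (φ k).map_par, (φ k).map_star, C.hcast_star,
        C.hcast_par,
        ← hw, C.star_sub, u.2.1, u.2.2.1]
      module
    rw [e, NC.smul]
    generalize w - u.1 = v at *
    have h1 := NC.add_le (v - C.par v) (C.star v - C.par (C.star v))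
    have h2 := NC.sub_le v (C.par v)
    have h3 := NC.sub_le (C.star v) (C.par (C.star v))
    have h4 := NC.par_le v
    have h5 := NC.par_le (C.star v)
    have h6 := NC.star_le v
    rw [norm_inv, RCLike.norm_ofNat]
    linarith

include hw in
-- If the image of `z` is close to `u`, then `z²` is close to `1` in the limit, hence also at all
-- late stages, where the Newton iteration applies. The bound `δ` depends on `u` and `ε` only, so it
-- can be fixed before the stage and `z` are chosen.
lemma eventually_exists_SS_near {X : C.Ob} (u : C.SS X) {ε : ℝ} (hε : 0 < ε) :
    ∃ δ > 0, ∀ (j : J) (Y : (A j).Ob) (hY : (φ j).obj Y = X) (z : (A j).Hom Y Y),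
      (A j).par z = -z → (A j).star z = z → NC.nrm (C.hcast hY hY ((φ j).map z) - u.1) < δ →
      ∀ᶠ k in atTop, ∀ h : j ≤ k, ∃ (hX : (φ k).obj ((f j k h).obj Y) = X)
        (x : (A k).SS ((f j k h).obj Y)), NC.nrm (C.hcast hX hX ((φ k).map x.1) - u.1) < ε := by
  set M := NC.nrm u.1
  have hM : 0 ≤ M := NC.nonneg _
  have hD : 0 < 8 * (M + 2) ^ 2 := by positivity
  have hδ0 : 0 < min ε 1 / (8 * (M + 2) ^ 2) := div_pos (lt_min hε one_pos) hD
  -- In the limit the error of `z` is at most `δ(2M + 1)`. At a late stage the error is at most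
  -- `δ(2M + 2) ≤ 1/2` and the norm of `z` at most `M + 2`, so Newton moves `z` by at most `4δ(M +
  -- 2)(M + 1)`. Together with the initial `δ` this is below `8δ(M + 2)² ≤ ε`.
  obtain ⟨δ, hδ⟩ : ∃ δ, δ = min ε 1 / (8 * (M + 2) ^ 2) := ⟨_, rfl⟩
  rw [← hδ] at hδ0
  have hδm : δ * (8 * (M + 2) ^ 2) = min ε 1 := by rw [hδ, div_mul_cancel₀ _ hD.ne']
  have hδε : δ * (8 * (M + 2) ^ 2) ≤ ε := hδm.trans_le (min_le_left _ _)
  have hδ1 : δ * (8 * (M + 2) ^ 2) ≤ 1 := hδm.trans_le (min_le_right _ _)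
  have hδM : 0 ≤ δ * M := by positivity
  have hδM2 : 0 ≤ δ * M ^ 2 := by positivity
  refine ⟨δ, hδ0, fun j Y hY z hp hs hz => ?_⟩
  subst hY
  rw [C.hcast_rfl] at hz
  have h1 : NC.nrm ((φ j).map ((A j).one Y - (A j).comp z z)) ≤ δ * (2 * M + 1) := by
    have e : (φ j).map ((A j).one Y - (A j).comp z z) =
        C.comp u.1 (u.1 - (φ j).map z) + C.comp (u.1 - (φ j).map z) ((φ j).map z) := by
      have hu : C.comp u.1 u.1 = C.one _ := u.2.2.2
      rw [map_sub, (φ j).map_one, (φ j).map_comp, C.comp_sub, C.sub_comp, hu]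
      abel
    have h2 := NC.add_le (C.comp u.1 (u.1 - (φ j).map z))
      (C.comp (u.1 - (φ j).map z) ((φ j).map z))
    have h3 := NC.comp_le u.1 (u.1 - (φ j).map z)
    have h4 := NC.comp_le (u.1 - (φ j).map z) ((φ j).map z)
    have h5 := NC.le_add_sub ((φ j).map z) u.1
    rw [NC.sub_comm] at h3 h4
    have h6 : NC.nrm u.1 * NC.nrm ((φ j).map z - u.1) ≤ M * δ := by gcongr
    have h7 : NC.nrm ((φ j).map z - u.1) * NC.nrm ((φ j).map z) ≤ δ * (M + δ) := by
      refine mul_le_mul hz.le (h5.trans ?_) (NC.nonneg _) hδ0.le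
      gcongr
    have h8 : δ ≤ 1 := by nlinarith
    rw [e]
    nlinarith
  have h2 := NC.le_add_sub ((φ j).map z) u.1
  filter_upwards [H.nrm_lt j ((A j).one Y - (A j).comp z z) δ hδ0, H.nrm_lt j z 1 one_pos]
    with k hk1 hk2 h
  have hk1 := hk1 h
  have hk2 := hk2 h
  obtain ⟨hX, _, e⟩ := hw j k h z
  rw [map_sub, (f j k h).map_one, (f j k h).map_comp] at hk1
  obtain ⟨x, hx⟩ := (N k).exists_SS_near ((f j k h).map z)
    (by rw [← (f j k h).map_par, hp, map_neg]) (by rw [← (f j k h).map_star, hs]) (by nlinarith)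
  refine ⟨hX, x, ?_⟩
  have h3 := NC.sub_le_sub_add_sub (C.hcast hX hX ((φ k).map x.1))
    (C.hcast hX hX ((φ k).map ((f j k h).map z))) u.1
  have h4 := H.nrm_map_le k (x.1 - (f j k h).map z)
  rw [map_sub] at h4
  rw [← map_sub, NC.nrm_hcast, e] at h3
  have h5 : 2 * (N k).nrm ((f j k h).map z) * (N k).nrm ((A k).one ((f j k h).obj Y) -
      (A k).comp ((f j k h).map z) ((f j k h).map z)) ≤ 2 * (M + 2) * (δ * (2 * M + 2)) := by
    refine mul_le_mul ?_ ?_ ((N k).nonneg _) (by positivity)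
    · nlinarith
    · nlinarith
  nlinarith

/-- Supersymmetries that become close in the limit are eventually in the same path component. -/
lemma eventually_joined (i : J) {X : (A i).Ob} (x y : (A i).SS X)
    (h : (NC.nrm ((φ i).map y.1 - (φ i).map x.1)) * (NC.nrm ((φ i).map x.1)) < 1 / 2) :
    ∀ᶠ k in atTop, ∀ h : i ≤ k, Joined ((f i k h).mapSS x) ((f i k h).mapSS y) := by
  -- The strict inequality leaves room for an `ε`, which absorbs the excess of the norms at late
  -- stages over those in the limit.
  obtain ⟨ε, hε, h⟩ : ∃ ε > 0, (NC.nrm ((φ i).map y.1 - (φ i).map x.1) + ε) *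
      (NC.nrm ((φ i).map x.1) + ε) < 1 / 2 := by
    have hc : Tendsto (fun ε : ℝ => (NC.nrm ((φ i).map y.1 - (φ i).map x.1) + ε) *
        (NC.nrm ((φ i).map x.1) + ε)) (𝓝[>] 0)
        (𝓝 ((NC.nrm ((φ i).map y.1 - (φ i).map x.1) + 0) * (NC.nrm ((φ i).map x.1) + 0))) :=
      tendsto_nhdsWithin_of_tendsto_nhds (by fun_prop : Continuous _).continuousAt
    rw [add_zero, add_zero] at hc
    obtain ⟨ε, h1, h2⟩ := ((hc.eventually (Iio_mem_nhds h)).and self_mem_nhdsWithin).exists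
    exact ⟨ε, h2, h1⟩
  filter_upwards [H.nrm_lt i (y.1 - x.1) ε hε, H.nrm_lt i x.1 ε hε] with k h1 h2 hk
  refine (N k).joined_of_near _ _ (lt_of_le_of_lt ?_ h)
  have h1 := h1 hk
  rw [map_sub, map_sub] at h1
  exact mul_le_mul h1.le (h2 hk).le ((N k).nonneg _) ((add_pos_of_nonneg_of_pos
    (NC.nonneg _) hε).le)

variable [IsDirectedOrder J] [Nonempty J]

include hw in
/-- Supersymmetries in the limit are approximated by supersymmetries. -/
lemma exists_SS_near {X : C.Ob} (u v : C.SS X) {ε : ℝ} (hε : 0 < ε) :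
    ∃ (k : J) (Y : (A k).Ob) (hY : (φ k).obj Y = X) (x y : (A k).SS Y),
      NC.nrm (C.hcast hY hY ((φ k).map x.1) - u.1) < ε ∧
      NC.nrm (C.hcast hY hY ((φ k).map y.1) - v.1) < ε := by
  obtain ⟨δ, hδ, hu⟩ := H.eventually_exists_SS_near hw u hε
  obtain ⟨δ', hδ', hv⟩ := H.eventually_exists_SS_near hw v hε
  obtain ⟨i, Y, rfl⟩ := H.obj_surj X
  -- Two moves along the system are needed: to `j` for odd self-adjoint approximations, then to `k`
  -- where these are corrected to supersymmetries. Both `u` and `v` are treated at the same stage,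
  -- over the same object.
  obtain ⟨j, hj, hij⟩ := (((H.exists_odd_near i u hδ).and (H.exists_odd_near i v hδ')).and
    (eventually_ge_atTop i)).exists
  obtain ⟨hX, z, hzp, hzs, hz⟩ := hj.1 hij
  obtain ⟨_, z', hzp', hzs', hz'⟩ := hj.2 hij
  obtain ⟨k, hk, hjk⟩ := (((hu j _ hX z hzp hzs hz).and (hv j _ hX z' hzp' hzs' hz')).and
    (eventually_ge_atTop j)).exists
  obtain ⟨hX', x, hx⟩ := hk.1 hjk
  obtain ⟨_, y, hy⟩ := hk.2 hjk
  exact ⟨k, _, hX', x, y, hx, hy⟩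

end IsDirectLimit

/-! ### Continuity of `V₁` -/

lemma UTStarCat.V1.mk_eq_of_joined {A : UTStarCat.{u} 𝕜} {X : A.addCompl.Ob}
    {x y : A.addCompl.SS X} (h : Joined x y) :
    UTStarCat.V1.mk A ⟨X, x⟩ = UTStarCat.V1.mk A ⟨X, y⟩ :=
  (AddCon.eq _).mpr (AddConGen.Rel.of _ _ (UTStarCat.V1Rel.path x y h))

lemma UTStarFun.mapV1_mk {A B : UTStarCat.{u} 𝕜} (f : UTStarFun A B) (s : A.Super) :
    f.mapV1 (UTStarCat.V1.mk A s) = UTStarCat.V1.mk B (f.mapSuper s) := rfl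

namespace Bnorm

variable {A : UTStarCat.{u} 𝕜} (N : Bnorm A.toTStarCat)

/-- Two supersymmetries of the same object at distance less than `ε`. -/
def Near (ε : ℝ) (s t : A.Super) : Prop :=
  ∃ x : A.addCompl.SS t.ob, s = ⟨t.ob, x⟩ ∧ N.addCompl.nrm (x.1 - t.ss.1) < ε

lemma Near.refl {ε : ℝ} (hε : 0 < ε) (s : A.Super) : N.Near ε s s :=
  ⟨s.ss, rfl, by rwa [sub_self, nrm_zero]⟩

variable {N}

lemma Near.mono {ε δ : ℝ} (h : ε ≤ δ) {s t : A.Super} : N.Near ε s t → N.Near δ s t :=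
  fun ⟨x, h1, h2⟩ => ⟨x, h1, h2.trans_le h⟩

/-- The off-diagonal blocks cancel, so the sum norm is exactly additive on block sums; this is what
makes `Near` additive. -/
lemma sum_sum_blockDiag {ι κ : Type} [Fintype ι] [Fintype κ] {a : ι → A.Ob} {b : κ → A.Ob}
    (x x' : ∀ i j, A.Hom (a j) (a i)) (y y' : ∀ i j, A.Hom (b j) (b i)) :
    ∑ s, ∑ t, N.nrm (UTStarCat.blockDiag x y s t - UTStarCat.blockDiag x' y' s t) =
      ∑ i, ∑ j, N.nrm (x i j - x' i j) + ∑ i, ∑ j, N.nrm (y i j - y' i j) := by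
  simp only [Fintype.sum_sum_type]
  have h1 : ∀ i j, N.nrm (UTStarCat.blockDiag x y (.inl i) (.inr j) -
      UTStarCat.blockDiag x' y' (.inl i) (.inr j)) = 0 := fun i j => by
    rw [UTStarCat.blockDiag, UTStarCat.blockDiag, sub_self, nrm_zero]
  have h2 : ∀ i j, N.nrm (UTStarCat.blockDiag x y (.inr i) (.inl j) -
      UTStarCat.blockDiag x' y' (.inr i) (.inl j)) = 0 := fun i j => by
    rw [UTStarCat.blockDiag, UTStarCat.blockDiag, sub_self, nrm_zero]
  simp only [h1, h2, Finset.sum_const_zero, add_zero, zero_add]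
  rfl

lemma Near.add {ε δ : ℝ} {s t s' t' : A.Super} (h : N.Near ε s t) (h' : N.Near δ s' t') :
    N.Near (ε + δ) (s + s') (t + t') := by
  obtain ⟨x, rfl, hx⟩ := h
  obtain ⟨x', rfl, hx'⟩ := h'
  refine ⟨x.oplus x', rfl, lt_of_eq_of_lt ?_ (add_lt_add hx hx')⟩
  rw [addCompl_nrm, addCompl_nrm, addCompl_nrm]
  refine Eq.trans ?_ (sum_sum_blockDiag (N := N) x.1 t.ss.1 x'.1 t'.ss.1)
  rw [← Equiv.sum_comp finSumFinEquiv.symm]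
  refine Finset.sum_congr rfl fun i _ => ?_
  rw [← Equiv.sum_comp finSumFinEquiv.symm]
  rfl

end Bnorm

namespace IsDirectLimit

open UTStarCat

variable {J : Type*} [Preorder J] [IsDirectedOrder J] [Nonempty J] {A : J → UTStarCat.{u} 𝕜}
  {f : ∀ i j, i ≤ j → UTStarFun (A i) (A j)} {C : UTStarCat.{u} 𝕜} {φ : ∀ i, UTStarFun (A i) C}
  {N : ∀ i, Bnorm (A i).toTStarCat} {NC : Bnorm C.toTStarCat}
  (H : IsDirectLimit (fun i j h => (f i j h).toTStarFun) (fun i => (φ i).toTStarFun) N NC)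
  (hf : ∀ i j k hij hjk,
    CategoryStruct.comp (obj := UTStarCat.{u} 𝕜) (f i j hij) (f j k hjk) = f i k (hij.trans hjk))
  (hφ : ∀ i j hij, CategoryStruct.comp (obj := UTStarCat.{u} 𝕜) (f i j hij) (φ j) = φ i)

lemma _root_.GradedCStar.UTStarFun.mapSuper_comp {A B C : UTStarCat.{u} 𝕜} (f : UTStarFun A B)
    (g : UTStarFun B C)
    (s : A.Super) : g.mapSuper (f.mapSuper s) =
      UTStarFun.mapSuper (CategoryStruct.comp (obj := UTStarCat.{u} 𝕜) f g) s := rfl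

/-- Equal functors have values in morphism sets that are equal only propositionally; this supplies
the compatibility `hw` in its transported form. -/
lemma _root_.GradedCStar.UTStarFun.addCompl_hcast_map {A B : UTStarCat.{u} 𝕜}
    {f g : UTStarFun A B} (h : f = g)
    {X Y : A.addCompl.Ob} (x : A.addCompl.Hom X Y) :
    ∃ hX hY, B.addCompl.hcast hX hY (f.addCompl.map x) = g.addCompl.map x := by
  subst h; exact ⟨rfl, rfl, rfl⟩

include H hφ in
/-- Pairs of supersymmetries of the same object can be lifted approximately. -/
lemma exists_near {X : C.addCompl.Ob} (u v : C.addCompl.SS X) {ε : ℝ} (hε : 0 < ε) :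
    ∃ (k : J) (Y : (A k).addCompl.Ob) (x y : (A k).addCompl.SS Y),
      (φ k).addCompl.obj Y = X ∧
      NC.Near ε ((φ k).mapSuper ⟨Y, x⟩) ⟨X, u⟩ ∧ NC.Near ε ((φ k).mapSuper ⟨Y, y⟩) ⟨X, v⟩ := by
  obtain ⟨k, Y, rfl, x, y, hx, hy⟩ := H.addCompl.exists_SS_near (fun i j h X Y x =>
    UTStarFun.addCompl_hcast_map (hφ i j h) x) u v hε
  exact ⟨k, Y, x, y, rfl, ⟨_, rfl, hx⟩, ⟨_, rfl, hy⟩⟩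

lemma exists_eq_mk_of_ob_eq {A : UTStarCat.{u} 𝕜} (s : A.Super) {Y : A.addCompl.Ob}
    (h : s.ob = Y) : ∃ x, s = ⟨Y, x⟩ := by
  subst h; exact ⟨s.ss, rfl⟩

include H hφ hf in
/-- Approximate lifts of close supersymmetries eventually have the same class. -/
lemma exists_V1_mk_eq (u : C.Super) : ∃ η > 0, ∀ v : C.addCompl.SS u.ob,
    NC.addCompl.nrm (v.1 - u.ss.1) < η → ∀ (i j : J) (s : (A i).Super) (t : (A j).Super),
      NC.Near η ((φ i).mapSuper s) u → NC.Near η ((φ j).mapSuper t) ⟨u.ob, v⟩ →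
      ∃ k hi hj, V1.mk (A k) ((f i k hi).mapSuper s) = V1.mk (A k) ((f j k hj).mapSuper t) := by
  obtain ⟨X, u⟩ := u
  set M := NC.addCompl.nrm u.1
  have hM : 0 ≤ M := NC.addCompl.nonneg _
  -- The lifted supersymmetries are at distance below `3η` in the limit and one of them has norm
  -- below `M + η`. As `η ≤ 1` and `η(M + 1) = 1/8`, the product is at most `3/8`, below the bound
  -- `1/2` needed for a path.
  refine ⟨1 / (8 * (M + 1)), by positivity, fun v huv i j s t hs ht => ?_⟩
  obtain ⟨η, hη⟩ : ∃ η, η = 1 / (8 * (M + 1)) := ⟨_, rfl⟩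
  have hη0 : 0 < η := by rw [hη]; positivity
  have hηM : η * (8 * (M + 1)) = 1 := by rw [hη]; field_simp
  rw [← hη] at huv hs ht
  obtain ⟨u', hsu, hu'⟩ := hs
  obtain ⟨v', htv, hv'⟩ := ht
  dsimp only at u' v' hsu htv hu' hv'
  obtain ⟨k, hik, hjk⟩ := exists_ge_ge i j
  have hs' : (φ k).mapSuper ((f i k hik).mapSuper s) = ⟨X, u'⟩ := by
    rw [UTStarFun.mapSuper_comp, hφ, hsu]
  have ht' : (φ k).mapSuper ((f j k hjk).mapSuper t) = ⟨X, v'⟩ := by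
    rw [UTStarFun.mapSuper_comp, hφ, htv]
  -- The two lifts are known to live on the same object only in the limit. Stage `l` makes their
  -- objects equal, and a later stage `m` provides the path.
  obtain ⟨l, hl, hkl⟩ := ((H.addCompl.obj_inj k ((f i k hik).mapSuper s).ob
    ((f j k hjk).mapSuper t).ob ((congrArg Super.ob hs').trans (congrArg Super.ob ht').symm)).and
      (eventually_ge_atTop k)).exists
  have hl := hl hkl
  obtain ⟨Y, x, y, hx, hy⟩ : ∃ Y x y, (f i l (hik.trans hkl)).mapSuper s = ⟨Y, x⟩ ∧
      (f j l (hjk.trans hkl)).mapSuper t = ⟨Y, y⟩ := by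
    obtain ⟨x, hx⟩ := exists_eq_mk_of_ob_eq ((f i l (hik.trans hkl)).mapSuper s)
      (Y := ((f j l (hjk.trans hkl)).mapSuper t).ob) (by
        rw [← hf i k l hik hkl, ← hf j k l hjk hkl]; exact hl)
    exact ⟨_, x, _, hx, rfl⟩
  have hs'' : (φ l).mapSuper ((f i l (hik.trans hkl)).mapSuper s) = ⟨X, u'⟩ := by
    rw [UTStarFun.mapSuper_comp, hφ, hsu]
  have ht'' : (φ l).mapSuper ((f j l (hjk.trans hkl)).mapSuper t) = ⟨X, v'⟩ := by
    rw [UTStarFun.mapSuper_comp, hφ, htv]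
  rw [hx] at hs''
  rw [hy] at ht''
  obtain ⟨rfl, hu⟩ := Super.mk.inj hs''
  have hu := eq_of_heq hu
  have hv := eq_of_heq (Super.mk.inj ht'').2
  obtain ⟨m, hm, hlm⟩ := ((H.addCompl.eventually_joined l x y (by
    change NC.addCompl.nrm (((φ l).addCompl.mapSS y).1 - ((φ l).addCompl.mapSS x).1) *
      NC.addCompl.nrm ((φ l).addCompl.mapSS x).1 < 1 / 2
    rw [hu, hv]
    have h1 := NC.addCompl.sub_le_sub_add_sub v'.1 v.1 u.1
    have h2 := NC.addCompl.sub_le_sub_add_sub v'.1 u.1 u'.1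
    rw [NC.addCompl.sub_comm u.1] at h2
    have h3 := NC.addCompl.le_add_sub u'.1 u.1
    have h4 : NC.addCompl.nrm (v'.1 - u'.1) * NC.addCompl.nrm u'.1 ≤ (3 * η) * (M + η) :=
      mul_le_mul (by linarith) (by linarith) (NC.addCompl.nonneg _) (by positivity)
    have h5 : η ≤ 1 / 8 := by nlinarith
    nlinarith)).and (eventually_ge_atTop l)).exists
  refine ⟨m, (hik.trans hkl).trans hlm, (hjk.trans hkl).trans hlm, ?_⟩
  rw [← hf i l m (hik.trans hkl) hlm, ← hf j l m (hjk.trans hkl) hlm, ← UTStarFun.mapSuper_comp, ←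
    UTStarFun.mapSuper_comp,
    hx, hy]
  exact V1.mk_eq_of_joined (hm hlm)

variable (f) in
omit [IsDirectedOrder J] [Nonempty J] in
lemma V1_mk_eq_trans {i k l : J} {s : (A i).Super} {a : (A k).V1} (hik : i ≤ k) (hkl : k ≤ l)
    (hf : ∀ i j k hij hjk,
      CategoryStruct.comp (obj := UTStarCat.{u} 𝕜) (f i j hij) (f j k hjk) = f i k (hij.trans hjk))
    (h : V1.mk (A k) ((f i k hik).mapSuper s) = a) :
    V1.mk (A l) ((f i l (hik.trans hkl)).mapSuper s) = (f k l hkl).mapV1 a := by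
  rw [← h, UTStarFun.mapV1_mk, UTStarFun.mapSuper_comp, hf]

/-- Supersymmetries in the limit with arbitrarily close lifts that have the same class. -/
def LiftRel (φ : ∀ i, UTStarFun (A i) C) (NC : Bnorm C.toTStarCat) (u v : C.Super) : Prop :=
  ∀ ε > 0, ∃ (k : J) (s t : (A k).Super), NC.Near ε ((φ k).mapSuper s) u ∧
    NC.Near ε ((φ k).mapSuper t) v ∧ V1.mk (A k) s = V1.mk (A k) t

include H hφ in
lemma liftRel_refl (u : C.Super) : LiftRel φ NC u u := fun ε hε => by
  obtain ⟨k, Y, x, y, _, hx, _⟩ := H.exists_near hφ u.ss u.ss hε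
  exact ⟨k, _, _, hx, hx, rfl⟩

include H hφ hf in
-- The middle term has two lifts, possibly at different stages. Once close enough to it they acquire
-- the same class at a later stage, which links the outer lifts.
lemma LiftRel.trans {u v w : C.Super} (huv : LiftRel φ NC u v) (hvw : LiftRel φ NC v w) :
    LiftRel φ NC u w := fun ε hε => by
  obtain ⟨η, hη, hv⟩ := H.exists_V1_mk_eq hf hφ v
  obtain ⟨i, s, t, hs, ht, hst⟩ := huv (min ε η) (lt_min hε hη)
  obtain ⟨j, t', r, ht', hr, htr⟩ := hvw (min ε η) (lt_min hε hη)
  obtain ⟨k, hi, hj, h⟩ := hv v.ss (by rwa [sub_self, Bnorm.nrm_zero]) i j t t'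
    (ht.mono (min_le_right _ _)) (ht'.mono (min_le_right _ _))
  refine ⟨k, (f i k hi).mapSuper s, (f j k hj).mapSuper r, ?_, ?_, ?_⟩
  · rw [UTStarFun.mapSuper_comp, hφ]; exact hs.mono (min_le_left _ _)
  · rw [UTStarFun.mapSuper_comp, hφ]; exact hr.mono (min_le_left _ _)
  · rw [← UTStarFun.mapV1_mk, hst, UTStarFun.mapV1_mk, h, ← UTStarFun.mapV1_mk, htr,
      UTStarFun.mapV1_mk]

include H hφ hf in
/-- Supersymmetries in the same path component are related. -/
lemma liftRel_of_joined {X : C.addCompl.Ob} {u v : C.addCompl.SS X} (h : Joined u v) :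
    LiftRel φ NC ⟨X, u⟩ ⟨X, v⟩ := by
  let r : Setoid (C.addCompl.SS X) :=
    { r := fun u v => LiftRel φ NC ⟨X, u⟩ ⟨X, v⟩
      iseqv := ⟨fun u => H.liftRel_refl hφ _,
        fun h ε hε => by
          obtain ⟨k, s, t, hs, ht, hst⟩ := h ε hε
          exact ⟨k, t, s, ht, hs, hst.symm⟩,
        fun h h' => LiftRel.trans H hf hφ h h'⟩ }
  -- Close supersymmetries are related, so the class map is locally constant, hence constant along
  -- any path. This replaces a subdivision of the path.
  have hloc : IsLocallyConstant (Quotient.mk r) := by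
    rw [IsLocallyConstant.iff_eventually_eq]
    intro u
    obtain ⟨η, hη, hu⟩ := H.exists_V1_mk_eq hf hφ ⟨X, u⟩
    have hn : ∀ᶠ v : C.addCompl.SS X in 𝓝 u, NC.addCompl.nrm (v.1 - u.1) < η :=
      continuous_subtype_val.continuousAt.eventually
        (((NC.addCompl.isBanachNorm X X).nhds_basis u.1).mem_of_mem hη)
    filter_upwards [hn] with v hv
    refine Quotient.sound (show LiftRel φ NC ⟨X, v⟩ ⟨X, u⟩ from fun ε hε => ?_)
    obtain ⟨i, Y, x, y, _, hx, hy⟩ := H.exists_near hφ u v (lt_min hε hη)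
    obtain ⟨k, hi, hj, h⟩ := hu v hv i i _ _ (hx.mono (min_le_right _ _))
      (hy.mono (min_le_right _ _))
    refine ⟨k, _, _, ?_, ?_, h.symm⟩
    · rw [UTStarFun.mapSuper_comp, hφ]; exact hy.mono (min_le_left _ _)
    · rw [UTStarFun.mapSuper_comp, hφ]; exact hx.mono (min_le_left _ _)
  obtain ⟨γ⟩ := h
  have := (hloc.comp_continuous γ.continuous).apply_eq_of_preconnectedSpace 0 1
  simp only [Function.comp_apply, γ.source, γ.target] at this
  exact Quotient.exact this

omit [Nonempty J] in
include hφ in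
lemma liftRel_add {u v u' v' : C.Super} (h : LiftRel φ NC u v) (h' : LiftRel φ NC u' v') :
    LiftRel φ NC (u + u') (v + v') := fun ε hε => by
  obtain ⟨i, s, t, hs, ht, hst⟩ := h (ε / 2) (half_pos hε)
  obtain ⟨j, s', t', hs', ht', hst'⟩ := h' (ε / 2) (half_pos hε)
  obtain ⟨k, hi, hj⟩ := exists_ge_ge i j
  refine ⟨k, (f i k hi).mapSuper s + (f j k hj).mapSuper s',
    (f i k hi).mapSuper t + (f j k hj).mapSuper t', ?_, ?_, ?_⟩
  · rw [map_add, UTStarFun.mapSuper_comp, UTStarFun.mapSuper_comp, hφ, hφ, ← add_halves ε]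
    exact hs.add hs'
  · rw [map_add, UTStarFun.mapSuper_comp, UTStarFun.mapSuper_comp, hφ, hφ, ← add_halves ε]
    exact ht.add ht'
  · rw [map_add, map_add, ← UTStarFun.mapV1_mk, ← UTStarFun.mapV1_mk, hst, hst']
    rfl

include H hφ hf in
/-- Classes that become equal in `V₁` of the limit are eventually equal. -/
lemma exists_V1_mk_eq_of_map_eq {i : J} (s t : (A i).Super)
    (h : V1.mk C ((φ i).mapSuper s) = V1.mk C ((φ i).mapSuper t)) :
    ∃ k hi, V1.mk (A k) ((f i k hi).mapSuper s) = V1.mk (A k) ((f i k hi).mapSuper t) := by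
  let R : AddCon C.Super :=
    { r := LiftRel φ NC
      iseqv := ⟨fun u => H.liftRel_refl hφ _,
        fun h ε hε => by
          obtain ⟨k, s, t, hs, ht, hst⟩ := h ε hε
          exact ⟨k, t, s, ht, hs, hst.symm⟩,
        fun h h' => LiftRel.trans H hf hφ h h'⟩
      add' := fun h h' => liftRel_add hφ h h' }
  -- Equality in `V₁` is the congruence generated by the two relations, so it suffices that
  -- `LiftRel` is a congruence that contains them. For `u + v` and `v + u` one takes the two sums of
  -- lifts in either order, as `V₁` of the stage is commutative.
  have hR : addConGen C.V1Rel ≤ R := by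
    refine AddCon.addConGen_le.mpr ?_
    rintro _ _ (⟨x, y, h⟩ | ⟨u, v⟩)
    · exact H.liftRel_of_joined hf hφ h
    · intro ε hε
      obtain ⟨j, s, _, hs, _, _⟩ := H.liftRel_refl hφ u (ε / 2) (half_pos hε)
      obtain ⟨j', t, _, ht, _, _⟩ := H.liftRel_refl hφ v (ε / 2) (half_pos hε)
      obtain ⟨k, hj, hj'⟩ := exists_ge_ge j j'
      refine ⟨k, (f j k hj).mapSuper s + (f j' k hj').mapSuper t,
        (f j' k hj').mapSuper t + (f j k hj).mapSuper s, ?_, ?_, ?_⟩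
      · rw [map_add, UTStarFun.mapSuper_comp, UTStarFun.mapSuper_comp, hφ, hφ, ← add_halves ε]
        exact hs.add ht
      · rw [map_add, UTStarFun.mapSuper_comp, UTStarFun.mapSuper_comp, hφ, hφ, ← add_halves ε]
        exact ht.add hs
      · rw [map_add, map_add, add_comm]
  have hst : LiftRel φ NC ((φ i).mapSuper s) ((φ i).mapSuper t) := hR ((AddCon.eq _).mp h)
  -- The lifts `s'` and `t'` have the same class by construction. Since `s` and `s'` both lift
  -- supersymmetries near the image of `s`, their classes agree later on, and likewise for `t` and
  -- `t'`.
  obtain ⟨η, hη, hu⟩ := H.exists_V1_mk_eq hf hφ ((φ i).mapSuper s)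
  obtain ⟨η', hη', hv⟩ := H.exists_V1_mk_eq hf hφ ((φ i).mapSuper t)
  obtain ⟨j, s', t', hs', ht', hst'⟩ := hst (min η η') (lt_min hη hη')
  obtain ⟨k, hik, hjk, h1⟩ := hu ((φ i).mapSuper s).ss (by rwa [sub_self, Bnorm.nrm_zero]) i j s s'
    (Bnorm.Near.refl NC hη _) (hs'.mono (min_le_left _ _))
  obtain ⟨l, hil, hjl, h2⟩ := hv ((φ i).mapSuper t).ss (by rwa [sub_self, Bnorm.nrm_zero]) i j t t'
    (Bnorm.Near.refl NC hη' _) (ht'.mono (min_le_right _ _))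
  obtain ⟨m, hkm, hlm⟩ := exists_ge_ge k l
  refine ⟨m, hik.trans hkm, ?_⟩
  rw [V1_mk_eq_trans f hik hkm hf h1, V1_mk_eq_trans f hil hlm hf h2]
  rw [UTStarFun.mapV1_mk, UTStarFun.mapV1_mk, UTStarFun.mapSuper_comp, UTStarFun.mapSuper_comp, hf,
    hf, ← UTStarFun.mapV1_mk, ← UTStarFun.mapV1_mk, hst']

end IsDirectLimit

/-! ### Filtered colimits of abelian groups and their kernels. -/

section FilteredColimits

variable {J : Type u} [Preorder J] [IsDirectedOrder J] [Nonempty J]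

/-- The forgetful functor to sets reflects filtered colimits, and for groups the eventual equality
of two elements reduces to the eventual vanishing of their difference. -/
lemma isColimit_of_exists (G : J ⥤ AddCommGrpCat.{u}) (c : Limits.Cocone G)
    (hs : ∀ x : c.pt, ∃ i, ∃ y : G.obj i, c.ι.app i y = x)
    (hi : ∀ i (y : G.obj i), c.ι.app i y = 0 → ∃ (k : J) (h : i ⟶ k), G.map h y = 0) :
    Nonempty (Limits.IsColimit c) := by
  have := Limits.reflectsColimit_of_reflectsIsomorphisms G (forget AddCommGrpCat.{u})
  refine ⟨Limits.isColimitOfReflects (forget AddCommGrpCat.{u}) ?_⟩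
  refine Limits.Types.FilteredColimit.isColimitOf' _ _ (fun x => ?_) fun i y z h => ?_
  · obtain ⟨i, y, h⟩ := hs x
    exact ⟨i, y, h.symm⟩
  · change G.obj i at y z
    obtain ⟨k, hk, e⟩ := hi i (y - z) (by
      rw [map_sub]; exact sub_eq_zero.mpr h)
    rw [map_sub] at e
    exact ⟨k, hk, sub_eq_zero.mp e⟩

lemma exists_rep_of_isColimit (G : J ⥤ AddCommGrpCat.{u}) (c : Limits.Cocone G)
    (hc : Limits.IsColimit c) (x : c.pt) : ∃ i, ∃ y : G.obj i, c.ι.app i y = x := by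
  exact Limits.Concrete.isColimit_exists_rep G hc x

lemma exists_map_eq_zero_of_isColimit (G : J ⥤ AddCommGrpCat.{u}) (c : Limits.Cocone G)
    (hc : Limits.IsColimit c) (i : J) (y : G.obj i) (hy : c.ι.app i y = 0) :
    ∃ (k : J) (h : i ⟶ k), G.map h y = 0 := by
  obtain ⟨k, h, h', e⟩ := Limits.Concrete.isColimit_exists_of_rep_eq G hc y (0 : G.obj i)
    (by rw [hy]; exact (map_zero (c.ι.app i).hom).symm)
  exact ⟨k, h, e.trans (map_zero (G.map h').hom)⟩

/-- Kernels commute with filtered colimits. -/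
lemma isColimit_kernel {T : Type*} [Category T] {G H : T ⥤ AddCommGrpCat.{u}} (α : G ⟶ H)
    (F : J ⥤ T)
    (c : Limits.Cocone F) (hG : Nonempty (Limits.IsColimit (G.mapCocone c)))
    (hH : Nonempty (Limits.IsColimit (H.mapCocone c))) :
    Nonempty (Limits.IsColimit ((Limits.kernel α).mapCocone c)) := by
  obtain ⟨hG⟩ := hG
  obtain ⟨hH⟩ := hH
  have hinj : ∀ X, Function.Injective ((Limits.kernel.ι α).app X) := fun X =>
    (AddCommGrpCat.mono_iff_injective _).mp inferInstance
  have hrange : ∀ X (g : G.obj X), α.app X g = 0 →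
      ∃ y : (Limits.kernel α).obj X, (Limits.kernel.ι α).app X y = g := by
    intro X g hg
    -- Evaluation at an object is exact, so the kernel in the functor category is computed
    -- objectwise.
    have h := (ShortComplex.exact_kernel α).map ((evaluation T AddCommGrpCat.{u}).obj X)
    exact (ShortComplex.ab_exact_iff _).mp h g hg
  have hcomp : ∀ X (y : (Limits.kernel α).obj X), α.app X ((Limits.kernel.ι α).app X y) = 0 :=
    fun X y => by
      have h := congrArg (fun β => β.app X) (Limits.kernel.condition α)
      exact congrArg (fun g : (Limits.kernel α).obj X ⟶ H.obj X => g.hom y) h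
  refine isColimit_of_exists _ _ (fun x => ?_) fun i y hy => ?_
  · obtain ⟨i, g, hg⟩ := exists_rep_of_isColimit _ _ hG ((Limits.kernel.ι α).app c.pt x)
    -- The representative `g` need not lie in the kernel at stage `i`. Its image under `α` vanishes
    -- in the colimit, hence at some stage `k`, where `g` enters the kernel.
    obtain ⟨k, h, hk⟩ := exists_map_eq_zero_of_isColimit _ _ hH i (α.app (F.obj i) g) (by
      have h := NatTrans.naturality_apply α (c.ι.app i) g
      refine h.symm.trans ((congrArg (α.app c.pt) hg).trans (hcomp _ x)))
    obtain ⟨y, hy⟩ := hrange (F.obj k) (G.map (F.map h) g)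
      ((NatTrans.naturality_apply α (F.map h) g).trans hk)
    refine ⟨k, y, hinj c.pt ?_⟩
    refine (NatTrans.naturality_apply (Limits.kernel.ι α) (c.ι.app k) y).trans ?_
    rw [hy, ← hg]
    have h2 := congrArg (fun β => (G.map β).hom g) (c.w h)
    rw [G.map_comp] at h2
    exact h2
  · obtain ⟨k, h, hk⟩ := exists_map_eq_zero_of_isColimit _ _ hG i ((Limits.kernel.ι α).app _ y) (by
      refine (NatTrans.naturality_apply (Limits.kernel.ι α) (c.ι.app i) y).symm.trans ?_
      exact (congrArg ((Limits.kernel.ι α).app c.pt) hy).trans (map_zero _))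
    refine ⟨k, h, hinj _ ?_⟩
    refine (NatTrans.naturality_apply (Limits.kernel.ι α) (F.map h) y).trans ?_
    exact hk.trans (map_zero _).symm

end FilteredColimits
-- Continuity of van Daele's group.
namespace IsDirectLimit

open UTStarCat Algebra

/-- Close supersymmetries of an object are joined by a path. The summand `1` in the hypothesis
yields the strict inequality that the path requires. -/
lemma _root_.GradedCStar.Bnorm.Near.V1_mk_eq {C : UTStarCat.{u} 𝕜} {NC : Bnorm C.toTStarCat}
    {s t : C.Super} {ε : ℝ} (h : NC.Near ε s t) (hε : ε * (NC.addCompl.nrm t.ss.1 + 1) ≤ 1 / 2) :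
    V1.mk C s = V1.mk C t := by
  obtain ⟨x, rfl, hx⟩ := h
  refine (V1.mk_eq_of_joined (NC.addCompl.joined_of_near t.ss x ?_)).symm
  have h1 := NC.addCompl.nonneg t.ss.1
  have h2 := NC.addCompl.nonneg (x.1 - t.ss.1)
  nlinarith

variable {J : Type u} [Preorder J] [IsDirectedOrder J] [Nonempty J]

/-- Van Daele's group commutes with direct limits. -/
theorem isColimit_vanDaele (F : J ⥤ UTStarCat.{u} 𝕜) (c : Limits.Cocone F)
    (N : ∀ i, Bnorm (F.obj i).toTStarCat) (NC : Bnorm c.pt.toTStarCat)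
    (H : IsDirectLimit (fun _ _ h => UTStarFun.toTStarFun (F.map (homOfLE h)))
      (fun i => UTStarFun.toTStarFun (c.ι.app i)) N NC) :
    Nonempty (Limits.IsColimit (vanDaele.mapCocone c)) := by
  let f : ∀ i j : J, i ≤ j → UTStarFun (F.obj i) (F.obj j) := fun i j h => F.map (homOfLE h)
  let φ : ∀ i, UTStarFun (F.obj i) c.pt := fun i => c.ι.app i
  change IsDirectLimit (fun i j h => (f i j h).toTStarFun) (fun i => (φ i).toTStarFun) N NC at H
  have hf : ∀ i j k hij hjk, CategoryStruct.comp (obj := UTStarCat.{u} 𝕜) (f i j hij) (f j k hjk) =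
      f i k (hij.trans hjk) := fun i j k hij hjk => (F.map_comp _ _).symm
  have hφ : ∀ i j hij, CategoryStruct.comp (obj := UTStarCat.{u} 𝕜) (f i j hij) (φ j) = φ i :=
    fun _ _ hij => c.w (homOfLE hij)
  -- The pair is lifted to supersymmetries of one object `Y`, as elements of van Daele's group are
  -- differences over a common object.
  have hlift : ∀ {X : c.pt.addCompl.Ob} (u v : c.pt.addCompl.SS X),
      ∃ (k : J) (Y : (F.obj k).addCompl.Ob) (x y : (F.obj k).addCompl.SS Y),
        V1.mk c.pt ((φ k).mapSuper ⟨Y, x⟩) = V1.mk c.pt ⟨X, u⟩ ∧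
        V1.mk c.pt ((φ k).mapSuper ⟨Y, y⟩) = V1.mk c.pt ⟨X, v⟩ := by
    intro X u v
    have h1 := NC.addCompl.nonneg u.1
    have h2 := NC.addCompl.nonneg v.1
    obtain ⟨ε, hε⟩ : ∃ ε, ε = 1 / (2 * (NC.addCompl.nrm u.1 + NC.addCompl.nrm v.1 + 1)) := ⟨_, rfl⟩
    have hε0 : 0 < ε := by rw [hε]; positivity
    have hε1 : ε * (NC.addCompl.nrm u.1 + NC.addCompl.nrm v.1 + 1) = 1 / 2 := by
      rw [hε]; field_simp
    obtain ⟨k, Y, x, y, _, hx, hy⟩ := H.exists_near hφ u v hε0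
    exact ⟨k, Y, x, y, hx.V1_mk_eq (by dsimp only; nlinarith), hy.V1_mk_eq
      (by dsimp only; nlinarith)⟩
  have hG1 : ∀ {A : UTStarCat.{u} 𝕜} {s t : A.Super}, V1.mk A s = V1.mk A t →
      G1.mk A s = G1.mk A t := fun h => congrArg GrothendieckAddGroup.of h
  refine isColimit_of_exists _ _ ?_ ?_
  · rintro ⟨_, X, u, v, rfl⟩
    obtain ⟨k, Y, x, y, hx, hy⟩ := hlift u v
    refine ⟨k, (⟨_, Y, x, y, rfl⟩ : (F.obj k).vanDaele), Subtype.ext ?_⟩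
    change (φ k).mapG1 (G1.mk _ ⟨Y, x⟩ - G1.mk _ ⟨Y, y⟩) = _
    rw [map_sub, UTStarFun.mapG1_mk, UTStarFun.mapG1_mk, hG1 hx, hG1 hy]
  · rintro i ⟨_, X, u, v, rfl⟩ h
    have h1 : (φ i).mapG1 (G1.mk _ ⟨X, u⟩ - G1.mk _ ⟨X, v⟩) = 0 := congrArg Subtype.val h
    rw [map_sub, UTStarFun.mapG1_mk, UTStarFun.mapG1_mk, sub_eq_zero] at h1
    -- Equality in the Grothendieck group is equality in `V₁` after adding some `w`. The class of
    -- `w` lifts to a stage, so injectivity on `V₁` applies to the sums, and the lift of `w` is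
    -- cancelled again in `G₁` of the later stage.
    obtain ⟨⟨w, _⟩, hw⟩ := (AddLocalization.addMonoidOf ⊤).exists_of_eq h1
    obtain ⟨w, rfl⟩ := AddCon.mk'_surjective w
    obtain ⟨j, Y, y, _, hy, _⟩ := hlift w.ss w.ss
    obtain ⟨k, hik, hjk⟩ := exists_ge_ge i j
    have hw' : V1.mk c.pt w + V1.mk c.pt ((φ i).mapSuper ⟨X, u⟩) =
      V1.mk c.pt w + V1.mk c.pt ((φ i).mapSuper ⟨X, v⟩) := hw
    have hy' : V1.mk c.pt ((φ j).mapSuper ⟨Y, y⟩) = V1.mk c.pt w := hy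
    rw [← hy', ← hφ i k hik, ← hφ j k hjk, ← UTStarFun.mapSuper_comp, ← UTStarFun.mapSuper_comp,
      ← UTStarFun.mapSuper_comp, ← map_add, ← map_add, ← map_add, ← map_add] at hw'
    obtain ⟨l, hkl, hl⟩ := H.exists_V1_mk_eq_of_map_eq hf hφ _ _ hw'
    refine ⟨l, homOfLE (hik.trans hkl), Subtype.ext ?_⟩
    change (f i l (hik.trans hkl)).mapG1 (G1.mk _ ⟨X, u⟩ - G1.mk _ ⟨X, v⟩) = 0
    have hl' := hG1 hl
    rw [map_add, map_add, map_add, map_add, UTStarFun.mapSuper_comp, UTStarFun.mapSuper_comp,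
      UTStarFun.mapSuper_comp, hf, hf] at hl'
    rw [map_sub, UTStarFun.mapG1_mk, UTStarFun.mapG1_mk, sub_eq_zero]
    exact add_left_cancel hl'

end IsDirectLimit

/-! ### The norm of the resolvent of a positive element -/

section
variable {B : Type*} [NonUnitalNormedRing B] [NormedSpace ℝ B] [IsScalarTower ℝ B B]
  [SMulCommClass ℝ B B] [StarRing B] [CStarRing B] [StarModule ℝ B]

/-- Since `s - s² = b` is positive, the spectrum of `s` should lie in `[0, 1]`. Some real `τ` in it
has modulus `‖s‖`, and `τ - τ²` belongs to the spectrum of `b`. Passing to a complex Banach algebra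
covers real scalars as well. -/
lemma norm_le_one_of_rep {R : Type*} [NormedRing R] [NormedAlgebra ℂ R] [CompleteSpace R]
    {ρ : B → R} (hρ : IsRep ρ)
    (hB : ∀ x : B, ∃ q : B, star x * x * q + q + star x * x = 0 ∧
      q * (star x * x) + q + star x * x = 0)
    {s b : B} (hs : star s = s) (hsb : s = s * s + b)
    (hb : ∀ t : ℝ, 0 < t → ∃ r : B, b * r + t • r + t⁻¹ • b = 0 ∧ r * b + t • r + t⁻¹ • b = 0) :
    ‖s‖ ≤ 1 := by
  rcases eq_or_ne s 0 with rfl | hs0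
  · simp
  by_contra! hlt
  obtain ⟨τ, hτ, hτs⟩ := exists_real_mem_spectrum_rep hρ hB s hs hs0
  rw [← hτ] at hlt
  -- If `|τ| > 1`, then `τ - τ²` is negative for either sign of `τ`. But `b + t` with `t = τ² - τ`
  -- is invertible by hypothesis, a contradiction.
  have htpos : 0 < τ ^ 2 - τ := by
    rcases lt_abs.mp hlt with h | h <;> nlinarith
  obtain ⟨r, h1, h2⟩ := hb _ htpos
  generalize ht : τ ^ 2 - τ = t at htpos h1 h2
  have ht0 : (t : ℂ) ≠ 0 := by exact_mod_cast htpos.ne'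
  have hmem : -(t : ℂ) ∈ spectrum ℂ (ρ b) := by
    have h := spectrum.subset_polynomial_aeval (ρ s)
      (Polynomial.X - Polynomial.X * Polynomial.X : Polynomial ℂ) ⟨_, hτs, rfl⟩
    have e := congrArg ρ hsb
    rw [hρ.add, hρ.mul] at e
    rw [map_sub, map_mul, Polynomial.aeval_X, sub_eq_iff_eq_add'.mpr e] at h
    convert h using 1
    simp [← ht, sq]
  have e1 : ρ b * ρ r + (t : ℂ) • ρ r + (t : ℂ)⁻¹ • ρ b = 0 := by
    have := congrArg ρ h1
    rwa [hρ.add, hρ.add, hρ.mul, hρ.smul, hρ.smul, hρ.zero, Complex.ofReal_inv] at this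
  have e2 : ρ r * ρ b + (t : ℂ) • ρ r + (t : ℂ)⁻¹ • ρ b = 0 := by
    have := congrArg ρ h2
    rwa [hρ.add, hρ.add, hρ.mul, hρ.smul, hρ.smul, hρ.zero, Complex.ofReal_inv] at this
  have e3 : ((t : ℂ) • 1 + ρ b) * ((t : ℂ)⁻¹ • 1 + ρ r) = 1 := by
    rw [add_mul, mul_add, mul_add, smul_mul_smul_comm, mul_inv_cancel₀ ht0, one_smul, one_mul,
      smul_mul_assoc, one_mul, mul_smul_comm, mul_one]
    calc _ = 1 + (ρ b * ρ r + (t : ℂ) • ρ r + (t : ℂ)⁻¹ • ρ b) := by abel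
      _ = 1 := by rw [e1, add_zero]
  have e4 : ((t : ℂ)⁻¹ • 1 + ρ r) * ((t : ℂ) • 1 + ρ b) = 1 := by
    rw [add_mul, mul_add, mul_add, smul_mul_smul_comm, inv_mul_cancel₀ ht0, one_smul, one_mul,
      smul_mul_assoc, one_mul, mul_smul_comm, mul_one]
    calc _ = 1 + (ρ r * ρ b + (t : ℂ) • ρ r + (t : ℂ)⁻¹ • ρ b) := by abel
      _ = 1 := by rw [e2, add_zero]
  apply hmem
  rw [spectrum.mem_resolventSet_iff, Algebra.algebraMap_eq_smul_one, neg_smul, ← neg_add',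
    IsUnit.neg_iff]
  exact ⟨⟨_, _, e3, e4⟩, rfl⟩

lemma norm_le_one_of_eq_mul_self_add
    (hB : ∀ x : B, ∃ q : B, star x * x * q + q + star x * x = 0 ∧
      q * (star x * x) + q + star x * x = 0)
    {s b : B} (hs : star s = s) (hsb : s = s * s + b)
    (hb : ∀ t : ℝ, 0 < t → ∃ r : B, b * r + t • r + t⁻¹ • b = 0 ∧ r * b + t • r + t⁻¹ • b = 0) :
    ‖s‖ ≤ 1 :=
  norm_le_one_of_rep (R := (B →L[ℝ] ℂ) →L[ℂ] (B →L[ℝ] ℂ)) (ρ := regRep)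
    ⟨regRep_add, regRep_mul, regRep_zero, regRep_smul, norm_regRep⟩ hB hs hsb hb

end

namespace GCStarCat

variable (A : GCStarCat.{u} 𝕜)

lemma comp_sub {X Y Z : A.Ob} (x : A.Hom Y Z) (y y' : A.Hom X Y) :
    A.comp x (y - y') = A.comp x y - A.comp x y' := A.toTStarCat.comp_sub x y y'

lemma sub_comp {X Y Z : A.Ob} (x x' : A.Hom Y Z) (y : A.Hom X Y) :
    A.comp (x - x') y = A.comp x y - A.comp x' y := A.toTStarCat.sub_comp x x' y

lemma star_sub {X Y : A.Ob} (x y : A.Hom X Y) : A.star (x - y) = A.star x - A.star y :=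
  A.toTStarCat.star_sub x y

/-- `t⁻¹ + r` is a left inverse of `p + t`. -/
def IsResolvent {X : A.Ob} (t : ℝ) (p r : A.Hom X X) : Prop :=
  A.comp p r + (t : 𝕜) • r + (t⁻¹ : 𝕜) • p = 0 ∧ A.comp r p + (t : 𝕜) • r + (t⁻¹ : 𝕜) • p = 0

variable {A}

lemma IsResolvent.unique {X : A.Ob} {t : ℝ} (ht : 0 < t) {p r r' : A.Hom X X}
    (h : A.IsResolvent t p r) (h' : A.IsResolvent t p r') : r = r' := by
  have ht0 : (t : 𝕜) ≠ 0 := by exact_mod_cast ht.ne'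
  -- Without a unit, uniqueness of the inverse is replaced by multiplying the equation of `r` by
  -- `r'` on the left and that of `r'` by `r` on the right. The comparison gives `r' p = p r`, and
  -- then the two equations give `r = r'`.
  have e1 := congrArg (A.comp r') h.1
  have e2 := congrArg (fun z => A.comp z r) h'.2
  have z1 : A.comp r' (0 : A.Hom X X) = 0 := by simpa using A.comp_smul 0 r' 0
  have z2 : A.comp (0 : A.Hom X X) r = 0 := by simpa using A.smul_comp 0 0 r
  simp only [A.comp_add, A.add_comp, A.comp_smul, A.smul_comp, z1, z2, A.assoc] at e1 e2
  have e3 : A.comp r' p = A.comp p r := by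
    have : (t⁻¹ : 𝕜) • A.comp r' p = (t⁻¹ : 𝕜) • A.comp p r :=
      add_left_cancel (e1.trans e2.symm)
    exact smul_right_injective _ (inv_ne_zero ht0) this
  have e4 := h.1.trans h'.2.symm
  rw [e3] at e4
  exact smul_right_injective _ ht0 (add_left_cancel (add_right_cancel e4))

lemma IsResolvent.star {X : A.Ob} {t : ℝ} {p r : A.Hom X X} (hp : A.star p = p)
    (h : A.IsResolvent t p r) : A.IsResolvent t p (A.star r) := by
  have z : A.star (0 : A.Hom X X) = 0 := by simpa using A.star_smul 0 (0 : A.Hom X X)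
  have e1 := congrArg A.star h.1
  have e2 := congrArg A.star h.2
  simp only [A.star_add, A.star_comp, A.star_smul, hp, z, map_inv₀, RCLike.conj_ofReal] at e1 e2
  exact ⟨e2, e1⟩

/-- The target of `y` may be any object: positivity of `y^* y` is an axiom for all morphisms out of
`X`. -/
lemma norm_le_one_of_eq_comp_self_add {X Y : A.Ob} {s : A.Hom X X} {y : A.Hom X Y}
    (hs : A.star s = s) (hsy : s = A.comp s s + A.comp (A.star y) y) : ‖s‖ ≤ 1 := by
  let := A.endRing X
  let : NormedSpace ℝ (A.Hom X X) := NormedSpace.restrictScalars ℝ 𝕜 _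
  have hA : ∀ (t : ℝ) (x : A.Hom X X), t • x = (t : 𝕜) • x := fun t x => by
    rw [← RCLike.real_smul_eq_coe_smul (K := 𝕜)]
  have : IsScalarTower ℝ (A.Hom X X) (A.Hom X X) := ⟨fun t x y => by
    rw [hA, hA]; exact A.smul_comp _ x y⟩
  have : SMulCommClass ℝ (A.Hom X X) (A.Hom X X) := ⟨fun t x y => by
    rw [hA, hA]; exact (A.comp_smul _ x y).symm⟩
  let : StarRing (A.Hom X X) :=
    { star := fun x => A.star x, star_involutive := A.star_star, star_mul := A.star_comp,
      star_add := A.star_add }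
  have : CStarRing (A.Hom X X) :=
    ⟨fun x => by rw [← sq]; exact (A.norm_star_comp_self x).ge⟩
  have : StarModule ℝ (A.Hom X X) := ⟨fun t x => by
    rw [hA, hA]; have := A.star_smul (t : 𝕜) x
    rw [RCLike.conj_ofReal] at this
    exact this⟩
  refine norm_le_one_of_eq_mul_self_add (fun x => ?_) (b := A.comp (A.star y) y) hs hsy
    fun t ht => ?_
  · obtain ⟨r, h1, h2⟩ := A.star_comp_self_pos x 1 one_pos
    simp only [RCLike.ofReal_one, inv_one, one_smul] at h1 h2
    exact ⟨r, h1, h2⟩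
  · obtain ⟨r, h1, h2⟩ := A.star_comp_self_pos y t ht
    refine ⟨r, ?_, ?_⟩
    · rw [hA, hA]; push_cast; exact h1
    · rw [hA, hA]; push_cast; exact h2

/-- In the unitization `r = (p + t)⁻¹ - t⁻¹ = -t⁻¹ s` with `p = x^* x` and `s = p (p + t)⁻¹`, a
contraction. That the bound does not depend on `x` makes the resolvents of a family of morphisms a
bounded family. -/
lemma IsResolvent.norm_le {X Y : A.Ob} {t : ℝ} (ht : 0 < t) {x : A.Hom X Y} {r : A.Hom X X}
    (h : A.IsResolvent t (A.comp (A.star x) x) r) : ‖r‖ ≤ t⁻¹ := by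
  have ht0 : (t : 𝕜) ≠ 0 := by exact_mod_cast ht.ne'
  have hr : A.star r = r :=
    (h.star (by rw [A.star_comp, A.star_star])).unique ht h
  obtain ⟨s, hs⟩ : ∃ s, s = (-(t : 𝕜)) • r := ⟨_, rfl⟩
  have hrs : r = (-(t⁻¹ : 𝕜)) • s := by
    rw [hs, smul_smul, neg_mul_neg, inv_mul_cancel₀ ht0, one_smul]
  have hss : A.star s = s := by
    rw [hs, A.star_smul, hr, map_neg, RCLike.conj_ofReal]
  have e1 : s = (t⁻¹ : 𝕜) • (A.comp (A.star x) x - A.comp (A.comp (A.star x) x) s) := by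
    have := h.1
    rw [hrs, A.comp_smul, smul_smul, mul_neg, mul_inv_cancel₀ ht0, neg_smul, neg_smul,
      one_smul] at this
    rw [smul_sub, ← sub_eq_zero, ← neg_eq_zero, ← this]
    abel
  have e2 : s = (t⁻¹ : 𝕜) • (A.comp (A.star x) x - A.comp s (A.comp (A.star x) x)) := by
    have := h.2
    rw [hrs, A.smul_comp, smul_smul, mul_neg, mul_inv_cancel₀ ht0, neg_smul, neg_smul,
      one_smul] at this
    rw [smul_sub, ← sub_eq_zero, ← neg_eq_zero, ← this]
    abel
  have h1 : ‖s‖ ≤ 1 := by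
    -- Since `1 - s = t (p + t)⁻¹`, one has `s - s² = t⁻¹ (1 - s) p (1 - s)`, which is `y^* y` for
    -- `y = t^(-1/2) (x - x s)`.
    refine norm_le_one_of_eq_comp_self_add
      (y := ((Real.sqrt t⁻¹ : ℝ) : 𝕜) • (x - A.comp x s)) hss ?_
    have hsq : ((Real.sqrt t⁻¹ : ℝ) : 𝕜) * ((Real.sqrt t⁻¹ : ℝ) : 𝕜) = (t : 𝕜)⁻¹ := by
      rw [← RCLike.ofReal_mul, Real.mul_self_sqrt (inv_nonneg.mpr ht.le), RCLike.ofReal_inv]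
    have e3 : A.comp s s = (t⁻¹ : 𝕜) • (A.comp s (A.comp (A.star x) x) -
        A.comp s (A.comp (A.comp (A.star x) x) s)) := by
      conv_lhs => rw [e1, A.comp_smul, A.comp_sub]
      rw [← e1]
    rw [A.star_smul, RCLike.conj_ofReal, A.smul_comp, A.comp_smul, smul_smul, hsq, e3, ← smul_add,
      A.star_sub, A.star_comp, hss, A.sub_comp, A.comp_sub, A.comp_sub]
    conv_lhs => rw [e1]
    simp only [A.assoc]
    congr 1
    abel
  rw [hrs, norm_smul, norm_neg, norm_inv, RCLike.norm_ofReal, abs_of_pos ht]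
  exact mul_le_of_le_one_right (inv_nonneg.mpr ht.le) h1

end GCStarCat

/-! ### Germs of bounded families -/

section Germ

variable {K : Type*} (l : Filter K) {E : K → Type*} [∀ k, NormedAddCommGroup (E k)]
  [∀ k, NormedSpace 𝕜 (E k)]

/-- Families that are bounded along a filter. -/
def EvBdd (x : ∀ k, E k) : Prop := ∃ C, ∀ᶠ k in l, ‖x k‖ ≤ C

variable (E) in
/-- The bounded families that tend to zero along a filter. -/
def nullFamilies : Submodule 𝕜 (lp E ⊤) where
  carrier := {x | Tendsto (fun k => ‖x k‖) l (𝓝 0)}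
  zero_mem' := by
    change Tendsto (fun k => ‖(0 : E k)‖) l (𝓝 0)
    simpa only [norm_zero] using tendsto_const_nhds
  add_mem' {x y} hx hy := by
    have := Tendsto.add hx hy
    rw [add_zero] at this
    exact squeeze_zero (fun k => norm_nonneg _) (fun k => norm_add_le (x k) (y k)) this
  smul_mem' c x hx := by
    have := Tendsto.const_mul ‖c‖ hx
    rw [mul_zero] at this
    exact this.congr fun k => (norm_smul c (x k)).symm

/-- Closedness makes the quotient seminorm a norm. -/
instance isClosed_nullFamilies : IsClosed (nullFamilies (𝕜 := 𝕜) l E : Set (lp E ⊤)) := by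
  refine isClosed_of_closure_subset fun x hx => ?_
  change Tendsto (fun k => ‖x k‖) l (𝓝 0)
  rw [Metric.tendsto_nhds]
  intro ε hε
  obtain ⟨y, hy, hxy⟩ := Metric.mem_closure_iff.mp hx (ε / 2) (half_pos hε)
  change Tendsto (fun k => ‖y k‖) l (𝓝 0) at hy
  filter_upwards [hy.eventually (gt_mem_nhds (half_pos hε))] with k hk
  have h1 : ‖x k - y k‖ ≤ ‖x - y‖ := lp.norm_apply_le_norm ENNReal.top_ne_zero (x - y) k
  rw [dist_eq_norm] at hxy
  have h2 := norm_le_norm_add_norm_sub' (x k) (y k)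
  rw [dist_zero_right, norm_norm]
  linarith

variable (𝕜 E) in
/-- Bounded families modulo those that tend to zero. -/
abbrev Germ := lp E ⊤ ⧸ nullFamilies (𝕜 := 𝕜) l E

open scoped Classical in
variable (𝕜) in
/-- The germ of an eventually bounded family. -/
noncomputable def germ (x : ∀ k, E k) : Germ 𝕜 l E :=
  if h : ∃ y : lp E ⊤, ∀ᶠ k in l, y k = x k then Submodule.Quotient.mk h.choose else 0

variable {l}

lemma EvBdd.of_le {x : ∀ k, E k} {C : ℝ} (h : ∀ k, ‖x k‖ ≤ C) : EvBdd l x :=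
  ⟨C, Eventually.of_forall h⟩

lemma EvBdd.add {x y : ∀ k, E k} (hx : EvBdd l x) (hy : EvBdd l y) :
    EvBdd l fun k => x k + y k := by
  obtain ⟨C, hC⟩ := hx
  obtain ⟨D, hD⟩ := hy
  refine ⟨C + D, ?_⟩
  filter_upwards [hC, hD] with k h1 h2 using (norm_add_le _ _).trans (add_le_add h1 h2)

include 𝕜 in
lemma EvBdd.smul {x : ∀ k, E k} (c : 𝕜) (hx : EvBdd l x) : EvBdd l fun k => c • x k := by
  obtain ⟨C, hC⟩ := hx
  refine ⟨‖c‖ * C, ?_⟩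
  filter_upwards [hC] with k h
  rw [norm_smul]
  exact mul_le_mul_of_nonneg_left h (norm_nonneg _)

/-- Replacing the values of norm larger than `C` by zero changes nothing along the filter and bounds
the family everywhere. -/
lemma EvBdd.exists_lp_le {x : ∀ k, E k} {C : ℝ} (hC : 0 ≤ C) (hx : ∀ᶠ k in l, ‖x k‖ ≤ C) :
    ∃ y : lp E ⊤, ‖y‖ ≤ C ∧ ∀ᶠ k in l, y k = x k := by
  classical
  have hb : ∀ k, ‖if ‖x k‖ ≤ C then x k else 0‖ ≤ C := fun k => by
    split_ifs with h
    · exact h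
    · rwa [norm_zero]
  refine ⟨⟨fun k => if ‖x k‖ ≤ C then x k else 0, memℓp_infty ⟨C, ?_⟩⟩,
    lp.norm_le_of_forall_le hC hb, ?_⟩
  · rintro _ ⟨k, rfl⟩
    exact hb k
  · filter_upwards [hx] with k hk using if_pos hk

lemma EvBdd.exists_lp {x : ∀ k, E k} (hx : EvBdd l x) :
    ∃ y : lp E ⊤, ∀ᶠ k in l, y k = x k := by
  obtain ⟨C, hC⟩ := hx
  obtain ⟨y, -, hy⟩ := EvBdd.exists_lp_le (x := x) (le_max_right C 0)
    (hC.mono fun k h => h.trans (le_max_left _ _))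
  exact ⟨y, hy⟩

/-- Two bounded families that agree along the filter differ by a null family, so the choice made in
`germ` is immaterial. -/
lemma germ_eq_mk {x : ∀ k, E k} {y : lp E ⊤} (h : ∀ᶠ k in l, y k = x k) :
    germ 𝕜 l x = Submodule.Quotient.mk y := by
  have h' : ∃ y : lp E ⊤, ∀ᶠ k in l, y k = x k := ⟨y, h⟩
  rw [germ, dif_pos h', Submodule.Quotient.eq]
  change Tendsto (fun k => ‖h'.choose k - y k‖) l (𝓝 0)
  refine tendsto_const_nhds.congr' ?_
  filter_upwards [h, h'.choose_spec] with k h1 h2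
  rw [h1, h2, sub_self, norm_zero]

lemma exists_germ (z : Germ 𝕜 l E) : ∃ x : ∀ k, E k, EvBdd l x ∧ germ 𝕜 l x = z := by
  obtain ⟨y, rfl⟩ := Submodule.Quotient.mk_surjective _ z
  exact ⟨y, .of_le fun k => lp.norm_apply_le_norm ENNReal.top_ne_zero y k,
    germ_eq_mk (Eventually.of_forall fun _ => rfl)⟩

lemma germ_eq_germ_iff {x y : ∀ k, E k} (hx : EvBdd l x) (hy : EvBdd l y) :
    germ 𝕜 l x = germ 𝕜 l y ↔ Tendsto (fun k => ‖x k - y k‖) l (𝓝 0) := by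
  obtain ⟨x', hx'⟩ := hx.exists_lp
  obtain ⟨y', hy'⟩ := hy.exists_lp
  rw [germ_eq_mk hx', germ_eq_mk hy', Submodule.Quotient.eq]
  refine tendsto_congr' ?_
  filter_upwards [hx', hy'] with k h1 h2
  rw [← h1, ← h2]; rfl

lemma germ_congr {x y : ∀ k, E k} (h : ∀ᶠ k in l, x k = y k) : germ 𝕜 l x = germ 𝕜 l y := by
  by_cases hx : ∃ z : lp E ⊤, ∀ᶠ k in l, z k = x k
  · obtain ⟨z, hz⟩ := hx
    rw [germ_eq_mk hz, germ_eq_mk (hz.mp (h.mono fun k h1 h2 => h2.trans h1))]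
  · have hy : ¬∃ z : lp E ⊤, ∀ᶠ k in l, z k = y k := fun ⟨z, hz⟩ =>
      hx ⟨z, hz.mp (h.mono fun k h1 h2 => h2.trans h1.symm)⟩
    rw [germ, dif_neg hx, germ, dif_neg hy]

lemma germ_add {x y : ∀ k, E k} (hx : EvBdd l x) (hy : EvBdd l y) :
    germ 𝕜 l (fun k => x k + y k) = germ 𝕜 l x + germ 𝕜 l y := by
  obtain ⟨x', hx'⟩ := hx.exists_lp
  obtain ⟨y', hy'⟩ := hy.exists_lp
  rw [germ_eq_mk hx', germ_eq_mk hy', ← Submodule.Quotient.mk_add]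
  refine germ_eq_mk ?_
  filter_upwards [hx', hy'] with k h1 h2
  rw [← h1, ← h2]; rfl

lemma germ_smul (c : 𝕜) {x : ∀ k, E k} (hx : EvBdd l x) :
    germ 𝕜 l (fun k => c • x k) = c • germ 𝕜 l x := by
  obtain ⟨x', hx'⟩ := hx.exists_lp
  rw [germ_eq_mk hx', ← Submodule.Quotient.mk_smul]
  refine germ_eq_mk ?_
  filter_upwards [hx'] with k h1
  rw [← h1]; rfl

lemma germ_zero : germ 𝕜 l (fun k => (0 : E k)) = 0 :=
  germ_eq_mk (y := 0) (Eventually.of_forall fun _ => rfl)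

lemma norm_germ_le {x : ∀ k, E k} {C : ℝ} (hC : 0 ≤ C) (hx : ∀ᶠ k in l, ‖x k‖ ≤ C) :
    ‖germ 𝕜 l x‖ ≤ C := by
  obtain ⟨y, hy, h⟩ := EvBdd.exists_lp_le hC hx
  rw [germ_eq_mk h]
  exact (Submodule.Quotient.norm_mk_le _ _).trans hy

lemma Germ.exists_mk_eq_of_norm_lt {z : Germ 𝕜 l E} {r : ℝ} (h : ‖z‖ < r) :
    ∃ y : lp E ⊤, Submodule.Quotient.mk y = z ∧ ‖y‖ < r := by
  obtain ⟨y, hy, hyr⟩ := Submodule.Quotient.norm_mk_lt z (ε := r - ‖z‖) (by linarith)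
  exact ⟨y, hy, by linarith⟩

lemma eventually_norm_lt_of_mk_eq {x : ∀ k, E k} (hx : EvBdd l x) {y : lp E ⊤} {r : ℝ}
    (hy : Submodule.Quotient.mk y = germ 𝕜 l x) (hyr : ‖y‖ < r) : ∀ᶠ k in l, ‖x k‖ < r := by
  have hb : ∀ k, ‖y k‖ ≤ ‖y‖ := lp.norm_apply_le_norm ENNReal.top_ne_zero y
  have e : germ 𝕜 l (fun k => y k) = Submodule.Quotient.mk y :=
    germ_eq_mk (Eventually.of_forall fun _ => rfl)
  rw [← e, germ_eq_germ_iff (.of_le hb) hx] at hy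
  have hr := sub_pos.mpr hyr
  filter_upwards [hy.eventually (gt_mem_nhds hr)] with k hk
  have h1 := norm_le_norm_add_norm_sub (y k) (x k)
  linarith [hb k]

/-- A representative of norm below `r` differs from `x` by a null family. Together with
`norm_germ_le` this identifies the norm of a germ with the upper limit of the norms. -/
lemma eventually_norm_lt_of_norm_germ_lt {x : ∀ k, E k} (hx : EvBdd l x) {r : ℝ}
    (h : ‖germ 𝕜 l x‖ < r) : ∀ᶠ k in l, ‖x k‖ < r := by
  obtain ⟨y, hy, hyr⟩ := Germ.exists_mk_eq_of_norm_lt h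
  exact eventually_norm_lt_of_mk_eq hx hy hyr

end Germ

lemma germ_eq_germ_iff_forall_lt {K : Type*} {l : Filter K} {E : K → Type*}
    [∀ k, NormedAddCommGroup (E k)] [∀ k, NormedSpace 𝕜 (E k)] {x y : ∀ k, E k}
    (hx : EvBdd l x) (hy : EvBdd l y) :
    germ 𝕜 l x = germ 𝕜 l y ↔ ∀ ε > 0, ∀ᶠ k in l, ‖x k - y k‖ < ε := by
  rw [germ_eq_germ_iff hx hy, Metric.tendsto_nhds]
  simp only [dist_zero_right, norm_norm]

/-! ### Gradings from involutions -/

section parDeg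

variable {V : Type*} [AddCommGroup V] [Module 𝕜 V]

/-- The eigenspaces of an involution. -/
def parDeg (f : V →ₗ[𝕜] V) (a : ZMod 2) : Submodule 𝕜 V :=
  LinearMap.ker (f - sgn 𝕜 a • LinearMap.id)

lemma mem_parDeg {f : V →ₗ[𝕜] V} {a : ZMod 2} {x : V} : x ∈ parDeg f a ↔ f x = sgn 𝕜 a • x := by
  simp [parDeg, LinearMap.mem_ker, sub_eq_zero]

lemma isCompl_parDeg {f : V →ₗ[𝕜] V} (hf : ∀ x, f (f x) = x) :
    IsCompl (parDeg f 0) (parDeg f 1) := by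
  have h1 : sgn 𝕜 1 = -1 := by simp [sgn]
  constructor
  · rw [Submodule.disjoint_def]
    intro x hx hx'
    rw [mem_parDeg, sgn_zero, one_smul] at hx
    rw [mem_parDeg, h1, neg_smul, one_smul, hx, eq_neg_iff_add_eq_zero, ← two_smul 𝕜] at hx'
    exact (smul_eq_zero.mp hx').resolve_left two_ne_zero
  · rw [codisjoint_iff, Submodule.eq_top_iff']
    intro x
    refine Submodule.mem_sup.mpr ⟨(2⁻¹ : 𝕜) • (x + f x), ?_, (2⁻¹ : 𝕜) • (x - f x), ?_, ?_⟩
    · rw [mem_parDeg, map_smul, map_add, hf, sgn_zero, one_smul, add_comm]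
    · rw [mem_parDeg, map_smul, map_sub, hf, h1, neg_smul, one_smul, ← smul_neg, neg_sub]
    · rw [← smul_add, add_add_sub_cancel, ← two_smul 𝕜 x, smul_smul, inv_mul_cancel₀ two_ne_zero,
        one_smul]

lemma GCStarCat.par_of_mem_deg (A : GCStarCat.{u} 𝕜) {X Y : A.Ob} {a : ZMod 2} {x : A.Hom X Y}
    (hx : x ∈ A.deg X Y a) : A.par x = sgn 𝕜 a • x := by
  rcases zmod_two_cases a with rfl | rfl
  · rw [A.par_of_mem_zero hx, sgn_zero, one_smul]
  · rw [A.par_of_mem_one hx]; simp [sgn]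

end parDeg

/-! ### Transport of morphisms and equality of functors -/

namespace GCStarCat

/-- Transport of morphisms along equalities of objects. -/
noncomputable def hcast (A : GCStarCat.{u} 𝕜) {X X' Y Y' : A.Ob} (hX : X = X') (hY : Y = Y') :
    A.Hom X Y →ₗ[𝕜] A.Hom X' Y' :=
  A.toTStarCat.hcast hX hY

variable (A : GCStarCat.{u} 𝕜)

@[simp] lemma hcast_rfl {X Y : A.Ob} (x : A.Hom X Y) : A.hcast rfl rfl x = x := rfl

lemma hcast_hcast {X X' X'' Y Y' Y'' : A.Ob} (hX : X = X') (hY : Y = Y') (hX' : X' = X'')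
    (hY' : Y' = Y'') (x : A.Hom X Y) :
    A.hcast hX' hY' (A.hcast hX hY x) = A.hcast (hX.trans hX') (hY.trans hY') x := by
  subst hX hY hX' hY'; rfl

lemma hcast_comp {X X' Y Y' Z Z' : A.Ob} (hX : X = X') (hY : Y = Y') (hZ : Z = Z')
    (x : A.Hom Y Z) (y : A.Hom X Y) :
    A.hcast hX hZ (A.comp x y) = A.comp (A.hcast hY hZ x) (A.hcast hX hY y) := by
  subst hX hY hZ; rfl

lemma hcast_star {X X' Y Y' : A.Ob} (hX : X = X') (hY : Y = Y') (x : A.Hom X Y) :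
    A.hcast hY hX (A.star x) = A.star (A.hcast hX hY x) := by
  subst hX hY; rfl

lemma hcast_par {X X' Y Y' : A.Ob} (hX : X = X') (hY : Y = Y') (x : A.Hom X Y) :
    A.hcast hX hY (A.par x) = A.par (A.hcast hX hY x) := by
  subst hX hY; rfl

lemma norm_hcast {X X' Y Y' : A.Ob} (hX : X = X') (hY : Y = Y') (x : A.Hom X Y) :
    ‖A.hcast hX hY x‖ = ‖x‖ := by
  subst hX hY; rfl

end GCStarCat

lemma GCStarFun.map_hcast {A B : GCStarCat.{u} 𝕜} (f : GCStarFun A B) {X X' Y Y' : A.Ob}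
    (hX : X = X') (hY : Y = Y') (x : A.Hom X Y) : f.map (A.hcast hX hY x) =
      B.hcast (congrArg f.obj hX) (congrArg f.obj hY) (f.map x) := by
  subst hX hY; rfl

lemma GCStarFun.hcast_map_of_eq {A B : GCStarCat.{u} 𝕜} {f g : GCStarFun A B} (h : f = g)
    {X Y : A.Ob} (x : A.Hom X Y) (hX : f.obj X = g.obj X) (hY : f.obj Y = g.obj Y) :
    B.hcast hX hY (f.map x) = g.map x := by
  subst h; rfl

lemma GCStarFun.ext_hcast {A B : GCStarCat.{u} 𝕜} {f g : GCStarFun A B}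
    (h : ∀ X, f.obj X = g.obj X)
    (hm : ∀ {X Y} (x : A.Hom X Y), B.hcast (h X) (h Y) (f.map x) = g.map x) : f = g := by
  obtain ⟨fo, fm, _, _, _⟩ := f
  obtain ⟨go, gm, _, _, _⟩ := g
  obtain rfl : fo = go := funext h
  have : @fm = @gm := by
    funext X Y
    exact LinearMap.ext hm
  subst this
  rfl

/-! ### Germs of objects and morphisms along a directed system -/

namespace GermCat

variable {J : Type u} [Preorder J] (F : J ⥤ GCStarCat.{u} 𝕜)

/-- The functors of a directed system. -/
def tr {i k : J} (h : i ≤ k) : GCStarFun (F.obj i) (F.obj k) := F.map (homOfLE h)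

lemma tr_tr_obj {i j k : J} (hij : i ≤ j) (hjk : j ≤ k) (X : (F.obj i).Ob) :
    (tr F hjk).obj ((tr F hij).obj X) = (tr F (hij.trans hjk)).obj X :=
  (congrArg (fun f : GCStarFun _ _ => f.obj X) (F.map_comp (homOfLE hij) (homOfLE hjk))).symm

lemma hcast_tr_tr {i j k : J} (hij : i ≤ j) (hjk : j ≤ k) {X Y : (F.obj i).Ob}
    (x : (F.obj i).Hom X Y) :
    (F.obj k).hcast (tr_tr_obj F hij hjk X) (tr_tr_obj F hij hjk Y)
      ((tr F hjk).map ((tr F hij).map x)) = (tr F (hij.trans hjk)).map x :=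
  GCStarFun.hcast_map_of_eq (F.map_comp (homOfLE hij) (homOfLE hjk)).symm x _ _

/-- Objects are identified if they become eventually equal. -/
def obSetoid : Setoid (Σ i, (F.obj i).Ob) where
  r a b := ∀ᶠ k in atTop, ∀ (h : a.1 ≤ k) (h' : b.1 ≤ k), (tr F h).obj a.2 = (tr F h').obj b.2
  iseqv :=
    { refl := fun _ => Eventually.of_forall fun _ _ _ => rfl
      symm := fun h => h.mono fun _ h h1 h2 => (h h2 h1).symm
      trans := fun {a b c} h h' => by
        filter_upwards [h, h', eventually_ge_atTop b.1] with k e e' hb h1 h2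
        exact (e h1 hb).trans (e' hb h2) }

/-- Germs of objects. -/
def Ob : Type u := Quotient (obSetoid F)

variable {F}

/-- The germ of an object. -/
def Ob.mk (i : J) (X : (F.obj i).Ob) : Ob F := Quotient.mk (obSetoid F) ⟨i, X⟩

namespace Ob

/-- An index at which a germ has a representative. -/
noncomputable def idx (P : Ob F) : J := (Quotient.out P).1

/-- The values of a representative of a germ. -/
noncomputable def val (P : Ob F) (k : J) (h : P.idx ≤ k) : (F.obj k).Ob :=
  (tr F h).obj (Quotient.out P).2

lemma mk_eq_mk_iff {i j : J} {X : (F.obj i).Ob} {Y : (F.obj j).Ob} : mk i X = mk j Y ↔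
    ∀ᶠ k in atTop, ∀ (h : i ≤ k) (h' : j ≤ k), (tr F h).obj X = (tr F h').obj Y :=
  Quotient.eq (r := obSetoid F)

lemma val_mk (i : J) (X : (F.obj i).Ob) : ∀ᶠ k in atTop, ∀ (h : i ≤ k) (h' : (mk i X).idx ≤ k),
    (tr F h).obj X = (mk i X).val k h' :=
  (obSetoid F).symm (Quotient.mk_out (s := obSetoid F) ⟨i, X⟩)

end Ob

/-- Indices at which two germs have representatives. -/
abbrev Idx (P Q : Ob F) : Type u := {k : J // P.idx ≤ k ∧ Q.idx ≤ k}

/-- The filter of large indices. -/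
def filt (P Q : Ob F) : Filter (Idx P Q) := comap Subtype.val atTop

/-- Families between different germs of objects have different index sets; this moves all eventual
statements to `J`, where they can be combined. -/
lemma eventually_filt {P Q : Ob F} {p : Idx P Q → Prop} :
    (∀ᶠ k in filt P Q, p k) ↔ ∀ᶠ k in atTop, ∀ h, p ⟨k, h⟩ := by
  rw [filt, eventually_comap]
  exact eventually_congr (Eventually.of_forall fun k =>
    ⟨fun h h' => h _ rfl, fun h a ha => by subst ha; exact h a.2⟩)

/-- Morphisms between representatives. -/
abbrev Val (P Q : Ob F) (k : Idx P Q) : Type u :=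
  (F.obj k.1).Hom (P.val k.1 k.2.1) (Q.val k.1 k.2.2)

/-- Families of morphisms between representatives. -/
abbrev Fam (P Q : Ob F) : Type u := ∀ k, Val P Q k

variable {P Q R S : Ob F}

open scoped Classical in
/-- Composition of families. -/
noncomputable def compFam (x : Fam Q R) (y : Fam P Q) : Fam P R := fun k =>
  if h : Q.idx ≤ k.1 then (F.obj k.1).comp (x ⟨k.1, h, k.2.2⟩) (y ⟨k.1, k.2.1, h⟩) else 0

/-- Involution of families. -/
noncomputable def starFam (x : Fam P Q) : Fam Q P := fun k => (F.obj k.1).star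
    (x ⟨k.1, k.2.2, k.2.1⟩)

/-- The parity operator on families. -/
noncomputable def parFam (x : Fam P Q) : Fam P Q := fun k => (F.obj k.1).par (x k)

lemma compFam_apply (x : Fam Q R) (y : Fam P Q) {k : J} (hP : P.idx ≤ k) (hQ : Q.idx ≤ k)
    (hR : R.idx ≤ k) :
    compFam x y ⟨k, hP, hR⟩ = (F.obj k).comp (x ⟨k, hQ, hR⟩) (y ⟨k, hP, hQ⟩) :=
  dif_pos hQ

lemma eventually_compFam (x : Fam Q R) (y : Fam P Q) (p : ∀ k, Val P R k → Prop)
    (h : ∀ᶠ k in atTop, ∀ (hP : P.idx ≤ k) (hQ : Q.idx ≤ k) (hR : R.idx ≤ k),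
      p ⟨k, hP, hR⟩ ((F.obj k).comp (x ⟨k, hQ, hR⟩) (y ⟨k, hP, hQ⟩))) :
    ∀ᶠ k in filt P R, p k (compFam x y k) := by
  rw [eventually_filt]
  filter_upwards [h, eventually_ge_atTop Q.idx] with k hk hQ h
  rw [compFam_apply x y h.1 hQ h.2]
  exact hk h.1 hQ h.2

lemma evBdd_iff {x : Fam P Q} : EvBdd (filt P Q) x ↔
    ∃ C, 0 < C ∧ ∀ᶠ k in atTop, ∀ h, ‖x ⟨k, h⟩‖ ≤ C := by
  constructor
  · rintro ⟨C, hC⟩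
    refine ⟨max C 1, lt_max_of_lt_right one_pos, ?_⟩
    filter_upwards [eventually_filt.mp hC] with k hk h using (hk h).trans (le_max_left _ _)
  · rintro ⟨C, -, hC⟩
    exact ⟨C, eventually_filt.mpr hC⟩

lemma evBdd_compFam {x : Fam Q R} {y : Fam P Q} (hx : EvBdd (filt Q R) x)
    (hy : EvBdd (filt P Q) y) : EvBdd (filt P R) (compFam x y) := by
  obtain ⟨C, hC0, hC⟩ := evBdd_iff.mp hx
  obtain ⟨D, hD0, hD⟩ := evBdd_iff.mp hy
  refine ⟨C * D, eventually_compFam x y (fun k z => ‖z‖ ≤ C * D) ?_⟩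
  filter_upwards [hC, hD] with k h1 h2 hP hQ hR
  exact ((F.obj k).norm_comp_le _ _).trans
    (mul_le_mul (h1 _) (h2 _) (norm_nonneg _) hC0.le)

lemma evBdd_starFam {x : Fam P Q} (hx : EvBdd (filt P Q) x) : EvBdd (filt Q P) (starFam x) := by
  obtain ⟨C, hC0, hC⟩ := evBdd_iff.mp hx
  refine evBdd_iff.mpr ⟨C, hC0, ?_⟩
  filter_upwards [hC] with k hk h using ((F.obj k).norm_star_le _).trans (hk _)

lemma evBdd_parFam {x : Fam P Q} (hx : EvBdd (filt P Q) x) : EvBdd (filt P Q) (parFam x) := by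
  obtain ⟨C, hC⟩ := hx
  exact ⟨C, hC.mono fun k hk => ((F.obj k.1).norm_par_le _).trans hk⟩

/-- This makes composition independent of the representatives; boundedness of one factor is used in
each term of `(a - a') b + a' (b - b')`. -/
lemma germ_compFam_congr {x x' : Fam Q R} {y y' : Fam P Q} (hx : EvBdd (filt Q R) x)
    (hx' : EvBdd (filt Q R) x') (hy : EvBdd (filt P Q) y) (hy' : EvBdd (filt P Q) y')
    (e : germ 𝕜 (filt Q R) x = germ 𝕜 (filt Q R) x')
    (e' : germ 𝕜 (filt P Q) y = germ 𝕜 (filt P Q) y') :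
    germ 𝕜 (filt P R) (compFam x y) = germ 𝕜 (filt P R) (compFam x' y') := by
  rw [germ_eq_germ_iff_forall_lt hx hx'] at e
  rw [germ_eq_germ_iff_forall_lt hy hy'] at e'
  rw [germ_eq_germ_iff_forall_lt (evBdd_compFam hx hy) (evBdd_compFam hx' hy')]
  obtain ⟨C, hC0, hC⟩ := evBdd_iff.mp hx'
  obtain ⟨D, hD0, hD⟩ := evBdd_iff.mp hy
  intro ε hε
  have hδ : 0 < ε / (C + D) := by positivity
  rw [eventually_filt]
  filter_upwards [eventually_filt.mp (e _ hδ), eventually_filt.mp (e' _ hδ), hC, hD,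
    eventually_ge_atTop Q.idx] with k h1 h2 h3 h4 hQ h
  rw [compFam_apply x y h.1 hQ h.2, compFam_apply x' y' h.1 hQ h.2]
  specialize h1 ⟨hQ, h.2⟩
  specialize h2 ⟨h.1, hQ⟩
  specialize h3 ⟨hQ, h.2⟩
  specialize h4 ⟨h.1, hQ⟩
  generalize x ⟨k, hQ, h.2⟩ = a at *
  generalize x' ⟨k, hQ, h.2⟩ = a' at *
  generalize y ⟨k, h.1, hQ⟩ = b at *
  generalize y' ⟨k, h.1, hQ⟩ = b' at *
  have e : (F.obj k).comp a b - (F.obj k).comp a' b' =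
      (F.obj k).comp (a - a') b + (F.obj k).comp a' (b - b') := by
    rw [(F.obj k).sub_comp, (F.obj k).comp_sub]; abel
  calc _ ≤ ‖a - a'‖ * ‖b‖ + ‖a'‖ * ‖b - b'‖ := by
        rw [e]
        exact (norm_add_le _ _).trans
          (add_le_add ((F.obj k).norm_comp_le _ _) ((F.obj k).norm_comp_le _ _))
    _ ≤ ‖a - a'‖ * D + C * ‖b - b'‖ := by gcongr
    _ < ε / (C + D) * D + C * (ε / (C + D)) := by gcongr
    _ = ε := by field_simp; ring

lemma germ_starFam_congr {x x' : Fam P Q} (hx : EvBdd (filt P Q) x) (hx' : EvBdd (filt P Q) x')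
    (e : germ 𝕜 (filt P Q) x = germ 𝕜 (filt P Q) x') :
    germ 𝕜 (filt Q P) (starFam x) = germ 𝕜 (filt Q P) (starFam x') := by
  rw [germ_eq_germ_iff_forall_lt hx hx'] at e
  rw [germ_eq_germ_iff_forall_lt (evBdd_starFam hx) (evBdd_starFam hx')]
  intro ε hε
  rw [eventually_filt]
  filter_upwards [eventually_filt.mp (e ε hε)] with k hk h
  rw [starFam, starFam, ← (F.obj k).star_sub]
  exact ((F.obj k).norm_star_le _).trans_lt (hk _)

lemma germ_parFam_congr {x x' : Fam P Q} (hx : EvBdd (filt P Q) x) (hx' : EvBdd (filt P Q) x')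
    (e : germ 𝕜 (filt P Q) x = germ 𝕜 (filt P Q) x') :
    germ 𝕜 (filt P Q) (parFam x) = germ 𝕜 (filt P Q) (parFam x') := by
  rw [germ_eq_germ_iff_forall_lt hx hx'] at e
  rw [germ_eq_germ_iff_forall_lt (evBdd_parFam hx) (evBdd_parFam hx')]
  intro ε hε
  filter_upwards [e ε hε] with k hk
  rw [parFam, parFam, ← map_sub]
  exact ((F.obj k.1).norm_par_le _).trans_lt hk

/-- Germs of morphisms. -/
abbrev Hom (P Q : Ob F) : Type u := Germ 𝕜 (filt P Q) (Val P Q)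

/-- A representative of a germ of morphisms. -/
noncomputable def rep (z : Hom P Q) : Fam P Q := (exists_germ z).choose

lemma evBdd_rep (z : Hom P Q) : EvBdd (filt P Q) (rep z) := (exists_germ z).choose_spec.1

lemma germ_rep (z : Hom P Q) : germ 𝕜 (filt P Q) (rep z) = z := (exists_germ z).choose_spec.2

/-- Composition of germs. -/
noncomputable def comp (z : Hom Q R) (w : Hom P Q) : Hom P R :=
  germ 𝕜 (filt P R) (compFam (rep z) (rep w))

/-- Involution of germs. -/
noncomputable def star (z : Hom P Q) : Hom Q P := germ 𝕜 (filt Q P) (starFam (rep z))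

lemma comp_germ {x : Fam Q R} {y : Fam P Q} (hx : EvBdd (filt Q R) x) (hy : EvBdd (filt P Q) y) :
    comp (germ 𝕜 (filt Q R) x) (germ 𝕜 (filt P Q) y) = germ 𝕜 (filt P R) (compFam x y) :=
  germ_compFam_congr (evBdd_rep _) hx (evBdd_rep _) hy (germ_rep _) (germ_rep _)

lemma star_germ {x : Fam P Q} (hx : EvBdd (filt P Q) x) :
    star (germ 𝕜 (filt P Q) x) = germ 𝕜 (filt Q P) (starFam x) :=
  germ_starFam_congr (evBdd_rep _) hx (germ_rep _)

/-- The parity operator on germs. -/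
noncomputable def par : Hom P Q →ₗ[𝕜] Hom P Q where
  toFun z := germ 𝕜 (filt P Q) (parFam (rep z))
  map_add' z w := by
    rw [← germ_add (evBdd_parFam (evBdd_rep z)) (evBdd_parFam (evBdd_rep w))]
    have h := (evBdd_rep z).add (evBdd_rep w)
    rw [germ_parFam_congr (evBdd_rep (z + w)) h
      (by rw [germ_rep, germ_add (evBdd_rep z) (evBdd_rep w), germ_rep, germ_rep])]
    exact germ_congr (Eventually.of_forall fun k => map_add _ _ _)
  map_smul' c z := by
    rw [RingHom.id_apply, ← germ_smul c (evBdd_parFam (evBdd_rep z))]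
    have h := (evBdd_rep z).smul c
    rw [germ_parFam_congr (evBdd_rep (c • z)) h
      (by rw [germ_rep, germ_smul c (evBdd_rep z), germ_rep])]
    exact germ_congr (Eventually.of_forall fun k => map_smul _ _ _)

lemma par_germ {x : Fam P Q} (hx : EvBdd (filt P Q) x) :
    par (germ 𝕜 (filt P Q) x) = germ 𝕜 (filt P Q) (parFam x) :=
  germ_parFam_congr (evBdd_rep _) hx (germ_rep _)

end GermCat

namespace GermCat

variable {J : Type u} [Preorder J] {F : J ⥤ GCStarCat.{u} 𝕜} {P Q R S : Ob F}

lemma ind {p : Hom P Q → Prop} (h : ∀ x : Fam P Q, EvBdd (filt P Q) x → p (germ 𝕜 (filt P Q) x))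
    (z : Hom P Q) : p z := by
  rw [← germ_rep z]
  exact h _ (evBdd_rep z)

lemma germ_congr_filt {x y : Fam P Q} (h : ∀ᶠ k in atTop, ∀ h, x ⟨k, h⟩ = y ⟨k, h⟩) :
    germ 𝕜 (filt P Q) x = germ 𝕜 (filt P Q) y :=
  germ_congr (eventually_filt.mpr h)

lemma comp_add (z : Hom Q R) (w w' : Hom P Q) : comp z (w + w') = comp z w + comp z w' := by
  induction z using ind with | _ x hx
  induction w using ind with | _ y hy
  induction w' using ind with | _ y' hy'
  rw [← germ_add hy hy', comp_germ hx (hy.add hy'), comp_germ hx hy, comp_germ hx hy',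
    ← germ_add (evBdd_compFam hx hy) (evBdd_compFam hx hy')]
  refine germ_congr_filt ?_
  filter_upwards [eventually_ge_atTop Q.idx] with k hQ h
  simp only [compFam_apply _ _ h.1 hQ h.2, (F.obj k).comp_add]

lemma add_comp (z z' : Hom Q R) (w : Hom P Q) : comp (z + z') w = comp z w + comp z' w := by
  induction z using ind with | _ x hx
  induction z' using ind with | _ x' hx'
  induction w using ind with | _ y hy
  rw [← germ_add hx hx', comp_germ (hx.add hx') hy, comp_germ hx hy, comp_germ hx' hy,
    ← germ_add (evBdd_compFam hx hy) (evBdd_compFam hx' hy)]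
  refine germ_congr_filt ?_
  filter_upwards [eventually_ge_atTop Q.idx] with k hQ h
  simp only [compFam_apply _ _ h.1 hQ h.2, (F.obj k).add_comp]

lemma comp_smul (c : 𝕜) (z : Hom Q R) (w : Hom P Q) : comp z (c • w) = c • comp z w := by
  induction z using ind with | _ x hx
  induction w using ind with | _ y hy
  rw [← germ_smul c hy, comp_germ hx (hy.smul c), comp_germ hx hy,
    ← germ_smul c (evBdd_compFam hx hy)]
  refine germ_congr_filt ?_
  filter_upwards [eventually_ge_atTop Q.idx] with k hQ h
  simp only [compFam_apply _ _ h.1 hQ h.2, (F.obj k).comp_smul]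

lemma smul_comp (c : 𝕜) (z : Hom Q R) (w : Hom P Q) : comp (c • z) w = c • comp z w := by
  induction z using ind with | _ x hx
  induction w using ind with | _ y hy
  rw [← germ_smul c hx, comp_germ (hx.smul c) hy, comp_germ hx hy,
    ← germ_smul c (evBdd_compFam hx hy)]
  refine germ_congr_filt ?_
  filter_upwards [eventually_ge_atTop Q.idx] with k hQ h
  simp only [compFam_apply _ _ h.1 hQ h.2, (F.obj k).smul_comp]

lemma assoc (z : Hom R S) (w : Hom Q R) (v : Hom P Q) :
    comp (comp z w) v = comp z (comp w v) := by
  induction z using ind with | _ x hx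
  induction w using ind with | _ y hy
  induction v using ind with | _ v hv
  rw [comp_germ hx hy, comp_germ hy hv, comp_germ (evBdd_compFam hx hy) hv,
    comp_germ hx (evBdd_compFam hy hv)]
  refine germ_congr_filt ?_
  filter_upwards [eventually_ge_atTop Q.idx, eventually_ge_atTop R.idx] with k hQ hR h
  rw [compFam_apply _ _ h.1 hQ h.2, compFam_apply _ _ h.1 hR h.2, compFam_apply _ _ h.1 hQ hR,
    compFam_apply _ _ hQ hR h.2, (F.obj k).assoc]

lemma star_add (z w : Hom P Q) : star (z + w) = star z + star w := by
  induction z using ind with | _ x hx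
  induction w using ind with | _ y hy
  rw [← germ_add hx hy, star_germ (hx.add hy), star_germ hx, star_germ hy,
    ← germ_add (evBdd_starFam hx) (evBdd_starFam hy)]
  exact germ_congr_filt (Eventually.of_forall fun k h => (F.obj k).star_add _ _)

lemma star_smul (c : 𝕜) (z : Hom P Q) : star (c • z) = starRingEnd 𝕜 c • star z := by
  induction z using ind with | _ x hx
  rw [← germ_smul c hx, star_germ (hx.smul c), star_germ hx, ← germ_smul _ (evBdd_starFam hx)]
  exact germ_congr_filt (Eventually.of_forall fun k h => (F.obj k).star_smul _ _)

lemma star_comp (z : Hom Q R) (w : Hom P Q) : star (comp z w) = comp (star w) (star z) := by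
  induction z using ind with | _ x hx
  induction w using ind with | _ y hy
  rw [comp_germ hx hy, star_germ hx, star_germ hy, star_germ (evBdd_compFam hx hy),
    comp_germ (evBdd_starFam hy) (evBdd_starFam hx)]
  refine germ_congr_filt ?_
  filter_upwards [eventually_ge_atTop Q.idx] with k hQ h
  rw [starFam, compFam_apply _ _ h.1 hQ h.2, compFam_apply _ _ h.2 hQ h.1, (F.obj k).star_comp]
  rfl

lemma star_star (z : Hom P Q) : star (star z) = z := by
  induction z using ind with | _ x hx
  rw [star_germ hx, star_germ (evBdd_starFam hx)]
  exact germ_congr_filt (Eventually.of_forall fun k h => (F.obj k).star_star _)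

lemma par_par (z : Hom P Q) : par (par z) = z := by
  induction z using ind with | _ x hx
  rw [par_germ hx, par_germ (evBdd_parFam hx)]
  exact germ_congr_filt (Eventually.of_forall fun k h => (F.obj k).toTStarCat.par_par _)

lemma par_star (z : Hom P Q) : par (star z) = star (par z) := by
  induction z using ind with | _ x hx
  rw [par_germ hx, star_germ hx, star_germ (evBdd_parFam hx), par_germ (evBdd_starFam hx)]
  exact germ_congr_filt (Eventually.of_forall fun k h => (F.obj k).toTStarCat.par_star _)

lemma par_comp (z : Hom Q R) (w : Hom P Q) : par (comp z w) = comp (par z) (par w) := by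
  induction z using ind with | _ x hx
  induction w using ind with | _ y hy
  rw [comp_germ hx hy, par_germ hx, par_germ hy, par_germ (evBdd_compFam hx hy),
    comp_germ (evBdd_parFam hx) (evBdd_parFam hy)]
  refine germ_congr_filt ?_
  filter_upwards [eventually_ge_atTop Q.idx] with k hQ h
  rw [parFam, compFam_apply _ _ h.1 hQ h.2, compFam_apply _ _ h.1 hQ h.2]
  exact (F.obj k).toTStarCat.par_comp _ _

lemma norm_comp_le (z : Hom Q R) (w : Hom P Q) : ‖comp z w‖ ≤ ‖z‖ * ‖w‖ := by
  induction z using ind with | _ x hx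
  induction w using ind with | _ y hy
  refine le_mul_of_forall_lt₀ fun r hr s hs => ?_
  rw [comp_germ hx hy]
  have hr0 : 0 ≤ r := (norm_nonneg _).trans hr.le
  have hs0 : 0 ≤ s := (norm_nonneg _).trans hs.le
  refine norm_germ_le (mul_nonneg hr0 hs0) (eventually_compFam x y (fun k z => ‖z‖ ≤ r * s) ?_)
  filter_upwards [eventually_filt.mp (eventually_norm_lt_of_norm_germ_lt hx hr),
    eventually_filt.mp (eventually_norm_lt_of_norm_germ_lt hy hs)] with k h1 h2 hP hQ hR
  exact ((F.obj k).norm_comp_le _ _).trans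
    (mul_le_mul (h1 _).le (h2 _).le (norm_nonneg _) hr0)

/-- The norm of a germ is an upper limit, and squaring is monotone on non-negative numbers, so the
C*-identity at the stages passes to germs. -/
lemma norm_star_comp_self (z : Hom P Q) : ‖comp (star z) z‖ = ‖z‖ ^ 2 := by
  induction z using ind with | _ x hx
  rw [star_germ hx, comp_germ (evBdd_starFam hx) hx]
  apply le_antisymm
  · rw [sq]
    refine le_mul_of_forall_lt₀ fun r hr s hs => ?_
    have hr0 : 0 ≤ r := (norm_nonneg _).trans hr.le
    have hs0 : 0 ≤ s := (norm_nonneg _).trans hs.le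
    refine norm_germ_le (mul_nonneg hr0 hs0)
      (eventually_compFam (starFam x) x (fun k z => ‖z‖ ≤ r * s) ?_)
    filter_upwards [eventually_filt.mp (eventually_norm_lt_of_norm_germ_lt hx hr),
      eventually_filt.mp (eventually_norm_lt_of_norm_germ_lt hx hs)] with k h1 h2 hP hQ _
    exact ((F.obj k).norm_comp_le _ _).trans
      (mul_le_mul (((F.obj k).norm_star_le _).trans (h1 _).le) (h2 _).le (norm_nonneg _) hr0)
  · refine le_of_forall_gt_imp_ge_of_dense fun r hr => ?_
    have hr0 : 0 ≤ r := (norm_nonneg _).trans hr.le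
    rw [← Real.le_sqrt (norm_nonneg _) hr0]
    refine norm_germ_le (Real.sqrt_nonneg _) ?_
    have h := eventually_norm_lt_of_norm_germ_lt (evBdd_compFam (evBdd_starFam hx) hx) hr
    rw [eventually_filt] at h ⊢
    filter_upwards [h, eventually_ge_atTop P.idx, eventually_ge_atTop Q.idx] with k h1 hP hQ h
    specialize h1 ⟨hP, hP⟩
    rw [compFam_apply _ _ hP hQ hP, starFam, (F.obj k).norm_star_comp_self] at h1
    exact Real.le_sqrt_of_sq_le h1.le

/-- The resolvents at the stages form a family bounded by `t⁻¹`, and its germ is the resolvent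
sought. -/
lemma star_comp_self_pos (z : Hom P Q) (t : ℝ) (ht : 0 < t) : ∃ r : Hom P P,
    comp (comp (star z) z) r + (t : 𝕜) • r + (t⁻¹ : 𝕜) • comp (star z) z = 0 ∧
    comp r (comp (star z) z) + (t : 𝕜) • r + (t⁻¹ : 𝕜) • comp (star z) z = 0 := by
  classical
  induction z using ind with | _ x hx
  choose r hr using fun k : Idx P Q => (F.obj k.1).star_comp_self_pos (x k) t ht
  have hn : ∀ k, ‖r k‖ ≤ t⁻¹ := fun k => GCStarCat.IsResolvent.norm_le ht (hr k)
  -- The resolvents exist only where `Q` has a representative. Families in `Fam P P` have more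
  -- indices, on which the value zero is harmless.
  let s : Fam P P := fun k => if h : Q.idx ≤ k.1 then r ⟨k.1, k.2.1, h⟩ else 0
  have hs : EvBdd (filt P P) s := EvBdd.of_le (C := t⁻¹) fun k => by
    simp only [s]
    split_ifs
    · exact hn _
    · rw [norm_zero]; positivity
  have hsx := evBdd_starFam hx
  have hp := evBdd_compFam hsx hx
  refine ⟨germ 𝕜 (filt P P) s, ?_, ?_⟩
  · rw [star_germ hx, comp_germ hsx hx, comp_germ hp hs, ← germ_smul _ hs, ← germ_smul _ hp,
      ← germ_add (evBdd_compFam hp hs) (hs.smul _),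
      ← germ_add ((evBdd_compFam hp hs).add (hs.smul _)) (hp.smul _), ← germ_zero]
    refine germ_congr_filt ?_
    filter_upwards [eventually_ge_atTop P.idx, eventually_ge_atTop Q.idx] with k hP hQ h
    rw [compFam_apply _ _ hP hP hP, compFam_apply _ _ hP hQ hP, starFam,
      show s ⟨k, hP, hP⟩ = r ⟨k, hP, hQ⟩ from dif_pos hQ]
    exact (hr ⟨k, hP, hQ⟩).1
  · rw [star_germ hx, comp_germ hsx hx, comp_germ hs hp, ← germ_smul _ hs, ← germ_smul _ hp,
      ← germ_add (evBdd_compFam hs hp) (hs.smul _),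
      ← germ_add ((evBdd_compFam hs hp).add (hs.smul _)) (hp.smul _), ← germ_zero]
    refine germ_congr_filt ?_
    filter_upwards [eventually_ge_atTop P.idx, eventually_ge_atTop Q.idx] with k hP hQ h
    rw [compFam_apply _ _ hP hP hP, compFam_apply _ _ hP hQ hP, starFam,
      show s ⟨k, hP, hP⟩ = r ⟨k, hP, hQ⟩ from dif_pos hQ]
    exact (hr ⟨k, hP, hQ⟩).2

end GermCat

open GermCat in
/-- The graded C*-category of germs of objects and of bounded families of morphisms. -/
noncomputable def germCat {J : Type u} [Preorder J] (F : J ⥤ GCStarCat.{u} 𝕜) : GCStarCat.{u} 𝕜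
    where
  Ob := Ob F
  Hom P Q := GermCat.Hom P Q
  normedAddCommGroup P Q := inferInstanceAs (NormedAddCommGroup (Germ 𝕜 (filt P Q) (Val P Q)))
  normedSpace P Q := inferInstanceAs (NormedSpace 𝕜 (Germ 𝕜 (filt P Q) (Val P Q)))
  completeSpace P Q := inferInstanceAs (CompleteSpace (Germ 𝕜 (filt P Q) (Val P Q)))
  comp := GermCat.comp
  comp_add := GermCat.comp_add
  add_comp := GermCat.add_comp
  comp_smul := GermCat.comp_smul
  smul_comp := GermCat.smul_comp
  assoc := GermCat.assoc
  star := GermCat.star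
  star_add := GermCat.star_add
  star_smul := GermCat.star_smul
  star_comp := GermCat.star_comp
  star_star := GermCat.star_star
  norm_comp_le := GermCat.norm_comp_le
  norm_star_comp_self := GermCat.norm_star_comp_self
  star_comp_self_pos := GermCat.star_comp_self_pos
  deg _ _ := parDeg GermCat.par
  isCompl_deg _ _ := isCompl_parDeg GermCat.par_par
  comp_mem_deg {X Y Z a b x y} hx hy := by
    rw [mem_parDeg] at hx hy ⊢
    rw [GermCat.par_comp, hx, hy, GermCat.smul_comp, GermCat.comp_smul, smul_smul, sgn_add]
  star_mem_deg {X Y a x} hx := by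
    rw [mem_parDeg] at hx ⊢
    rw [GermCat.par_star, hx, GermCat.star_smul, conj_sgn]

/-- Composition of graded C*-functors. -/
abbrev GCStarFun.comp {A B C : GCStarCat.{u} 𝕜} (f : GCStarFun A B) (g : GCStarFun B C) :
    GCStarFun A C :=
  CategoryStruct.comp (obj := GCStarCat.{u} 𝕜) f g

namespace GermCat

variable {J : Type u} [Preorder J] {F : J ⥤ GCStarCat.{u} 𝕜}

open scoped Classical in
/-- The family of images of a morphism. -/
noncomputable def legFam {i : J} {X Y : (F.obj i).Ob} (x : (F.obj i).Hom X Y) (P Q : Ob F) :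
    Fam P Q := fun k =>
  if h : ∃ hi : i ≤ k.1, (tr F hi).obj X = P.val k.1 k.2.1 ∧ (tr F hi).obj Y = Q.val k.1 k.2.2 then
    (F.obj k.1).hcast h.2.1 h.2.2 ((tr F h.1).map x) else 0

lemma legFam_eq {i : J} {X Y : (F.obj i).Ob} (x : (F.obj i).Hom X Y) {P Q : Ob F} {k : J}
    {h : P.idx ≤ k ∧ Q.idx ≤ k} (hi : i ≤ k) (hX : (tr F hi).obj X = P.val k h.1)
    (hY : (tr F hi).obj Y = Q.val k h.2) :
    legFam x P Q ⟨k, h⟩ = (F.obj k).hcast hX hY ((tr F hi).map x) :=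
  dif_pos (c := ∃ hi : i ≤ k, (tr F hi).obj X = P.val k h.1 ∧ (tr F hi).obj Y = Q.val k h.2)
    ⟨hi, hX, hY⟩

lemma evBdd_legFam {i : J} {X Y : (F.obj i).Ob} (x : (F.obj i).Hom X Y) (P Q : Ob F) :
    EvBdd (filt P Q) (legFam x P Q) := by
  refine .of_le (C := ‖x‖) fun k => ?_
  unfold legFam
  split_ifs with h
  · rw [GCStarCat.norm_hcast]
    exact GCStarCat.norm_map_le _ _
  · rw [norm_zero]; exact norm_nonneg _

lemma val_mk_eq (i : J) (X : (F.obj i).Ob) : ∀ᶠ k in atTop, ∃ hi : i ≤ k,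
    ∀ h, (tr F hi).obj X = (Ob.mk i X).val k h := by
  filter_upwards [Ob.val_mk i X, eventually_ge_atTop i] with k hk hi using ⟨hi, hk hi⟩

lemma eventually_legFam {i : J} (X Y : (F.obj i).Ob) : ∀ᶠ k in atTop,
    ∀ h : (Ob.mk i X).idx ≤ k ∧ (Ob.mk i Y).idx ≤ k, ∃ (hi : i ≤ k)
      (hX : (tr F hi).obj X = (Ob.mk i X).val k h.1) (hY : (tr F hi).obj Y = (Ob.mk i Y).val k h.2),
      ∀ x, legFam x (Ob.mk i X) (Ob.mk i Y) ⟨k, h⟩ = (F.obj k).hcast hX hY ((tr F hi).map x) := by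
  filter_upwards [val_mk_eq i X, val_mk_eq i Y] with k ⟨hi, hX⟩ ⟨_, hY⟩ h
  exact ⟨hi, hX h.1, hY h.2, fun x => legFam_eq x hi (hX h.1) (hY h.2)⟩

/-- The germ of a morphism, placed between two given germs of objects. -/
noncomputable def legHom {i : J} {X Y : (F.obj i).Ob} (x : (F.obj i).Hom X Y)
    (P Q : Ob F) : Hom P Q :=
  germ 𝕜 (filt P Q) (legFam x P Q)

section

variable {i : J} {X Y Z : (F.obj i).Ob}

lemma legHom_add (x y : (F.obj i).Hom X Y) : legHom (x + y) (Ob.mk i X) (Ob.mk i Y) =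
    legHom x (Ob.mk i X) (Ob.mk i Y) + legHom y (Ob.mk i X) (Ob.mk i Y) := by
  rw [legHom, legHom, legHom, ← germ_add (evBdd_legFam x _ _) (evBdd_legFam y _ _)]
  refine germ_congr_filt ?_
  filter_upwards [eventually_legFam X Y] with k hk h
  obtain ⟨hi, hX, hY, e⟩ := hk h
  simp only [e, map_add]

lemma legHom_smul (c : 𝕜) (x : (F.obj i).Hom X Y) : legHom (c • x) (Ob.mk i X) (Ob.mk i Y) =
    c • legHom x (Ob.mk i X) (Ob.mk i Y) := by
  rw [legHom, legHom, ← germ_smul c (evBdd_legFam x _ _)]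
  refine germ_congr_filt ?_
  filter_upwards [eventually_legFam X Y] with k hk h
  obtain ⟨hi, hX, hY, e⟩ := hk h
  simp only [e, map_smul]

lemma legHom_comp (x : (F.obj i).Hom Y Z) (y : (F.obj i).Hom X Y) :
    legHom ((F.obj i).comp x y) (Ob.mk i X) (Ob.mk i Z) =
      comp (legHom x (Ob.mk i Y) (Ob.mk i Z)) (legHom y (Ob.mk i X) (Ob.mk i Y)) := by
  rw [legHom, legHom, legHom, comp_germ (evBdd_legFam x _ _) (evBdd_legFam y _ _)]
  refine germ_congr_filt ?_
  filter_upwards [val_mk_eq i X, val_mk_eq i Y, val_mk_eq i Z,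
    eventually_ge_atTop (Ob.mk i Y).idx] with k ⟨hi, hX⟩ ⟨_, hY⟩ ⟨_, hZ⟩ hQ h
  rw [compFam_apply _ _ h.1 hQ h.2, legFam_eq _ hi (hX h.1) (hZ h.2),
    legFam_eq _ hi (hX h.1) (hY hQ), legFam_eq _ hi (hY hQ) (hZ h.2), (tr F hi).map_comp,
    GCStarCat.hcast_comp]

lemma legHom_star (x : (F.obj i).Hom X Y) : legHom ((F.obj i).star x) (Ob.mk i Y) (Ob.mk i X) =
    star (legHom x (Ob.mk i X) (Ob.mk i Y)) := by
  rw [legHom, legHom, star_germ (evBdd_legFam x _ _)]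
  refine germ_congr_filt ?_
  filter_upwards [val_mk_eq i X, val_mk_eq i Y] with k ⟨hi, hX⟩ ⟨_, hY⟩ h
  rw [starFam, legFam_eq _ hi (hX h.2) (hY h.1), legFam_eq _ hi (hY h.1) (hX h.2),
    (tr F hi).map_star, GCStarCat.hcast_star]

lemma legHom_par (x : (F.obj i).Hom X Y) : legHom ((F.obj i).par x) (Ob.mk i X) (Ob.mk i Y) =
    par (legHom x (Ob.mk i X) (Ob.mk i Y)) := by
  rw [legHom, legHom, par_germ (evBdd_legFam x _ _)]
  refine germ_congr_filt ?_
  filter_upwards [eventually_legFam X Y] with k hk h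
  obtain ⟨hi, hX, hY, e⟩ := hk h
  rw [parFam, e, e, (tr F hi).map_par, GCStarCat.hcast_par]

lemma legHom_tr {j : J} (h : i ≤ j) (x : (F.obj i).Hom X Y) :
    legHom ((tr F h).map x) (Ob.mk i X) (Ob.mk i Y) = legHom x (Ob.mk i X) (Ob.mk i Y) := by
  refine germ_congr_filt ?_
  filter_upwards [eventually_legFam X Y, eventually_ge_atTop j] with k hk hj h'
  obtain ⟨hi, hX, hY, e⟩ := hk h'
  rw [e, legFam_eq ((tr F h).map x) hj ((tr_tr_obj F h hj X).trans hX)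
    ((tr_tr_obj F h hj Y).trans hY), ← hcast_tr_tr F h hj, GCStarCat.hcast_hcast]

end

/-- The two germs of objects are free parameters of `legHom` so that a transport merely changes the
parameters. -/
lemma hcast_legHom {i : J} {X Y : (F.obj i).Ob} (x : (F.obj i).Hom X Y) {P P' Q Q' : (germCat F).Ob}
    (hP : P = P') (hQ : Q = Q') :
    (germCat F).hcast hP hQ (show (germCat F).Hom P Q from legHom x P Q) = legHom x P' Q' := by
  subst hP hQ; rfl

variable (F) in
/-- The germ of an object, as an object of the category of germs. -/
def legObj (i : J) (X : (F.obj i).Ob) : (germCat F).Ob := Ob.mk i X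

variable (F) in
/-- The linear map that sends a morphism to its germ. -/
noncomputable def legMap (i : J) (X Y : (F.obj i).Ob) :
    (F.obj i).Hom X Y →ₗ[𝕜] (germCat F).Hom (legObj F i X) (legObj F i Y) where
  toFun x := legHom x (Ob.mk i X) (Ob.mk i Y)
  map_add' := legHom_add
  map_smul' := legHom_smul

variable (F) in
/-- The functor that sends a morphism to its germ. -/
noncomputable def leg (i : J) : GCStarFun (F.obj i) (germCat F) where
  obj := legObj F i
  map {X Y} := legMap F i X Y
  map_comp := legHom_comp
  map_star := legHom_star
  map_mem_deg {X Y a x} hx := by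
    refine mem_parDeg.mpr ((legHom_par x).symm.trans ?_)
    rw [(F.obj i).par_of_mem_deg hx]
    exact legHom_smul _ x

lemma tr_comp_leg {i j : J} (h : i ≤ j) : (tr F h).comp (leg F j) = leg F i := by
  have ho : ∀ X : (F.obj i).Ob, legObj F j ((tr F h).obj X) = legObj F i X := fun X =>
    Ob.mk_eq_mk_iff.mpr (Eventually.of_forall fun k h1 h2 => tr_tr_obj F h h1 X)
  exact GCStarFun.ext_hcast ho fun {X Y} x =>
    (hcast_legHom ((tr F h).map x) (ho X) (ho Y)).trans (legHom_tr h x)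

/-- At late stages the chosen representatives agree with the images of `X` and `Y`, so the family of
`x` consists of transports of its actual images. -/
lemma eventually_norm_lt_of_norm_leg_lt {i : J} {X Y : (F.obj i).Ob} (x : (F.obj i).Hom X Y) {r : ℝ}
    (hr : ‖(leg F i).map x‖ < r) : ∀ᶠ k in atTop, ∀ h : i ≤ k, ‖(tr F h).map x‖ < r := by
  have h3 : ∀ᶠ k in filt (Ob.mk i X) (Ob.mk i Y), ‖legFam x (Ob.mk i X) (Ob.mk i Y) k‖ < r :=
    eventually_norm_lt_of_norm_germ_lt (evBdd_legFam x (Ob.mk i X) (Ob.mk i Y)) hr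
  filter_upwards [eventually_filt.mp h3, val_mk_eq i X, val_mk_eq i Y,
    eventually_ge_atTop (Ob.mk i X).idx, eventually_ge_atTop (Ob.mk i Y).idx]
    with k hk ⟨hi, hX⟩ ⟨_, hY⟩ hP hQ h
  have := hk ⟨hP, hQ⟩
  rwa [legFam_eq _ hi (hX hP) (hY hQ), GCStarCat.norm_hcast] at this

variable (F) in
/-- The cocone of germs. -/
noncomputable def cocone : Limits.Cocone F where
  pt := germCat F
  ι :=
    { app := leg F
      naturality := fun _ _ f => tr_comp_leg (leOfHom f) }

/-! ### Consequences of a functor to the category of germs. -/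

section Desc

variable {C : GCStarCat.{u} 𝕜} {φ : ∀ i, GCStarFun (F.obj i) C} {d : GCStarFun C (germCat F)}
  (hd : ∀ i, (φ i).comp d = leg F i)
include hd

lemma obj_leg_eq {i : J} (X : (F.obj i).Ob) : d.obj ((φ i).obj X) = (leg F i).obj X :=
  congrArg (fun f : GCStarFun (F.obj i) (germCat F) => f.obj X) (hd i)

/-- The functor `d` sends an object from a stage to its germ, so an equality in `C` becomes an
equality of germs, that is, an eventual equality. -/
lemma mk_eq_mk_of_obj_eq {i j : J} {X : (F.obj i).Ob} {Y : (F.obj j).Ob}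
    (h : (φ i).obj X = (φ j).obj Y) : Ob.mk i X = Ob.mk j Y :=
  (obj_leg_eq hd X).symm.trans ((congrArg d.obj h).trans (obj_leg_eq hd Y))

/-- The functor `d` is norm-decreasing and sends `(φ i).map x` to the germ of `x`, whose norm is the
upper limit of the norms at the stages. -/
lemma eventually_norm_tr_lt {i : J} {X Y : (F.obj i).Ob} (x : (F.obj i).Hom X Y) {ε : ℝ}
    (hε : 0 < ε) : ∀ᶠ k in atTop, ∀ h : i ≤ k, ‖(tr F h).map x‖ < ‖(φ i).map x‖ + ε := by
  apply eventually_norm_lt_of_norm_leg_lt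
  have h1 : (germCat F).hcast (obj_leg_eq hd X) (obj_leg_eq hd Y) (d.map ((φ i).map x)) =
    (leg F i).map x := GCStarFun.hcast_map_of_eq (hd i) x _ _
  rw [← h1, GCStarCat.norm_hcast]
  exact (GCStarCat.norm_map_le d _).trans_lt (lt_add_of_pos_right _ hε)

end Desc

end GermCat

/-! ### The unital case -/

/-- The functor that forgets units. -/
def forgetUnits : UGCStarCat.{u} 𝕜 ⥤ GCStarCat.{u} 𝕜 where
  obj A := A.toGCStarCat
  map f := f.toGCStarFun

lemma UGCStarCat.hcast_one (A : UGCStarCat.{u} 𝕜) {X X' : A.Ob} (h : X = X') :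
    A.hcast h h (A.one X) = A.one X' := by
  subst h; rfl

lemma UGCStarFun.toGCStarFun_injective {A B : UGCStarCat.{u} 𝕜} {f g : UGCStarFun A B}
    (h : f.toGCStarFun = g.toGCStarFun) : f = g := by
  cases f; cases g; cases h; rfl

/-- The C*-identity reads `‖e‖ = ‖e‖²`. For identities this gives the uniform bound by which they
define a germ. -/
lemma GCStarCat.norm_le_one_of_comp_self (A : GCStarCat.{u} 𝕜) {X : A.Ob} {e : A.Hom X X}
    (h1 : A.star e = e) (h2 : A.comp e e = e) : ‖e‖ ≤ 1 := by
  have h := A.norm_star_comp_self e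
  rw [h1, h2] at h
  rcases (norm_nonneg e).eq_or_lt with h0 | h0
  · rw [← h0]; exact zero_le_one
  · exact le_of_mul_le_mul_right (by rw [one_mul, ← sq, ← h]) h0

lemma UGCStarCat.star_one (A : UGCStarCat.{u} 𝕜) (X : A.Ob) : A.star (A.one X) = A.one X := by
  have h := A.star_comp (A.one X) (A.star (A.one X))
  rwa [A.one_comp, A.star_star, A.one_comp, eq_comm] at h

lemma UGCStarCat.norm_one_le (A : UGCStarCat.{u} 𝕜) (X : A.Ob) : ‖A.one X‖ ≤ 1 :=
  A.norm_le_one_of_comp_self (A.star_one X) (A.one_comp _)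

namespace GermCat

variable {J : Type u} [Preorder J] (F : J ⥤ UGCStarCat.{u} 𝕜)

/-- The family of identities. -/
noncomputable def oneFam (P : Ob (F ⋙ forgetUnits)) : Fam P P := fun k => (F.obj k.1).one _

lemma evBdd_oneFam (P : Ob (F ⋙ forgetUnits)) : EvBdd (filt P P) (oneFam F P) :=
  .of_le fun k => (F.obj k.1).norm_one_le _

/-- The unital graded C*-category of germs. -/
noncomputable def ucat : UGCStarCat.{u} 𝕜 where
  toGCStarCat := germCat (F ⋙ forgetUnits)
  one P := germ 𝕜 (filt P P) (oneFam F P)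
  one_comp {P Q} z := by
    induction z using ind with | _ x hx
    refine (comp_germ (evBdd_oneFam F Q) hx).trans (germ_congr_filt ?_)
    filter_upwards with k h
    rw [compFam_apply _ _ h.1 h.2 h.2]
    exact (F.obj k).one_comp _
  comp_one {P Q} z := by
    induction z using ind with | _ x hx
    refine (comp_germ hx (evBdd_oneFam F P)).trans (germ_congr_filt ?_)
    filter_upwards with k h
    rw [compFam_apply _ _ h.1 h.1 h.2]
    exact (F.obj k).comp_one _

lemma legHom_one (i : J) (X : (F.obj i).Ob) :
    legHom (F := F ⋙ forgetUnits) (i := i) ((F.obj i).one X) (Ob.mk i X) (Ob.mk i X) =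
      germ 𝕜 (filt _ _) (oneFam F (Ob.mk i X)) := by
  refine germ_congr_filt ?_
  filter_upwards [eventually_legFam (F := F ⋙ forgetUnits) (i := i) X X] with k hk h
  obtain ⟨hi, hX, hY, e⟩ := hk h
  exact (e _).trans ((congrArg _ ((F.map (homOfLE hi)).map_one X)).trans ((F.obj k).hcast_one _))

/-- The unital functor that sends a morphism to its germ. -/
noncomputable def uleg (i : J) : UGCStarFun (F.obj i) (ucat F) where
  toGCStarFun := leg (F ⋙ forgetUnits) i
  map_one := legHom_one F i

/-- The cocone of germs of unital categories. -/
noncomputable def ucocone : Limits.Cocone F where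
  pt := ucat F
  ι :=
    { app := uleg F
      naturality := fun _ _ f => UGCStarFun.toGCStarFun_injective
        (tr_comp_leg (F := F ⋙ forgetUnits) (leOfHom f)) }

end GermCat

/-! ### Continuity of the operations and of the resolvent. -/

namespace GCStarCat

variable {A : GCStarCat.{u} 𝕜}

lemma continuous_comp (A : GCStarCat.{u} 𝕜) {X Y Z : A.Ob} :
    Continuous fun p : A.Hom Y Z × A.Hom X Y => A.comp p.1 p.2 :=
  (LinearMap.mkContinuous₂ (A.toTStarCat.compₗ (X := X) (Y := Y) (Z := Z)) 1 fun x y => by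
    rw [one_mul]; exact A.norm_comp_le x y).continuous₂

lemma continuous_star (A : GCStarCat.{u} 𝕜) {X Y : A.Ob} :
    Continuous fun x : A.Hom X Y => A.star x :=
  AddMonoidHomClass.continuous_of_bound (A.toTStarCat.starₐ (X := X) (Y := Y)) 1 fun x => by
    rw [one_mul]; exact A.norm_star_le x

lemma continuous_par (A : GCStarCat.{u} 𝕜) {X Y : A.Ob} :
    Continuous fun x : A.Hom X Y => A.par x :=
  A.parFun.continuous_map

/-- The converse of `par_of_mem_deg`: the grading is recovered from its parity operator, so closed
subcategories can be graded by eigenspaces. -/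
lemma mem_deg_of_par_eq {X Y : A.Ob} {a : ZMod 2} {x : A.Hom X Y} (h : A.par x = sgn 𝕜 a • x) :
    x ∈ A.deg X Y a := by
  obtain ⟨y, hy, z, hz, rfl⟩ := A.exists_add_deg x
  rw [map_add, A.par_of_mem_zero hy, A.par_of_mem_one hz] at h
  rcases zmod_two_cases a with rfl | rfl
  · rw [sgn_zero, one_smul, add_right_inj, neg_eq_iff_add_eq_zero, ← two_smul 𝕜] at h
    rw [(smul_eq_zero.mp h).resolve_left two_ne_zero, add_zero]
    exact hy
  · rw [show sgn 𝕜 1 = -1 by simp [sgn], neg_smul, one_smul, neg_add, add_left_inj,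
      eq_neg_iff_add_eq_zero, ← two_smul 𝕜] at h
    rw [(smul_eq_zero.mp h).resolve_left two_ne_zero, zero_add]
    exact hz

/-- This is the resolvent identity `(p' + t)⁻¹ - (p + t)⁻¹ = (p' + t)⁻¹ (p - p') (p + t)⁻¹`,
expanded with the inverses written as `t⁻¹ + r'` and `t⁻¹ + r`. -/
lemma IsResolvent.sub_eq {X : A.Ob} {t : ℝ} (ht : 0 < t) {p p' r r' : A.Hom X X}
    (h : A.IsResolvent t p r) (h' : A.IsResolvent t p' r') :
    r' - r = (t⁻¹ : 𝕜) • (t⁻¹ : 𝕜) • (p - p') + (t⁻¹ : 𝕜) • A.comp r' (p - p') +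
      (t⁻¹ : 𝕜) • A.comp (p - p') r + A.comp (A.comp r' (p - p')) r := by
  have ht0 : (t : 𝕜) ≠ 0 := by exact_mod_cast ht.ne'
  have e1 : A.comp p r = (-(t : 𝕜)) • r - (t⁻¹ : 𝕜) • p := by
    rw [← sub_eq_zero, ← h.1, neg_smul]; abel
  have e2 : A.comp r' p' = (-(t : 𝕜)) • r' - (t⁻¹ : 𝕜) • p' := by
    rw [← sub_eq_zero, ← h'.2, neg_smul]; abel
  have e3 : A.comp (A.comp r' (p - p')) r =
      (t⁻¹ : 𝕜) • A.comp p' r - (t⁻¹ : 𝕜) • A.comp r' p := by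
    rw [A.comp_sub, A.sub_comp, A.assoc, e1, e2, A.comp_sub, A.sub_comp, A.comp_smul, A.smul_comp,
      A.comp_smul, A.smul_comp]
    abel
  rw [e3, A.comp_sub, A.sub_comp, e1, e2]
  simp only [smul_sub, neg_smul, smul_neg, smul_smul, inv_mul_cancel₀ ht0, one_smul]
  abel

/-- Each of the four terms of the resolvent identity has norm at most `t⁻²` times that of the
difference. -/
lemma IsResolvent.norm_sub_le {X Y : A.Ob} {t : ℝ} (ht : 0 < t) {x y : A.Hom X Y}
    {r s : A.Hom X X} (h : A.IsResolvent t (A.comp (A.star x) x) r)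
    (h' : A.IsResolvent t (A.comp (A.star y) y) s) :
    ‖s - r‖ ≤ 4 * t⁻¹ ^ 2 * ‖A.comp (A.star x) x - A.comp (A.star y) y‖ := by
  rw [h.sub_eq ht h']
  have h1 := h.norm_le ht
  have h2 := h'.norm_le ht
  generalize A.comp (A.star x) x - A.comp (A.star y) y = q
  have ht' : 0 < t⁻¹ := inv_pos.mpr ht
  have hn : ‖(t⁻¹ : 𝕜)‖ = t⁻¹ := by rw [norm_inv, RCLike.norm_ofReal, abs_of_pos ht]
  have b1 : ‖A.comp s q‖ ≤ t⁻¹ * ‖q‖ := (A.norm_comp_le _ _).trans (by gcongr)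
  have b2 : ‖A.comp q r‖ ≤ ‖q‖ * t⁻¹ := (A.norm_comp_le _ _).trans (by gcongr)
  have b3 : ‖A.comp (A.comp s q) r‖ ≤ (t⁻¹ * ‖q‖) * t⁻¹ :=
    (A.norm_comp_le _ _).trans (by gcongr)
  refine (norm_add_le _ _).trans ?_
  refine (add_le_add_left (norm_add₃_le) _).trans ?_
  rw [norm_smul, norm_smul, norm_smul, norm_smul, hn]
  calc _ ≤ t⁻¹ * (t⁻¹ * ‖q‖) + t⁻¹ * (t⁻¹ * ‖q‖) + t⁻¹ * (‖q‖ * t⁻¹) + (t⁻¹ * ‖q‖) * t⁻¹ := by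
        gcongr
    _ = _ := by ring

end GCStarCat

/-! ### The closed subcategory generated by a directed system -/

variable {J : Type u} [Preorder J] {F : J ⥤ GCStarCat.{u} 𝕜} {C : GCStarCat.{u} 𝕜}

/-- A compatible family of functors that identifies only objects that become eventually equal. -/
structure IsCompat (φ : ∀ i, GCStarFun (F.obj i) C) : Prop where
  comp : ∀ {i j} (h : i ≤ j), (GermCat.tr F h).comp (φ j) = φ i
  obj_eq : ∀ {i j X Y}, (φ i).obj X = (φ j).obj Y →
    ∀ᶠ k in atTop, ∀ (h : i ≤ k) (h' : j ≤ k), (GermCat.tr F h).obj X = (GermCat.tr F h').obj Y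

namespace IsCompat

variable {φ : ∀ i, GCStarFun (F.obj i) C} (H : IsCompat φ)

/-- Morphisms in the image. -/
def IsImage (φ : ∀ i, GCStarFun (F.obj i) C) {Z W : C.Ob} (y : C.Hom Z W) : Prop :=
  ∃ (i : J) (X Y : (F.obj i).Ob) (hX : (φ i).obj X = Z) (hY : (φ i).obj Y = W)
    (x : (F.obj i).Hom X Y), C.hcast hX hY ((φ i).map x) = y

include H

lemma obj_tr {i j : J} (h : i ≤ j) (X : (F.obj i).Ob) :
    (φ j).obj ((GermCat.tr F h).obj X) = (φ i).obj X :=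
  congrArg (fun f : GCStarFun (F.obj i) C => f.obj X) (H.comp h)

lemma hcast_map_tr {i j : J} (h : i ≤ j) {X Y : (F.obj i).Ob} (x : (F.obj i).Hom X Y) :
    C.hcast (H.obj_tr h X) (H.obj_tr h Y) ((φ j).map ((GermCat.tr F h).map x)) = (φ i).map x :=
  GCStarFun.hcast_map_of_eq (H.comp h) x _ _

lemma hcast_hcast_map_tr {i j : J} (h : i ≤ j) {X Y : (F.obj i).Ob} {Z W : C.Ob}
    (hX : (φ i).obj X = Z) (hY : (φ i).obj Y = W) (x : (F.obj i).Hom X Y) :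
    C.hcast ((H.obj_tr h X).trans hX) ((H.obj_tr h Y).trans hY) ((φ j).map
      ((GermCat.tr F h).map x)) =
      C.hcast hX hY ((φ i).map x) := by
  rw [← H.hcast_map_tr h x, C.hcast_hcast]

/-- A morphism in the image comes with its own source and target at a stage. These become equal to
any prescribed representatives later on, which is what permits adding and composing morphisms from
different stages. -/
lemma eventually_exists_map_eq {Z W : C.Ob} {y : C.Hom Z W} (hy : IsImage φ y) {i j : J}
    {X : (F.obj i).Ob} {Y : (F.obj j).Ob} (hX : (φ i).obj X = Z) (hY : (φ j).obj Y = W) :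
    ∀ᶠ k in atTop, ∀ (h : i ≤ k) (h' : j ≤ k),
      ∃ x : (F.obj k).Hom ((GermCat.tr F h).obj X) ((GermCat.tr F h').obj Y),
        C.hcast ((H.obj_tr h X).trans hX) ((H.obj_tr h' Y).trans hY) ((φ k).map x) = y := by
  obtain ⟨l, X', Y', hX', hY', x, rfl⟩ := hy
  filter_upwards [H.obj_eq (hX'.trans hX.symm), H.obj_eq (hY'.trans hY.symm),
    eventually_ge_atTop l] with k h1 h2 hl h h'
  refine ⟨(F.obj k).hcast (h1 hl h) (h2 hl h') ((GermCat.tr F hl).map x), ?_⟩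
  rw [GCStarFun.map_hcast, C.hcast_hcast]
  exact H.hcast_hcast_map_tr hl hX' hY' x

omit H in
lemma isImage_map {i : J} {X Y : (F.obj i).Ob} (x : (F.obj i).Hom X Y) :
    IsImage φ ((φ i).map x) :=
  ⟨i, X, Y, rfl, rfl, x, rfl⟩

omit H in
lemma isImage_smul {Z W : C.Ob} (c : 𝕜) {y : C.Hom Z W} (hy : IsImage φ y) :
    IsImage φ (c • y) := by
  obtain ⟨i, X, Y, rfl, rfl, x, rfl⟩ := hy
  exact ⟨i, X, Y, rfl, rfl, c • x, by rw [map_smul, map_smul]⟩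

omit H in
lemma isImage_star {Z W : C.Ob} {y : C.Hom Z W} (hy : IsImage φ y) : IsImage φ (C.star y) := by
  obtain ⟨i, X, Y, rfl, rfl, x, rfl⟩ := hy
  exact ⟨i, Y, X, rfl, rfl, (F.obj i).star x, by rw [(φ i).map_star, C.hcast_star]⟩

omit H in
lemma isImage_par {Z W : C.Ob} {y : C.Hom Z W} (hy : IsImage φ y) : IsImage φ (C.par y) := by
  obtain ⟨i, X, Y, rfl, rfl, x, rfl⟩ := hy
  exact ⟨i, X, Y, rfl, rfl, (F.obj i).par x, by rw [(φ i).map_par, C.hcast_par]⟩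

variable [IsDirectedOrder J] [Nonempty J]

lemma isImage_add {Z W : C.Ob} {y y' : C.Hom Z W} (hy : IsImage φ y) (hy' : IsImage φ y') :
    IsImage φ (y + y') := by
  obtain ⟨i, X, Y, hX, hY, x, rfl⟩ := hy
  obtain ⟨k, hk, hi⟩ :=
    ((H.eventually_exists_map_eq hy' hX hY).and (eventually_ge_atTop i)).exists
  obtain ⟨x', rfl⟩ := hk hi hi
  refine ⟨k, _, _, (H.obj_tr hi X).trans hX, (H.obj_tr hi Y).trans hY, (GermCat.tr F hi).map x +
    x', ?_⟩
  rw [map_add, map_add, H.hcast_hcast_map_tr hi]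

lemma isImage_comp {Z W V : C.Ob} (hV : ∃ i X, (φ i).obj X = V) {y : C.Hom W V}
    {y' : C.Hom Z W} (hy : IsImage φ y) (hy' : IsImage φ y') : IsImage φ (C.comp y y') := by
  obtain ⟨j, T, hT⟩ := hV
  obtain ⟨i, X, Y, hX, hY, x, rfl⟩ := hy'
  obtain ⟨k, ⟨hk, hi⟩, hj⟩ := (((H.eventually_exists_map_eq hy hY hT).and
    (eventually_ge_atTop i)).and (eventually_ge_atTop j)).exists
  obtain ⟨x', rfl⟩ := hk hi hj
  refine ⟨k, _, _, (H.obj_tr hi X).trans hX, (H.obj_tr hj T).trans hT,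
    (F.obj k).comp x' ((GermCat.tr F hi).map x), ?_⟩
  rw [(φ k).map_comp, C.hcast_comp _ ((H.obj_tr hi Y).trans hY), H.hcast_hcast_map_tr hi]

omit [Nonempty J] in
lemma isImage_zero {Z W : C.Ob} (hZ : ∃ i X, (φ i).obj X = Z) (hW : ∃ i X, (φ i).obj X = W) :
    IsImage φ (0 : C.Hom Z W) := by
  obtain ⟨i, X, hX⟩ := hZ
  obtain ⟨j, Y, hY⟩ := hW
  obtain ⟨k, hi, hj⟩ := exists_ge_ge i j
  exact ⟨k, _, _, (H.obj_tr hi X).trans hX, (H.obj_tr hj Y).trans hY, 0, by simp only [map_zero]⟩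

/-- Objects in the image. -/
def SubOb (_ : IsCompat φ) : Type u := {Z : C.Ob // ∃ i X, (φ i).obj X = Z}

/-- The closure of the morphisms in the image. -/
def closedHom (Z W : H.SubOb) : Submodule 𝕜 (C.Hom Z.1 W.1) :=
  Submodule.topologicalClosure
    { carrier := {y | IsImage φ y}
      add_mem' := H.isImage_add
      zero_mem' := H.isImage_zero Z.2 W.2
      smul_mem' := fun c _ => isImage_smul c }

omit H [IsDirectedOrder J] [Nonempty J] in
lemma exists_isResolvent {Z W : C.Ob} {y : C.Hom Z W} (hy : IsImage φ y) {t : ℝ} (ht : 0 < t) :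
    ∃ r : C.Hom Z Z, IsImage φ r ∧ C.IsResolvent t (C.comp (C.star y) y) r := by
  obtain ⟨i, X, Y, rfl, rfl, x, rfl⟩ := hy
  obtain ⟨r, h1, h2⟩ := (F.obj i).star_comp_self_pos x t ht
  refine ⟨(φ i).map r, isImage_map r, ?_, ?_⟩
  · rw [C.hcast_rfl, ← (φ i).map_star, ← (φ i).map_comp, ← (φ i).map_comp, ← map_smul, ← map_smul,
      ← map_add, ← map_add, h1, map_zero]
  · rw [C.hcast_rfl, ← (φ i).map_star, ← (φ i).map_comp, ← (φ i).map_comp, ← map_smul, ← map_smul,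
      ← map_add, ← map_add, h2, map_zero]

variable {Z W V : H.SubOb}

lemma mem_closedHom {y : C.Hom Z.1 W.1} :
    y ∈ H.closedHom Z W ↔ y ∈ closure {y : C.Hom Z.1 W.1 | IsImage φ y} := Iff.rfl

lemma comp_mem {y : C.Hom W.1 V.1} {y' : C.Hom Z.1 W.1} (hy : y ∈ H.closedHom W V)
    (hy' : y' ∈ H.closedHom Z W) : C.comp y y' ∈ H.closedHom Z V :=
  map_mem_closure₂ C.continuous_comp hy hy' fun _ h _ h' => H.isImage_comp V.2 h h'

lemma star_mem {y : C.Hom Z.1 W.1} (hy : y ∈ H.closedHom Z W) : C.star y ∈ H.closedHom W Z :=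
  map_mem_closure C.continuous_star hy fun _ h => isImage_star h

lemma par_mem {y : C.Hom Z.1 W.1} (hy : y ∈ H.closedHom Z W) : C.par y ∈ H.closedHom Z W :=
  map_mem_closure C.continuous_par hy fun _ h => isImage_par h

/-- For morphisms in the image the resolvent is the image of a resolvent; in general it is a limit
of such, by continuity of the resolvent. This gives the positivity axiom for the closed subcategory.
-/
lemma resolvent_mem {y : C.Hom Z.1 W.1} (hy : y ∈ H.closedHom Z W) {t : ℝ} (ht : 0 < t)
    {r : C.Hom Z.1 Z.1} (hr : C.IsResolvent t (C.comp (C.star y) y) r) :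
    r ∈ H.closedHom Z Z := by
  rw [mem_closedHom, Metric.mem_closure_iff]
  intro ε hε
  have hc : Continuous fun z : C.Hom Z.1 W.1 =>
      4 * t⁻¹ ^ 2 * ‖C.comp (C.star y) y - C.comp (C.star z) z‖ :=
    continuous_const.mul (continuous_const.sub
      (C.continuous_comp.comp (C.continuous_star.prodMk continuous_id))).norm
  have hn : {z : C.Hom Z.1 W.1 |
      4 * t⁻¹ ^ 2 * ‖C.comp (C.star y) y - C.comp (C.star z) z‖ < ε} ∈ 𝓝 y :=
    (isOpen_lt hc continuous_const).mem_nhds (by simpa using hε)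
  obtain ⟨z, hz, hzi⟩ := mem_closure_iff_nhds.mp (H.mem_closedHom.mp hy) _ hn
  obtain ⟨s, hs, hsr⟩ := exists_isResolvent hzi ht
  refine ⟨s, hs, ?_⟩
  rw [dist_comm, dist_eq_norm]
  exact (hr.norm_sub_le ht hsr).trans_lt hz

/-- The parity operator on the closure of the image. -/
noncomputable def subPar (Z W : H.SubOb) : H.closedHom Z W →ₗ[𝕜] H.closedHom Z W :=
  C.par.restrict fun _ => H.par_mem

/-- The closed subcategory generated by the image. -/
noncomputable def sub : GCStarCat.{u} 𝕜 where
  Ob := H.SubOb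
  Hom Z W := H.closedHom Z W
  normedAddCommGroup Z W := inferInstance
  normedSpace Z W := inferInstance
  completeSpace Z W := (Submodule.isClosed_topologicalClosure _).completeSpace_coe
  comp x y := ⟨C.comp x.1 y.1, H.comp_mem x.2 y.2⟩
  comp_add x y y' := Subtype.ext (C.comp_add _ _ _)
  add_comp x x' y := Subtype.ext (C.add_comp _ _ _)
  comp_smul c x y := Subtype.ext (C.comp_smul _ _ _)
  smul_comp c x y := Subtype.ext (C.smul_comp _ _ _)
  assoc x y z := Subtype.ext (C.assoc _ _ _)
  star x := ⟨C.star x.1, H.star_mem x.2⟩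
  star_add x y := Subtype.ext (C.star_add _ _)
  star_smul c x := Subtype.ext (C.star_smul _ _)
  star_comp x y := Subtype.ext (C.star_comp _ _)
  star_star x := Subtype.ext (C.star_star _)
  norm_comp_le x y := C.norm_comp_le x.1 y.1
  norm_star_comp_self x := C.norm_star_comp_self x.1
  star_comp_self_pos x t ht := by
    obtain ⟨r, h1, h2⟩ := C.star_comp_self_pos x.1 t ht
    exact ⟨⟨r, H.resolvent_mem x.2 ht ⟨h1, h2⟩⟩, Subtype.ext h1, Subtype.ext h2⟩
  deg Z W := parDeg (H.subPar Z W)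
  isCompl_deg Z W := isCompl_parDeg fun x => Subtype.ext (C.toTStarCat.par_par x.1)
  comp_mem_deg {X Y Z a b x y} hx hy := by
    rw [mem_parDeg] at hx hy ⊢
    have hx' : C.par x.1 = sgn 𝕜 a • x.1 := congrArg Subtype.val hx
    have hy' : C.par y.1 = sgn 𝕜 b • y.1 := congrArg Subtype.val hy
    refine Subtype.ext ((C.toTStarCat.par_comp x.1 y.1).trans ?_)
    change C.comp (C.par x.1) (C.par y.1) = sgn 𝕜 (a + b) • C.comp x.1 y.1
    rw [hx', hy', C.smul_comp, C.comp_smul, smul_smul, sgn_add]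
  star_mem_deg {X Y a x} hx := by
    rw [mem_parDeg] at hx ⊢
    have hx' : C.par x.1 = sgn 𝕜 a • x.1 := congrArg Subtype.val hx
    refine Subtype.ext ((C.toTStarCat.par_star x.1).trans ?_)
    change C.star (C.par x.1) = sgn 𝕜 a • C.star x.1
    rw [hx', C.star_smul, conj_sgn]

/-- The inclusion of the closed subcategory generated by the image. -/
noncomputable def incl : GCStarFun H.sub C where
  obj Z := Z.1
  map {Z W} := (H.closedHom Z W).subtype
  map_comp _ _ := rfl
  map_star _ := rfl
  map_mem_deg hx := C.mem_deg_of_par_eq (congrArg Subtype.val (mem_parDeg.mp hx))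

/-- The image of an object, as an object of the closed subcategory. -/
def subObj (i : J) (X : (F.obj i).Ob) : H.sub.Ob := ⟨(φ i).obj X, i, X, rfl⟩

/-- The map on morphisms into the closed subcategory. -/
noncomputable def subMap (i : J) (X Y : (F.obj i).Ob) :
    (F.obj i).Hom X Y →ₗ[𝕜] H.sub.Hom (H.subObj i X) (H.subObj i Y) where
  toFun x := ⟨(φ i).map x, subset_closure (isImage_map x)⟩
  map_add' x y := Subtype.ext (map_add (φ i).map x y)
  map_smul' c x := Subtype.ext (map_smul (φ i).map c x)

/-- The functors into the closed subcategory generated by their images. -/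
noncomputable def toSub (i : J) : GCStarFun (F.obj i) H.sub where
  obj := H.subObj i
  map {X Y} := H.subMap i X Y
  map_comp x y := Subtype.ext ((φ i).map_comp x y)
  map_star x := Subtype.ext ((φ i).map_star x)
  map_mem_deg hx := mem_parDeg.mpr (Subtype.ext (C.par_of_mem_deg ((φ i).map_mem_deg hx)))

lemma toSub_comp_incl (i : J) : (H.toSub i).comp H.incl = φ i := rfl

lemma tr_comp_toSub {i j : J} (h : i ≤ j) : (GermCat.tr F h).comp (H.toSub j) = H.toSub i := by
  have ho : ∀ X : (F.obj i).Ob, (H.toSub j).obj ((GermCat.tr F h).obj X) = (H.toSub i).obj X := fun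
    X =>
    Subtype.ext (H.obj_tr h X)
  refine GCStarFun.ext_hcast ho fun {X Y} x => Subtype.ext ?_
  exact (H.incl.map_hcast (ho X) (ho Y) _).trans (H.hcast_map_tr h x)

/-- A family whose limit is generated by the images is a direct limit. -/
theorem isDirectLimit {d : GCStarFun C (germCat F)} (hd : ∀ i, (φ i).comp d = GermCat.leg F i)
    {e : GCStarFun C H.sub} (he : e.comp H.incl = 𝟙 C) :
    IsDirectLimit (fun _ _ h => (GermCat.tr F h).toTStarFun) (fun i => (φ i).toTStarFun)
      (fun i => (F.obj i).bnorm) C.bnorm where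
  obj_surj Z := by
    -- The object `e.obj Z` lies in the image, and the inclusion sends it back to `Z`.
    obtain ⟨i, X, h⟩ := (e.obj Z).2
    exact ⟨i, X, h.trans (congrArg (fun f : GCStarFun C C => f.obj Z) he)⟩
  obj_inj i X Y h := (H.obj_eq h).mono fun k hk h => hk h h
  nrm_map_le i X Y x := GCStarCat.norm_map_le (φ i) x
  nrm_lt i X Y x ε hε := GermCat.eventually_norm_tr_lt hd x hε
  dense i X Y y ε hε := by
    have ho : ∀ Z, (e.obj Z).1 = Z := fun Z => congrArg (fun f : GCStarFun C C => f.obj Z) he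
    -- Up to transport `y` is the value of the inclusion at `e.map y`, so it lies in the closure of
    -- the image.
    have hy : C.hcast (ho _) (ho _) (e.map y).1 = y := GCStarFun.hcast_map_of_eq he y _ _
    obtain ⟨z, hz, hyz⟩ := Metric.mem_closure_iff.mp (H.mem_closedHom.mp (e.map y).2) ε hε
    filter_upwards [H.eventually_exists_map_eq hz (ho _).symm (ho _).symm] with k hk h
    obtain ⟨x, rfl⟩ := hk h h
    refine ⟨H.obj_tr h X, H.obj_tr h Y, x, ?_⟩
    change ‖C.hcast _ _ ((φ k).map x) - y‖ < ε
    rw [dist_comm, dist_eq_norm, ← C.norm_hcast (ho _) (ho _), map_sub, hy, C.hcast_hcast] at hyz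
    exact hyz

end IsCompat

/-! ### Colimits are concrete direct limits. -/

section Colimit

variable {J : Type u} [Preorder J] [IsDirectedOrder J] [Nonempty J]

/-- A colimit of small graded C*-categories is a direct limit in terms of its morphism sets. -/
theorem isDirectLimit_GCStarCat (F : J ⥤ GCStarCat.{u} 𝕜) (c : Limits.Cocone F)
    (hc : Limits.IsColimit c) :
    IsDirectLimit (fun _ _ h => GCStarFun.toTStarFun (F.map (homOfLE h)))
      (fun i => GCStarFun.toTStarFun (c.ι.app i)) (fun i => (F.obj i).bnorm) c.pt.bnorm := by
  -- The universal property gives a functor from the colimit to the category of germs, which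
  -- controls norms and equality of objects from above.
  have hd := hc.fac (GermCat.cocone F)
  have H : IsCompat (F := F) (C := c.pt) c.ι.app :=
    { comp := fun h => c.w (homOfLE h)
      obj_eq := fun h => GermCat.Ob.mk_eq_mk_iff.mp (GermCat.mk_eq_mk_of_obj_eq hd h) }
  let s : Limits.Cocone F :=
    { pt := H.sub
      ι :=
        { app := H.toSub
          naturality := fun _ _ f => H.tr_comp_toSub (leOfHom f) } }
  have hi : ∀ i, H.toSub i ≫ H.incl = c.ι.app i := H.toSub_comp_incl
  -- The functor into the closed subcategory followed by the inclusion agrees with the identity on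
  -- the cocone, hence is the identity.
  refine H.isDirectLimit hd (e := hc.desc s) (hc.hom_ext fun i => ?_)
  rw [← hi]
  exact congrArg (fun f : F.obj i ⟶ H.sub => f ≫ H.incl) (hc.fac s i)

variable {F : J ⥤ UGCStarCat.{u} 𝕜} {C : UGCStarCat.{u} 𝕜} {φ : ∀ i, UGCStarFun (F.obj i) C}
  (H : IsCompat (F := F ⋙ forgetUnits) (C := C.toGCStarCat) fun i => (φ i).toGCStarFun)

lemma IsCompat.one_mem (Z : H.SubOb) : C.one Z.1 ∈ H.closedHom Z Z := by
  obtain ⟨_, i, X, rfl⟩ := Z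
  exact subset_closure ⟨i, X, X, rfl, rfl, (F.obj i).one X, (φ i).map_one X⟩

/-- The closed subcategory of a unital category. -/
noncomputable def IsCompat.usub : UGCStarCat.{u} 𝕜 where
  toGCStarCat := H.sub
  one Z := ⟨C.one Z.1, H.one_mem Z⟩
  one_comp x := Subtype.ext (C.one_comp x.1)
  comp_one x := Subtype.ext (C.comp_one x.1)

/-- The inclusion of the closed subcategory of a unital category. -/
noncomputable def IsCompat.uincl : UGCStarFun H.usub C where
  toGCStarFun := H.incl
  map_one _ := rfl

/-- The unital functors into the closed subcategory. -/
noncomputable def IsCompat.toUSub (i : J) : UGCStarFun (F.obj i) H.usub where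
  toGCStarFun := H.toSub i
  map_one X := Subtype.ext ((φ i).map_one X)

end Colimit

/-- A colimit of small unital graded C*-categories is a direct limit in terms of its morphism
sets. -/
theorem isDirectLimit_UGCStarCat {J : Type u} [Preorder J] [IsDirectedOrder J] [Nonempty J]
    (F : J ⥤ UGCStarCat.{u} 𝕜) (c : Limits.Cocone F) (hc : Limits.IsColimit c) :
    IsDirectLimit (fun _ _ h => GCStarFun.toTStarFun (UGCStarFun.toGCStarFun (F.map (homOfLE h))))
      (fun i => GCStarFun.toTStarFun (UGCStarFun.toGCStarFun (c.ι.app i)))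
      (fun i => (F.obj i).bnorm) c.pt.bnorm := by
  have hd : ∀ i, (UGCStarFun.toGCStarFun (c.ι.app i)).comp
      (UGCStarFun.toGCStarFun (hc.desc (GermCat.ucocone F))) = GermCat.leg (F ⋙ forgetUnits) i :=
    fun i => congrArg UGCStarFun.toGCStarFun (hc.fac (GermCat.ucocone F) i)
  have H : IsCompat (F := F ⋙ forgetUnits) (C := c.pt.toGCStarCat)
      fun i => (UGCStarFun.toGCStarFun (c.ι.app i)) :=
    { comp := fun h => congrArg UGCStarFun.toGCStarFun (c.w (homOfLE h))
      obj_eq := fun h => GermCat.Ob.mk_eq_mk_iff.mp (GermCat.mk_eq_mk_of_obj_eq hd h) }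
  let s : Limits.Cocone F :=
    { pt := H.usub
      ι :=
        { app := H.toUSub
          naturality := fun _ _ f =>
            UGCStarFun.toGCStarFun_injective (H.tr_comp_toSub (leOfHom f)) } }
  have hi : ∀ i, s.ι.app i ≫ H.uincl = c.ι.app i := fun i => rfl
  have he : hc.desc s ≫ H.uincl = 𝟙 c.pt := hc.hom_ext fun i => by
    rw [← Category.assoc, hc.fac, hi, Category.comp_id]
  exact H.isDirectLimit hd (e := UGCStarFun.toGCStarFun (hc.desc s))
    (congrArg UGCStarFun.toGCStarFun he)

/-! ### K-theory of direct limits. -/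

section Main

variable {J : Type u} [Preorder J] [IsDirectedOrder J] [Nonempty J]

namespace IsDirectLimit

theorem isColimit_K1Unital (F : J ⥤ UTStarCat.{u} 𝕜) (c : Limits.Cocone F)
    (N : ∀ i, Bnorm (F.obj i).toTStarCat) (NC : Bnorm c.pt.toTStarCat)
    (H : IsDirectLimit (fun _ _ h => UTStarFun.toTStarFun (F.map (homOfLE h)))
      (fun i => UTStarFun.toTStarFun (c.ι.app i)) N NC) :
    Nonempty (Limits.IsColimit (K1Unital.mapCocone c)) :=
  isColimit_vanDaele (F ⋙ cliffU 1 1) ((cliffU 1 1).mapCocone c) (fun i => (N i).cliff 1 1)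
    (NC.cliff 1 1) (H.cliff 1 1)

/-- Both `K₁(A⁺)` and `K₁(𝔽_A)` are continuous, the latter because `𝔽_A` is the unitization of a
category of zero morphisms; their kernel is then continuous too. -/
theorem isColimit_K1NonUnital (F : J ⥤ TStarCat.{u} 𝕜) (c : Limits.Cocone F)
    (N : ∀ i, Bnorm (F.obj i)) (NC : Bnorm c.pt)
    (H : IsDirectLimit (A := F.obj) (fun _ _ h => F.map (homOfLE h))
      (C := c.pt) (fun i => c.ι.app i) N NC) :
    Nonempty (Limits.IsColimit (K1NonUnital.mapCocone c)) := by
  refine isColimit_kernel _ F c ?_ ?_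
  · exact isColimit_K1Unital (F ⋙ unitization) (unitization.mapCocone c) (fun i => (N i).plus)
      NC.plus H.plus
  · exact isColimit_K1Unital (F ⋙ zeroFunctor ⋙ unitization)
      ((zeroFunctor ⋙ unitization).mapCocone c) (fun i => (Bnorm.zeroCat (F.obj i)).plus)
      (Bnorm.zeroCat c.pt).plus H.zeroCat.plus

end IsDirectLimit
end Main
end GradedCStar

theorem mainTheorem8 {𝕜 : Type} [RCLike 𝕜] {J : Type u} [Preorder J] [IsDirectedOrder J]
    [Nonempty J] :
    (∀ (F : J ⥤ UGCStarCat.{u} 𝕜) (c : Limits.Cocone F), Nonempty (Limits.IsColimit c) →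
      Nonempty (Limits.IsColimit (UGCStarCat.K1Direct.mapCocone c)) ∧
      Nonempty (Limits.IsColimit (UGCStarCat.K1.mapCocone c)) ∧
      ∀ p q : ℕ, Nonempty (Limits.IsColimit ((UGCStarCat.K p q).mapCocone c))) ∧
    (∀ (F : J ⥤ GCStarCat.{u} 𝕜) (c : Limits.Cocone F), Nonempty (Limits.IsColimit c) →
      Nonempty (Limits.IsColimit (GCStarCat.K1.mapCocone c)) ∧
      ∀ p q : ℕ, Nonempty (Limits.IsColimit ((GCStarCat.K p q).mapCocone c))) := by
  refine ⟨fun F c ⟨hc⟩ => ?_, fun F c ⟨hc⟩ => ?_⟩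
  · have H := isDirectLimit_UGCStarCat F c hc
    refine ⟨IsDirectLimit.isColimit_vanDaele (F ⋙ forgetUGC) (forgetUGC.mapCocone c) _ _ H,
      IsDirectLimit.isColimit_K1Unital (F ⋙ forgetUGC) (forgetUGC.mapCocone c) _ _ H, fun p q => ?_⟩
    exact IsDirectLimit.isColimit_K1Unital (F ⋙ forgetUGC ⋙ cliffU p q)
      ((forgetUGC ⋙ cliffU p q).mapCocone c) _ _ (H.cliff p q)
  · have H := isDirectLimit_GCStarCat F c hc
    refine ⟨IsDirectLimit.isColimit_K1NonUnital (F ⋙ forgetGC) (forgetGC.mapCocone c) _ _ H,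
      fun p q => ?_⟩
    exact IsDirectLimit.isColimit_K1NonUnital (F ⋙ forgetGC ⋙ cliffT p q)
      ((forgetGC ⋙ cliffT p q).mapCocone c) _ _ (H.cliff p q)
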